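/- **Conventions.** Let $\mathbb K=\mathbb R$ or $\mathbb C$, let $G$ be an abelian group and $\rho\colon G\times G\to\mathbb K$ a commutation factor: $\rho(i,j)\rho(j,i)=1$ and $\rho(i+j,k)=\rho(i,k)\rho(j,k)$. Then $\rho(i,i)=\pm1$; call $i\in G$ even if $\rho(i,i)=1$ and odd if $\rho(i,i)=-1$. A $G$-graded algebra is $\rho$-commutative if $fg=\rho(|f|,|g|)gf$ for homogeneous $f,g$. *$\rho$-manifolds.* A $\rho$-manifold $(M,\mathscr O_\rho)$ is a connected $n$-dimensional smooth, real analytic or holomorphic manifold $M$, with function sheaf $\mathscr O$ (smooth functions with values in $\mathbb K=\mathbb R$ or $\mathbb C$, real analytic functions with $\mathbb K=\mathbb R$, holomorphic functions with $\mathbb K=\mathbb C$), together with a sheaf $\mathscr O_\rho$ of $G$-graded $\rho$-commutative $\mathbb K$-algebras which is locally, on charts $(x^1,\dots,x^n)$ of $M$, isomorphic to $\mathscr O[[x^{n+1},\dots,x^{n+m}]]_\bullet$. This denotes the algebra of finite sums of homogeneous formal power series in $\rho$-commuting indeterminates of fixed degrees $|x^{n+1}|,\dots,|x^{n+m}|\in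 G$; put $|x^a|=0$ for $a\le n$. Such $x=(x^1,\dots,x^{n+m})$ on an open set $U_x$ are called coordinates, and $\partial/\partial x^a$ is the $\rho$-derivation of degree $-|x^a|$ with $\partial x^b/\partial x^a=\delta_{ab}$. A vector field $X$ of degree $|X|\in G$ is a $\rho$-derivation of the sheaf $\mathscr O_\rho$, i.e. a family of linear maps $X$ of degree $|X|$ on the algebras $\mathscr O_\rho(U)$, compatible with restrictions, with $X(fg)=(Xf)g+\rho(|X|,|f|)f(Xg)$. In coordinates, $X=\sum_a X^a\,\partial/\partial x^a$ with $X^a=X(x^a)$. A vector field $Q$ is homological if $\rho(|Q|,|Q|)=-1$ and $[Q,Q]_\rho=2\,Q\circ Q=0$; then $(M,Q)$ is a $\rho$-Q-manifold. *Berezinian.* For a matrix $F=(f_{kl})$ with entries of degree $|f_{kl}|=i_k-i_l$, with all $i_k$ even or all $i_k$ odd, $\rho\mathrm{det}(F)$ is defined by $$\prod_k\Big(\sum_l f_{kl}t_l\Big)=\rho\mathrm{det}(F)\cdot\prod_k t_k$$ (ordered products) for indeterminates $t_k$ of degree $i_k$ with $t_kf=\rho(i_k,|f|)ft_k$ for scalars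 $f$, where $t_kt_l=-\rho(i_k,i_l)t_lt_k$ in the even case and $t_kt_l=\rho(i_k,i_l)t_lt_k$ in the odd case. For arbitrary degrees $i_k$, with blocks formed by the even and the odd indices, put $\rho\mathrm{Ber}(F)=\rho\mathrm{det}(F_{00}-F_{01}F_{11}^{-1}F_{10})\,\rho\mathrm{det}(F_{11})^{-1}$ if $F_{00}$ and $F_{11}$ are invertible, and $\rho\mathrm{Ber}(F)=0$ otherwise. The $\rho$-Berezinian bundle has a local frame $D(x)$ of degree $0$ for each coordinate system $x$, and $$D(y)=D(x)\,\rho\mathrm{Ber}\Big(\frac{\partial y^a}{\partial x^b}\Big),$$ where $\partial y^a/\partial x^b$ stands in row $b$ and column $a$ (degrees $i_b=-|x^b|$). A $\rho$-Berezin volume form $\mathrm{vol}$ is a global section of this bundle which is locally $\mathrm{vol}|_{U_x}=D(x)s(x)$ with $s(x)\in\mathscr O_\rho(U_x)$ invertible of degree $0$. The Lie derivative of a section along a vector field $X$ is given in coordinates by $$L_X(D(x)s)=D(x)\sum_a\rho(|x^a|,|x^a|+|X|)\frac{\partial}{\partial x^a}(X^as),$$ and a divergence of $X$ is a function $\mathrm{Div}_{\mathrm{vol}}X\in\mathscr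 O_\rho(M)$ such that $\mathrm{vol}\cdot\mathrm{Div}_{\mathrm{vol}}X=L_X(\mathrm{vol})$ in all coordinate systems. *Cohomology.* For a $\rho$-Q-manifold, $H^r_Q(M)$, $r\in\mathbb Z$, is the cohomology of the cochain complex with terms $\mathscr O_\rho(M)_{r|Q|}$ and differential $Q$. **Statement.** Let $(M,Q)$ be a $\rho$-Q-manifold with a $\rho$-Berezin volume form $\mathrm{vol}$. Then $Q$ has exactly one divergence $\mathrm{Div}_{\mathrm{vol}}Q\in\mathscr O_\rho(M)$. It is homogeneous of degree $|Q|$ and satisfies $$Q(\mathrm{Div}_{\mathrm{vol}}Q)=0 .$$ Consequently $\mathrm{Div}_{\mathrm{vol}}Q$ is a $1$-cocycle, and the modular class $[\mathrm{Div}_{\mathrm{vol}}Q]\in H^1_Q(M)$ is well defined. -/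

import Mathlib

open scoped ContDiff Manifold
open TopologicalSpace

universe u v

/-! ### Commutation factors and formal power series with `G`-graded indeterminates -/

/-- A commutation factor on the abelian group `G` with values in the field `K`. -/
structure CommutationFactor (G K : Type*) [AddCommGroup G] [Field K] where
  toFun : G → G → K
  mul_swap : ∀ i j, toFun i j * toFun j i = 1
  add_left : ∀ i j k, toFun (i + j) k = toFun i k * toFun j k

namespace CommutationFactor

variable {G K : Type*} [AddCommGroup G] [Field K]

instance : CoeFun (CommutationFactor G K) (fun _ => G → G → K) := ⟨toFun⟩

variable (ρ : CommutationFactor G K) {m : ℕ} (d : Fin m → G)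

/-- The degree of the monomial `ξ ^ w = (ξ 0) ^ (w 0) * (ξ 1) ^ (w 1) * ⋯`, for `|ξ b| = d b`. -/
def expDegree (w : Fin m →₀ ℕ) : G := ∑ b, w b • d b

/-- An exponent is admissible if every odd indeterminate, i.e. one with `ρ(|ξ b|, |ξ b|) = -1`,
occurs in it at most once. (As `ρ(i, i) = ± 1` always, "odd" is written as `ρ(i, i) ≠ 1`.) -/
def Admissible (w : Fin m →₀ ℕ) : Prop := ∀ b, ρ (d b) (d b) ≠ 1 → w b ≤ 1

/-- The scalar `c(w, v)` with `ξ ^ w * ξ ^ v = c(w, v) ξ ^ (w + v)`: each factor `ξ c` of `ξ ^ v` is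
moved to the left past the factors `ξ b`, `b > c`, of `ξ ^ w`. -/
def reorder (w v : Fin m →₀ ℕ) : K :=
  ∏ b, ∏ c, if c < b then ρ (d b) (d c) ^ (w b * v c) else 1

variable {d} in
theorem Admissible.of_add_left {w v : Fin m →₀ ℕ} (h : ρ.Admissible d (w + v)) :
    ρ.Admissible d w := fun b hb => by
  have := h b hb
  simp only [Finsupp.add_apply] at this
  omega

variable {d} in
theorem Admissible.of_add_right {w v : Fin m →₀ ℕ} (h : ρ.Admissible d (w + v)) :
    ρ.Admissible d v := fun b hb => by
  have := h b hb
  simp only [Finsupp.add_apply] at this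
  omega

theorem admissible_zero : ρ.Admissible d 0 := fun b _ => by simp

theorem expDegree_add (w v : Fin m →₀ ℕ) :
    expDegree d (w + v) = expDegree d w + expDegree d v := by
  simp [expDegree, add_smul, Finset.sum_add_distrib]

theorem expDegree_single (b : Fin m) : expDegree d (Finsupp.single b 1) = d b := by
  classical
  simp only [expDegree, Finsupp.single_apply, ite_smul, one_smul, zero_smul]
  simp

theorem reorder_add_left (w w' v : Fin m →₀ ℕ) :
    ρ.reorder d (w + w') v = ρ.reorder d w v * ρ.reorder d w' v := by
  simp only [reorder, ← Finset.prod_mul_distrib]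
  refine Finset.prod_congr rfl fun b _ => Finset.prod_congr rfl fun c _ => ?_
  split_ifs
  · rw [Finsupp.add_apply, add_mul, pow_add]
  · simp

theorem reorder_add_right (w v v' : Fin m →₀ ℕ) :
    ρ.reorder d w (v + v') = ρ.reorder d w v * ρ.reorder d w v' := by
  simp only [reorder, ← Finset.prod_mul_distrib]
  refine Finset.prod_congr rfl fun b _ => Finset.prod_congr rfl fun c _ => ?_
  split_ifs
  · rw [Finsupp.add_apply, mul_add, pow_add]
  · simp

theorem reorder_zero_left (v : Fin m →₀ ℕ) : ρ.reorder d 0 v = 1 := by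
  simp [reorder]

theorem reorder_zero_right (v : Fin m →₀ ℕ) : ρ.reorder d v 0 = 1 := by
  simp [reorder]

/-- The families of coefficients `f_w ∈ R` of the formal series `∑ f_w ξ ^ w` that lie in
`R⟦ξ⟧_• = ⨁ i, R⟦ξ⟧_i`: only admissible exponents occur, and the occurring monomials have only
finitely many degrees. -/
def seriesSubmodule (R : Type*) [CommRing R] [Algebra K R] :
    Submodule K ((Fin m →₀ ℕ) → R) where
  carrier := {f | (∀ w, ¬ ρ.Admissible d w → f w = 0) ∧
    {i | ∃ w, f w ≠ 0 ∧ expDegree d w = i}.Finite}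
  zero_mem' := ⟨fun _ _ => rfl, by simp⟩
  add_mem' := by
    rintro f g ⟨hf, hf'⟩ ⟨hg, hg'⟩
    refine ⟨fun w hw => by simp [hf w hw, hg w hw], (hf'.union hg').subset ?_⟩
    rintro i ⟨w, hw, rfl⟩
    by_cases h : f w = 0
    · exact Or.inr ⟨w, fun h' => hw (by simp [h, h']), rfl⟩
    · exact Or.inl ⟨w, h, rfl⟩
  smul_mem' := by
    rintro a f ⟨hf, hf'⟩
    refine ⟨fun w hw => by simp [hf w hw], hf'.subset ?_⟩
    rintro i ⟨w, hw, rfl⟩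
    exact ⟨w, fun h => hw (by simp [h]), rfl⟩

end CommutationFactor

/-- The `ρ`-commutative algebra `R⟦ξ 0, …, ξ (m-1)⟧_•` of formal power series with coefficients in
the commutative `K`-algebra `R`, in indeterminates of degrees `|ξ b| = d b ∈ G`. -/
def RhoSeries {G K : Type*} [AddCommGroup G] [Field K] (ρ : CommutationFactor G K) {m : ℕ}
    (d : Fin m → G) (R : Type*) [CommRing R] [Algebra K R] : Type _ :=
  ρ.seriesSubmodule d R

namespace RhoSeries

open CommutationFactor

variable {G K : Type*} [AddCommGroup G] [Field K] {ρ : CommutationFactor G K} {m : ℕ}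
  {d : Fin m → G} {R : Type*} [CommRing R] [Algebra K R]

noncomputable instance : AddCommGroup (RhoSeries ρ d R) :=
  inferInstanceAs (AddCommGroup (ρ.seriesSubmodule d R))

noncomputable instance : Module K (RhoSeries ρ d R) :=
  inferInstanceAs (Module K (ρ.seriesSubmodule d R))

/-- The coefficient of `ξ ^ w`. -/
def coeff (f : RhoSeries ρ d R) (w : Fin m →₀ ℕ) : R := f.1 w

@[ext] theorem ext {f g : RhoSeries ρ d R} (h : ∀ w, f.coeff w = g.coeff w) : f = g :=
  Subtype.ext (funext h)

theorem coeff_eq_zero (f : RhoSeries ρ d R) {w : Fin m →₀ ℕ} (h : ¬ ρ.Admissible d w) :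
    f.coeff w = 0 := f.2.1 w h

@[simp] theorem coeff_zero (w : Fin m →₀ ℕ) : (0 : RhoSeries ρ d R).coeff w = 0 := rfl

@[simp] theorem coeff_add (f g : RhoSeries ρ d R) (w : Fin m →₀ ℕ) :
    (f + g).coeff w = f.coeff w + g.coeff w := rfl

@[simp] theorem coeff_smul (a : K) (f : RhoSeries ρ d R) (w : Fin m →₀ ℕ) :
    (a • f).coeff w = a • f.coeff w := rfl

open Classical in
/-- The monomial `r ξ ^ w` (which is zero if an odd indeterminate occurs twice in it). -/
noncomputable def monomial (w : Fin m →₀ ℕ) (r : R) : RhoSeries ρ d R :=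
  ⟨fun v => if v = w ∧ ρ.Admissible d w then r else 0,
    fun v hv => if_neg (by rintro ⟨rfl, h⟩; exact hv h),
    (Set.finite_singleton (expDegree d w)).subset (by
      rintro i ⟨v, hv, rfl⟩
      by_cases h : v = w
      · simp [h]
      · exact absurd (if_neg (fun h' => h h'.1)) hv)⟩

open Classical in
theorem coeff_monomial (w v : Fin m →₀ ℕ) (r : R) :
    (monomial w r : RhoSeries ρ d R).coeff v =
      if v = w ∧ ρ.Admissible d w then r else 0 := rfl

noncomputable instance : One (RhoSeries ρ d R) := ⟨monomial 0 1⟩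

open Classical in
theorem coeff_one (v : Fin m →₀ ℕ) :
    (1 : RhoSeries ρ d R).coeff v = if v = 0 then 1 else 0 := by
  change (monomial 0 1 : RhoSeries ρ d R).coeff v = _
  simp [coeff_monomial, ρ.admissible_zero d]

open Classical in
/-- The product `(∑ f_w ξ ^ w) (∑ g_v ξ ^ v) = ∑ f_w g_v c(w, v) ξ ^ (w + v)`. -/
noncomputable instance : Mul (RhoSeries ρ d R) :=
  ⟨fun f g => ⟨fun w => if ρ.Admissible d w then
      ∑ p ∈ Finset.HasAntidiagonal.antidiagonal w,
        ρ.reorder d p.1 p.2 • (f.coeff p.1 * g.coeff p.2) else 0,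
    fun w hw => if_neg hw,
    ((f.2.2.prod g.2.2).image (fun q => q.1 + q.2)).subset (by
      rintro i ⟨w, hw, rfl⟩
      have hw' : (if ρ.Admissible d w then
        ∑ p ∈ Finset.HasAntidiagonal.antidiagonal w,
        ρ.reorder d p.1 p.2 • (f.coeff p.1 * g.coeff p.2)
          else 0) ≠ 0 := hw
      split_ifs at hw' with h
      · obtain ⟨p, hp, hne⟩ := Finset.exists_ne_zero_of_sum_ne_zero hw'
        rw [Finset.HasAntidiagonal.mem_antidiagonal] at hp
        refine ⟨(expDegree d p.1, expDegree d p.2), ⟨⟨p.1, fun h0 => hne ?_, rfl⟩,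
          ⟨p.2, fun h0 => hne ?_, rfl⟩⟩, ?_⟩
        · have : f.coeff p.1 = 0 := h0
          simp [this]
        · have : g.coeff p.2 = 0 := h0
          simp [this]
        · simp only [← hp, expDegree_add]
      · exact absurd rfl hw')⟩⟩

open Classical in
theorem coeff_mul (f g : RhoSeries ρ d R) (w : Fin m →₀ ℕ) :
    (f * g).coeff w = if ρ.Admissible d w then
      ∑ p ∈ Finset.HasAntidiagonal.antidiagonal w,
        ρ.reorder d p.1 p.2 • (f.coeff p.1 * g.coeff p.2) else 0 :=
  rfl

protected theorem one_mul' (f : RhoSeries ρ d R) : 1 * f = f := by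
  classical
  ext w
  rw [coeff_mul]
  split_ifs with h
  · rw [Finset.sum_eq_single (0, w)]
    · simp [coeff_one, reorder_zero_left]
    · rintro ⟨a, b⟩ hp hne
      rw [Finset.HasAntidiagonal.mem_antidiagonal] at hp
      have : a ≠ 0 := by
        rintro rfl
        exact hne (by simpa using hp)
      simp [coeff_one, this]
    · simp
  · exact (f.coeff_eq_zero h).symm

protected theorem mul_one' (f : RhoSeries ρ d R) : f * 1 = f := by
  classical
  ext w
  rw [coeff_mul]
  split_ifs with h
  · rw [Finset.sum_eq_single (w, 0)]
    · simp [coeff_one, reorder_zero_right]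
    · rintro ⟨a, b⟩ hp hne
      rw [Finset.HasAntidiagonal.mem_antidiagonal] at hp
      have : b ≠ 0 := by
        rintro rfl
        exact hne (by simpa using hp)
      simp [coeff_one, this]
    · simp
  · exact (f.coeff_eq_zero h).symm

protected theorem mul_assoc' (f g h : RhoSeries ρ d R) : f * g * h = f * (g * h) := by
  classical
  ext w
  rw [coeff_mul, coeff_mul]
  split_ifs with hw
  · have e1 : ∀ p ∈ Finset.HasAntidiagonal.antidiagonal w,
        ρ.reorder d p.1 p.2 • ((f * g).coeff p.1 * h.coeff p.2) =
        ∑ q ∈ Finset.HasAntidiagonal.antidiagonal p.1, (ρ.reorder d p.1 p.2 * ρ.reorder d q.1 q.2) •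
          (f.coeff q.1 * g.coeff q.2 * h.coeff p.2) := by
      intro p hp
      rw [Finset.HasAntidiagonal.mem_antidiagonal] at hp
      have : ρ.Admissible d p.1 := Admissible.of_add_left (v := p.2) ρ (by rwa [hp])
      rw [coeff_mul, if_pos this, Finset.sum_mul, Finset.smul_sum]
      refine Finset.sum_congr rfl fun q _ => ?_
      rw [smul_mul_assoc, smul_smul]
    have e2 : ∀ p ∈ Finset.HasAntidiagonal.antidiagonal w,
        ρ.reorder d p.1 p.2 • (f.coeff p.1 * (g * h).coeff p.2) =
        ∑ q ∈ Finset.HasAntidiagonal.antidiagonal p.2, (ρ.reorder d p.1 p.2 * ρ.reorder d q.1 q.2) •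
          (f.coeff p.1 * g.coeff q.1 * h.coeff q.2) := by
      intro p hp
      rw [Finset.HasAntidiagonal.mem_antidiagonal] at hp
      have : ρ.Admissible d p.2 := Admissible.of_add_right (w := p.1) ρ (by rwa [hp])
      rw [coeff_mul, if_pos this, Finset.mul_sum, Finset.smul_sum]
      refine Finset.sum_congr rfl fun q _ => ?_
      rw [mul_smul_comm, smul_smul, mul_assoc]
    rw [Finset.sum_congr rfl e1, Finset.sum_congr rfl e2, Finset.sum_sigma', Finset.sum_sigma']
    refine Finset.sum_nbij' (fun x => ⟨(x.2.1, x.2.2 + x.1.2), (x.2.2, x.1.2)⟩)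
      (fun x => ⟨(x.1.1 + x.2.1, x.2.2), (x.1.1, x.2.1)⟩) ?_ ?_ ?_ ?_ ?_
    · rintro ⟨⟨a, b⟩, ⟨c, e⟩⟩ hx
      simp only [Finset.mem_sigma, Finset.HasAntidiagonal.mem_antidiagonal] at hx ⊢
      exact ⟨by rw [← add_assoc, hx.2, hx.1], trivial⟩
    · rintro ⟨⟨a, b⟩, ⟨c, e⟩⟩ hx
      simp only [Finset.mem_sigma, Finset.HasAntidiagonal.mem_antidiagonal] at hx ⊢
      exact ⟨by rw [add_assoc, hx.2, hx.1], trivial⟩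
    · rintro ⟨⟨a, b⟩, ⟨c, e⟩⟩ hx
      simp only [Finset.mem_sigma, Finset.HasAntidiagonal.mem_antidiagonal] at hx ⊢
      obtain ⟨h1, h2⟩ := hx
      subst h2
      rfl
    · rintro ⟨⟨a, b⟩, ⟨c, e⟩⟩ hx
      simp only [Finset.mem_sigma, Finset.HasAntidiagonal.mem_antidiagonal] at hx ⊢
      obtain ⟨h1, h2⟩ := hx
      subst h2
      rfl
    · rintro ⟨⟨a, b⟩, ⟨c, e⟩⟩ hx
      simp only [Finset.mem_sigma, Finset.HasAntidiagonal.mem_antidiagonal] at hx ⊢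
      obtain ⟨h1, h2⟩ := hx
      subst h2
      congr 1
      simp only [reorder_add_left, reorder_add_right]
      ring
  · rfl

noncomputable instance : Ring (RhoSeries ρ d R) :=
  { (inferInstance : AddCommGroup (RhoSeries ρ d R)),
    (inferInstance : Mul (RhoSeries ρ d R)), (inferInstance : One (RhoSeries ρ d R)) with
    one_mul := RhoSeries.one_mul'
    mul_one := RhoSeries.mul_one'
    mul_assoc := RhoSeries.mul_assoc'
    zero_mul := fun f => by
      ext w
      simp [coeff_mul]
    mul_zero := fun f => by
      ext w
      simp [coeff_mul]
    left_distrib := fun f g h => by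
      ext w
      simp only [coeff_mul, coeff_add]
      split_ifs
      · simp only [mul_add, smul_add, Finset.sum_add_distrib]
      · simp
    right_distrib := fun f g h => by
      ext w
      simp only [coeff_mul, coeff_add]
      split_ifs
      · simp only [add_mul, smul_add, Finset.sum_add_distrib]
      · simp }

noncomputable instance : Algebra K (RhoSeries ρ d R) :=
  Algebra.ofModule
    (fun a f g => by
      ext w
      simp only [coeff_mul, coeff_smul]
      split_ifs
      · rw [Finset.smul_sum]
        refine Finset.sum_congr rfl fun p _ => ?_
        rw [smul_mul_assoc, smul_comm]
      · simp)
    (fun a f g => by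
      ext w
      simp only [coeff_mul, coeff_smul]
      split_ifs
      · rw [Finset.smul_sum]
        refine Finset.sum_congr rfl fun p _ => ?_
        rw [mul_smul_comm, smul_comm]
      · simp)

/-- `f` is homogeneous of degree `i`: only monomials of degree `i` occur. -/
def IsHomogeneous (f : RhoSeries ρ d R) (i : G) : Prop :=
  ∀ w, f.coeff w ≠ 0 → expDegree d w = i

/-- The operation `∑ f_w ξ ^ w ↦ ∑ D(f_w) ξ ^ w`. -/
def mapCoeff {S : Type*} [CommRing S] [Algebra K S] (D : R → S) (hD : D 0 = 0)
    (f : RhoSeries ρ d R) : RhoSeries ρ d S :=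
  ⟨fun w => D (f.coeff w), fun w hw => by simp [f.coeff_eq_zero hw, hD],
    f.2.2.subset (by
      rintro i ⟨w, hw, rfl⟩
      refine ⟨w, fun h => hw ?_, rfl⟩
      have : f.coeff w = 0 := h
      simp [this, hD])⟩

/-- The partial derivative `∂/∂ξ b`, the `ρ`-derivation of degree `-|ξ b|` that kills `R` and has
`∂(ξ c)/∂(ξ b) = δ_bc`: in `∂(ξ ^ (w + e_b))/∂(ξ b)` the derivation first passes the factors `ξ c`,
`c < b`. -/
noncomputable def formalPartial (b : Fin m) (f : RhoSeries ρ d R) : RhoSeries ρ d R :=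
  ⟨fun w => (((w b : K) + 1) * ∏ c, if c < b then ρ (-d b) (d c) ^ (w c) else 1) •
      f.coeff (w + Finsupp.single b 1),
    fun w hw => by
      have : f.coeff (w + Finsupp.single b 1) = 0 :=
        f.coeff_eq_zero (fun h => hw (Admissible.of_add_left ρ h))
      simp [this],
    (f.2.2.image (fun i => i - d b)).subset (by
      rintro i ⟨w, hw, rfl⟩
      refine ⟨expDegree d (w + Finsupp.single b 1), ⟨_, fun h => hw ?_, rfl⟩, ?_⟩
      · have : f.coeff (w + Finsupp.single b 1) = 0 := h
        simp [this]
      · simp [expDegree_add, expDegree_single])⟩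

end RhoSeries

/-! ### Functions on the underlying manifold -/

section BaseFunctions

variable (𝕜 K : Type*) [RCLike 𝕜] [RCLike K] [NormedAlgebra 𝕜 K] (k : ℕ∞ω) {n : ℕ}
  {M : Type u} [TopologicalSpace M] [ChartedSpace (EuclideanSpace 𝕜 (Fin n)) M]

/-- The algebra `𝒪(V)` of `K`-valued functions of class `C^k` on the open subset `V` of a manifold
over `𝕜`. For `k = ∞`, `𝕜 = ℝ` these are the smooth functions with values in `K = ℝ` or `K = ℂ`; for
`k = ω` they are the real analytic functions (`𝕜 = K = ℝ`) or the holomorphic functions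
(`𝕜 = K = ℂ`). -/
def baseFunctions (V : Opens M) : Subalgebra K (V → K) where
  carrier := {f | ContMDiff 𝓘(𝕜, EuclideanSpace 𝕜 (Fin n)) 𝓘(𝕜, K) k f}
  mul_mem' := fun hf hg =>
    (contDiff_mul (𝕜 := 𝕜) (𝔸 := K)).contMDiff.comp (hf.prodMk_space hg)
  add_mem' := fun hf hg =>
    (contDiff_add (𝕜 := 𝕜) (F := K)).contMDiff.comp (hf.prodMk_space hg)
  algebraMap_mem' := fun _ => contMDiff_const

variable {𝕜 K k}

/-- Restriction of functions to a smaller open set. -/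
def baseFunctions.restrict {U V : Opens M} (h : V ≤ U) (f : baseFunctions 𝕜 K k (n := n) U) :
    baseFunctions 𝕜 K k (n := n) V :=
  ⟨fun p => f.1 ⟨p.1, h p.2⟩, f.2.comp (contMDiff_inclusion h)⟩

open Classical in
/-- Extension of a function on `V` by zero. -/
noncomputable def extendByZero {V : Opens M} (f : V → K) : M → K :=
  fun p => if h : p ∈ V then f ⟨p, h⟩ else 0

theorem contMDiffAt_extendByZero {V : Opens M} (f : baseFunctions 𝕜 K k (n := n) V) (p : V) :
    ContMDiffAt 𝓘(𝕜, EuclideanSpace 𝕜 (Fin n)) 𝓘(𝕜, K) k (extendByZero f.1) p.1 := by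
  rw [← contMDiffAt_subtype_iff]
  have : (fun x : V => extendByZero f.1 x.1) = f.1 := by
    funext x
    simp [extendByZero]
  rw [this]
  exact f.2 p

variable [IsManifold 𝓘(𝕜, EuclideanSpace 𝕜 (Fin n)) k M]
  {φ : OpenPartialHomeomorph M (EuclideanSpace 𝕜 (Fin n))}

/-- The `a`-th coordinate of the chart `φ` as a function on the open subset `V` of its domain. -/
noncomputable def baseCoord (hφ : φ ∈ IsManifold.maximalAtlas 𝓘(𝕜, EuclideanSpace 𝕜 (Fin n)) k M)
    {V : Opens M} (hV : (V : Set M) ⊆ φ.source) (a : Fin n) : baseFunctions 𝕜 K k (n := n) V :=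
  ⟨fun p => algebraMap 𝕜 K (φ p.1 a), by
    have h1 : ContMDiff 𝓘(𝕜, EuclideanSpace 𝕜 (Fin n)) 𝓘(𝕜, EuclideanSpace 𝕜 (Fin n)) k
        (fun p : V => φ p.1) := fun p =>
      contMDiffAt_subtype_iff.2
        (contMDiffAt_of_mem_maximalAtlas hφ (hV p.2))
    have h2 : ContDiff 𝕜 k (fun z : EuclideanSpace 𝕜 (Fin n) => algebraMap 𝕜 K (z a)) :=
      ((Algebra.linearMap 𝕜 K).toContinuousLinearMap.comp
        (EuclideanSpace.proj (𝕜 := 𝕜) a)).contDiff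
    exact h2.contMDiff.comp h1⟩

/-- The partial derivative `∂f/∂x^a` of a function on the open subset `V` of the domain of the chart
`φ = (x^1, …, x^n)`. -/
noncomputable def basePartial [hk : Fact (∞ ≤ k)]
    (hφ : φ ∈ IsManifold.maximalAtlas 𝓘(𝕜, EuclideanSpace 𝕜 (Fin n)) k M)
    {V : Opens M} (hV : (V : Set M) ⊆ φ.source) (a : Fin n)
    (f : baseFunctions 𝕜 K k (n := n) V) : baseFunctions 𝕜 K k (n := n) V :=
  ⟨fun p => fderiv 𝕜 (extendByZero f.1 ∘ φ.symm) (φ p.1) (EuclideanSpace.single a 1), by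
    have hk1 : k + 1 ≤ k := by
      rcases k with _ | k
      · exact le_top
      · have h : (⊤ : ℕ∞) ≤ k := WithTop.coe_le_coe.1 hk.out
        have : k = ⊤ := top_le_iff.1 h
        subst this
        exact le_of_eq rfl
    set S : Set (EuclideanSpace 𝕜 (Fin n)) := φ.target ∩ φ.symm ⁻¹' (V : Set M) with hS
    have hSo : IsOpen S := φ.isOpen_inter_preimage_symm V.isOpen
    have h1 : ContDiffOn 𝕜 k (extendByZero f.1 ∘ φ.symm) S := by
      rw [← contMDiffOn_iff_contDiffOn]
      intro z hz
      exact (contMDiffAt_extendByZero f ⟨φ.symm z, hz.2⟩).comp_contMDiffWithinAt z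
        ((contMDiffOn_symm_of_mem_maximalAtlas hφ).mono Set.inter_subset_left z hz)
    have h2 : ContDiffOn 𝕜 k (fun z => fderiv 𝕜 (extendByZero f.1 ∘ φ.symm) z
        (EuclideanSpace.single a 1)) S :=
      (h1.fderiv_of_isOpen hSo hk1).clm_apply contDiffOn_const
    intro p
    have hp : φ p.1 ∈ S := ⟨φ.map_source (hV p.2), by
      rw [Set.mem_preimage, φ.left_inv (hV p.2)]
      exact p.2⟩
    exact ((h2.contDiffAt (hSo.mem_nhds hp)).contMDiffAt).comp p
      (contMDiffAt_subtype_iff.2 (contMDiffAt_of_mem_maximalAtlas hφ (hV p.2)))⟩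

theorem basePartial_zero [Fact (∞ ≤ k)]
    (hφ : φ ∈ IsManifold.maximalAtlas 𝓘(𝕜, EuclideanSpace 𝕜 (Fin n)) k M)
    {V : Opens M} (hV : (V : Set M) ⊆ φ.source) (a : Fin n) :
    basePartial (K := K) hφ hV a 0 = 0 := by
  apply Subtype.ext
  funext p
  have : (extendByZero (0 : baseFunctions 𝕜 K k (n := n) V).1 ∘ φ.symm) = fun _ => 0 := by
    funext z
    simp [extendByZero]
  change fderiv 𝕜 (extendByZero (0 : baseFunctions 𝕜 K k (n := n) V).1 ∘ φ.symm) (φ p.1)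
    (EuclideanSpace.single a 1) = 0
  rw [this]
  simp

end BaseFunctions

/-! ### `ρ`-manifolds -/

/-- A sheaf of `G`-graded `ρ`-commutative `K`-algebras on `M`. Gluing is for sections of one and the
same degree, as is usual for sheaves of graded algebras. -/
structure RhoSheaf {G K : Type*} [AddCommGroup G] [DecidableEq G] [Field K]
    (ρ : CommutationFactor G K) (M : Type u) [TopologicalSpace M] where
  obj : Opens M → Type v
  [ring : ∀ U, Ring (obj U)]
  [algebra : ∀ U, Algebra K (obj U)]
  gr : ∀ U, G → Submodule K (obj U)
  [graded : ∀ U, GradedAlgebra (gr U)]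
  rho_comm : ∀ (U : Opens M) (i j : G) (f g : obj U), f ∈ gr U i → g ∈ gr U j →
    f * g = ρ i j • (g * f)
  res : ∀ {U V : Opens M}, V ≤ U → (obj U →ₐ[K] obj V)
  res_self : ∀ (U : Opens M) (f : obj U), res le_rfl f = f
  res_res : ∀ {U V W : Opens M} (hVU : V ≤ U) (hWV : W ≤ V) (f : obj U),
    res hWV (res hVU f) = res (hWV.trans hVU) f
  res_mem : ∀ {U V : Opens M} (h : V ≤ U) (i : G) (f : obj U), f ∈ gr U i → res h f ∈ gr V i
  glue : ∀ (i : G) {ι : Type u} (W : ι → Opens M) (s : ∀ a, obj (W a)),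
    (∀ a, s a ∈ gr (W a) i) →
    (∀ a b, res (inf_le_left : W a ⊓ W b ≤ W a) (s a) = res inf_le_right (s b)) →
    ∃! t : obj (iSup W), t ∈ gr (iSup W) i ∧ ∀ a, res (le_iSup W a) t = s a

attribute [instance] RhoSheaf.ring RhoSheaf.algebra RhoSheaf.graded

section RhoManifold

variable {𝕜 K : Type*} [RCLike 𝕜] [RCLike K] [NormedAlgebra 𝕜 K] (k : ℕ∞ω)
  {G : Type*} [AddCommGroup G] [DecidableEq G] {ρ : CommutationFactor G K}
  {n m : ℕ} (d : Fin m → G)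
  {M : Type u} [TopologicalSpace M] [ChartedSpace (EuclideanSpace 𝕜 (Fin n)) M]
  [IsManifold 𝓘(𝕜, EuclideanSpace 𝕜 (Fin n)) k M]

/-- A coordinate system of the ringed space `(M, 𝒪)`: a chart `(x^1, …, x^n)` of the manifold `M`
and an isomorphism of sheaves of graded algebras of `𝒪` with `𝒪_M⟦x^(n+1), …, x^(n+m)⟧_•` on the
domain of the chart, where `|x^(n+b)| = d b`. -/
structure RhoChart (𝒪 : RhoSheaf.{u, v} ρ M) where
  φ : OpenPartialHomeomorph M (EuclideanSpace 𝕜 (Fin n))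
  φ_mem : φ ∈ IsManifold.maximalAtlas 𝓘(𝕜, EuclideanSpace 𝕜 (Fin n)) k M
  iso : ∀ V : Opens M, (V : Set M) ⊆ φ.source →
    (𝒪.obj V ≃ₐ[K] RhoSeries ρ d (baseFunctions 𝕜 K k (n := n) V))
  iso_gr : ∀ (V : Opens M) (hV : (V : Set M) ⊆ φ.source) (i : G) (f : 𝒪.obj V),
    f ∈ 𝒪.gr V i ↔ (iso V hV f).IsHomogeneous i
  iso_res : ∀ (U V : Opens M) (hU : (U : Set M) ⊆ φ.source) (hVU : V ≤ U) (f : 𝒪.obj U)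
    (w : Fin m →₀ ℕ), (iso V (subset_trans hVU hU) (𝒪.res hVU f)).coeff w =
      baseFunctions.restrict hVU ((iso U hU f).coeff w)

/-- `(M, 𝒪)` is a `ρ`-manifold of dimension `n | m`, whose formal coordinates have the degrees
`d`: the underlying manifold is connected, and `M` is covered by coordinate neighbourhoods. -/
structure IsRhoManifold (𝒪 : RhoSheaf.{u, v} ρ M) : Prop where
  connected : ConnectedSpace M
  exists_chart : ∀ p : M, ∃ x : RhoChart (𝕜 := 𝕜) (n := n) k d 𝒪, p ∈ x.φ.source

/-- The degrees `|x^a|` of all coordinates `x^1, …, x^(n+m)`. -/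
def coordDegree (n : ℕ) {m : ℕ} (d : Fin m → G) : Fin (n + m) → G :=
  Fin.append (fun _ => 0) d

namespace RhoChart

variable {k d} {𝒪 : RhoSheaf.{u, v} ρ M}

/-- The coordinate neighbourhood. -/
def dom (x : RhoChart (𝕜 := 𝕜) (n := n) k d 𝒪) : Opens M := ⟨x.φ.source, x.φ.open_source⟩

/-- The coordinate functions `x^1, …, x^(n+m)` on the open subset `V` of the coordinate
neighbourhood. -/
noncomputable def coord (x : RhoChart (𝕜 := 𝕜) (n := n) k d 𝒪) {V : Opens M} (hV : V ≤ x.dom)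
    (a : Fin (n + m)) : 𝒪.obj V :=
  (x.iso V hV).symm (Fin.addCases
    (fun a => RhoSeries.monomial 0 (baseCoord x.φ_mem hV a))
    (fun b => RhoSeries.monomial (Finsupp.single b 1) 1) a)

/-- The partial derivatives `∂/∂x^1, …, ∂/∂x^(n+m)` on the open subset `V` of the coordinate
neighbourhood. -/
noncomputable def partialDeriv [Fact (∞ ≤ k)] (x : RhoChart (𝕜 := 𝕜) (n := n) k d 𝒪)
    {V : Opens M} (hV : V ≤ x.dom) (a : Fin (n + m)) (f : 𝒪.obj V) : 𝒪.obj V :=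
  (x.iso V hV).symm (Fin.addCases
    (fun a => RhoSeries.mapCoeff (basePartial x.φ_mem hV a) (basePartial_zero x.φ_mem hV a)
      (x.iso V hV f))
    (fun b => RhoSeries.formalPartial b (x.iso V hV f)) a)

/-- The Jacobian matrix on the intersection of two coordinate neighbourhoods, with the entry
`∂y^a/∂x^b` in row `b` and column `a`. It is a matrix of degree zero for the tuple of degrees
`-|x^b|`, and the chain rule `∂z^c/∂x^b = ∑ a, (∂y^a/∂x^b) (∂z^c/∂y^a)` says that it is
multiplicative. -/
noncomputable def jacobian [Fact (∞ ≤ k)] (x y : RhoChart (𝕜 := 𝕜) (n := n) k d 𝒪) :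
    Matrix (Fin (n + m)) (Fin (n + m)) (𝒪.obj (x.dom ⊓ y.dom)) :=
  Matrix.of fun b a => x.partialDeriv inf_le_left b (y.coord inf_le_right a)

end RhoChart

end RhoManifold

/-! ### The graded determinant and the graded Berezinian -/

section Berezinian

variable {G K : Type*} [AddCommGroup G] [Field K] (ρ : CommutationFactor G K)
  {A : Type*} [Ring A] [Algebra K A]

/-- The `ρ`-determinant of a matrix `F` whose entries have degrees `|F k l| = i k - i l`, where the
`i k` are all even (`ρ(i k, i k) = 1`) or all odd (`ρ(i k, i k) = -1`). It is characterized by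
`∏ k, (∑ l, F k l * t l) = ρdet F * ∏ k, t k` (ordered products) for indeterminates `t k` of degree
`i k` with `t k * f = ρ(i k, |f|) f * t k` for scalars `f`, which satisfy
`t k * t l = - ρ(i k, i l) t l * t k` and `t k * t k = 0` in the even case, and
`t k * t l = ρ(i k, i l) t l * t k` in the odd case (where `t k * t k = 0` follows). The two scalar
factors below arise when the entries `F l (σ l)` are moved to the left past `t (σ k)`, `k < l`, and
when `∏ k, t (σ k)` is then reordered. -/
noncomputable def rhoDet {ι : Type*} [Fintype ι] [LinearOrder ι] (i : ι → G)
    (F : Matrix ι ι A) : A :=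
  ∑ σ : Equiv.Perm ι,
    ((∏ k, ∏ l, if k < l then ρ (i (σ k)) (i l - i (σ l)) else 1) *
      (∏ k, ∏ l, if k < l ∧ σ l < σ k then
        -ρ (i (σ k)) (i (σ k)) * ρ (i (σ k)) (i (σ l)) else 1)) •
    (((Finset.univ : Finset ι).sort (· ≤ ·)).map fun k => F k (σ k)).prod

open Classical in
/-- The `ρ`-Berezinian `ρdet(F₀₀ - F₀₁ F₁₁⁻¹ F₁₀) ρdet(F₁₁)⁻¹` of a matrix whose entries have degrees
`|F k l| = i k - i l`. The blocks consist of the even indices `k` (`ρ(i k, i k) = 1`) and the odd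
ones (`ρ(i k, i k) = -1`). -/
noncomputable def rhoBer {ι : Type*} [Fintype ι] [LinearOrder ι] (i : ι → G)
    (F : Matrix ι ι A) : A :=
  let F₀₀ := F.toBlock (fun k => ρ (i k) (i k) = 1) (fun k => ρ (i k) (i k) = 1)
  let F₀₁ := F.toBlock (fun k => ρ (i k) (i k) = 1) (fun k => ¬ ρ (i k) (i k) = 1)
  let F₁₀ := F.toBlock (fun k => ¬ ρ (i k) (i k) = 1) (fun k => ρ (i k) (i k) = 1)
  let F₁₁ := F.toBlock (fun k => ¬ ρ (i k) (i k) = 1) (fun k => ¬ ρ (i k) (i k) = 1)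
  if IsUnit F₀₀ ∧ IsUnit F₁₁ then
    rhoDet ρ (fun k => i k.1) (F₀₀ - F₀₁ * Ring.inverse F₁₁ * F₁₀) *
      Ring.inverse (rhoDet ρ (fun k => i k.1) F₁₁)
  else 0

end Berezinian

/-! ### Volume forms, vector fields and the divergence -/

section Divergence

variable {𝕜 K : Type*} [RCLike 𝕜] [RCLike K] [NormedAlgebra 𝕜 K] (k : ℕ∞ω) [Fact (∞ ≤ k)]
  {G : Type*} [AddCommGroup G] [DecidableEq G] {ρ : CommutationFactor G K}
  {n m : ℕ} (d : Fin m → G)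
  {M : Type u} [TopologicalSpace M] [ChartedSpace (EuclideanSpace 𝕜 (Fin n)) M]
  [IsManifold 𝓘(𝕜, EuclideanSpace 𝕜 (Fin n)) k M]

/-- A global section of the `ρ`-Berezinian bundle. It has a local expression `D(x) s(x)` in every
coordinate system `x`, and the frames satisfy `D(y) = D(x) ρBer(∂y/∂x)`. -/
structure BerezinianSection (𝒪 : RhoSheaf.{u, v} ρ M) where
  s : ∀ x : RhoChart (𝕜 := 𝕜) (n := n) k d 𝒪, 𝒪.obj x.dom
  compat : ∀ x y : RhoChart (𝕜 := 𝕜) (n := n) k d 𝒪,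
    𝒪.res (inf_le_left : x.dom ⊓ y.dom ≤ x.dom) (s x) =
      rhoBer ρ (fun a => -coordDegree n d a) (x.jacobian y) * 𝒪.res inf_le_right (s y)

/-- A `ρ`-Berezin volume form: a section `D(x) s(x)` with `s(x)` of degree zero and invertible. -/
structure RhoVolumeForm (𝒪 : RhoSheaf.{u, v} ρ M) extends
    BerezinianSection (𝕜 := 𝕜) (n := n) k d 𝒪 where
  s_mem : ∀ x, s x ∈ 𝒪.gr x.dom 0
  s_isUnit : ∀ x, IsUnit (s x)

/-- A vector field of degree `δ` on `(M, 𝒪)`: a `ρ`-derivation of degree `δ` of the structure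
sheaf. -/
structure RhoVectorField (𝒪 : RhoSheaf.{u, v} ρ M) (δ : G) where
  app : ∀ U : Opens M, 𝒪.obj U →ₗ[K] 𝒪.obj U
  app_mem : ∀ (U : Opens M) (i : G) (f : 𝒪.obj U), f ∈ 𝒪.gr U i → app U f ∈ 𝒪.gr U (δ + i)
  leibniz : ∀ (U : Opens M) (i : G) (f g : 𝒪.obj U), f ∈ 𝒪.gr U i →
    app U (f * g) = app U f * g + ρ δ i • (f * app U g)
  app_res : ∀ {U V : Opens M} (h : V ≤ U) (f : 𝒪.obj U), app V (𝒪.res h f) = 𝒪.res h (app U f)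

namespace RhoVectorField

variable {𝒪 : RhoSheaf.{u, v} ρ M} {δ : G}

/-- `Q` is homological: `ρ(|Q|, |Q|) = -1`, and the `ρ`-commutator
`[Q, Q]_ρ = Q ∘ Q - ρ(|Q|, |Q|) Q ∘ Q` vanishes. -/
structure IsHomological (Q : RhoVectorField 𝒪 δ) : Prop where
  odd : ρ δ δ = -1
  bracket_self : ∀ (U : Opens M) (f : 𝒪.obj U),
    Q.app U (Q.app U f) - ρ δ δ • Q.app U (Q.app U f) = 0

/-- The cocycles of degree `r` of the cochain complex with the terms `𝒪(M)_(r |Q|)`, `r ∈ ℤ`, and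
the differential `Q`. -/
def cocycles (Q : RhoVectorField 𝒪 δ) (r : ℤ) : Submodule K (𝒪.obj ⊤) :=
  𝒪.gr ⊤ (r • δ) ⊓ LinearMap.ker (Q.app ⊤)

/-- The coboundaries of degree `r` of the same complex. -/
def coboundaries (Q : RhoVectorField 𝒪 δ) (r : ℤ) : Submodule K (𝒪.obj ⊤) :=
  (𝒪.gr ⊤ ((r - 1) • δ)).map (Q.app ⊤)

/-- The cohomology `H^r_Q(M)`. -/
abbrev Cohomology (Q : RhoVectorField 𝒪 δ) (r : ℤ) : Type _ :=
  Q.cocycles r ⧸ (Q.coboundaries r).submoduleOf (Q.cocycles r)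

variable {k d}

/-- The Lie derivative in the coordinate system `x`: the function `s'` with
`L_X (D(x) s) = D(x) s'`, that is, `s' = ∑ a, ρ(|x^a|, |x^a| + |X|) ∂(X^a s)/∂x^a` for
`X = ∑ a, X^a ∂/∂x^a`. -/
noncomputable def lieDerivCoord (X : RhoVectorField 𝒪 δ)
    (x : RhoChart (𝕜 := 𝕜) (n := n) k d 𝒪) (s : 𝒪.obj x.dom) : 𝒪.obj x.dom :=
  ∑ a : Fin (n + m), ρ (coordDegree n d a) (coordDegree n d a + δ) •
    x.partialDeriv le_rfl a (X.app x.dom (x.coord le_rfl a) * s)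

/-- The global function `f` is a divergence of `X` with respect to `vol`: `vol · f = L_X vol`, in
every coordinate system. -/
def IsDivergence (vol : RhoVolumeForm (𝕜 := 𝕜) (n := n) k d 𝒪) (X : RhoVectorField 𝒪 δ)
    (f : 𝒪.obj ⊤) : Prop :=
  ∀ x : RhoChart (𝕜 := 𝕜) (n := n) k d 𝒪,
    vol.s x * 𝒪.res le_top f = X.lieDerivCoord x (vol.s x)

end RhoVectorField

end Divergence

/-!
# The modular class of a `ρ`-`Q`-manifold

Why a vector field `X` has a unique divergence. In a coordinate system `x` with `vol = D(x) s`,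
where `s` is invertible, the only possible divergence is `s⁻¹ L_X(s)`, and it has the degree of `X`.
On an intersection of coordinate neighbourhoods the local divergences agree, because the Lie
derivative of Berezinian sections does not depend on the coordinates
(`IsCoordFrame.frameLie_rhoBer`). As `L_X(D(x) s) = D(x) (div_x X · s + X s)`, this means that under
a change of coordinates with Jacobian matrix `J` the function `div_x X` changes by the logarithmic
derivative of the Berezinian, and it is a combination of two computations: `div_x X` changes by the
supertrace of `X(J) J⁻¹` (`IsCoordFrame.frameLie_one_change`), and
`X(ρBer J) = str(X(J) J⁻¹) ρBer J` (`IsRhoDer.map_rhoBer`). The latter follows from Jacobi's formula for the graded determinant,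
applied to the Schur complement and the odd block. Jacobi's formula itself is obtained from the
definition of `ρdet(F)` by the product of the `θ k = ∑ l, F k l t l`: if `X` acts as a derivation
that kills the indeterminates `t k`, then `X(θ k)` is the sum of the `(X(F) F⁻¹) k m θ m`, and as
`θ m * θ m = 0`, only the diagonal terms survive in the derivative of the product
(`GradedFock.der_mul_prod_row`). The indeterminates are realized as operators on families of
coefficients indexed by finite sets.

The computations in coordinates use that vector fields have the expansion `∑ a, X(x^a) ∂/∂x^a`, that
the chain rule holds and that the partial derivatives `ρ`-commute. All of this follows from one
uniqueness statement: a `ρ`-derivation of the structure sheaf over a coordinate neighbourhood that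
kills the coordinates is zero (`IsSheafDer.eq_zero_of_coord`). On functions of the base coordinates
this is Hadamard's lemma `f = f(p) + ∑ i, (x^i - x^i(p)) g_i` near `p`, which is proved for smooth
and for analytic functions; a formal power series is then handled by increasing orders in the formal
coordinates (`RhoSeries.eq_zero_of_single_mul`).

For a homological vector field `Q`, the divergence is locally `div_x Q + s⁻¹ Q(s)`. Since `Q` is odd
and `Q(Q(x^a)) = 0`, applying `Q` to `div_x Q` gives a double sum whose terms change sign under the
exchange of the two indices (`IsCoordFrame.map_frameLie_one`), and `Q(s⁻¹ Q(s)) = -(s⁻¹ Q(s))² = 0`.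

The gluing axiom of the structure sheaf concerns sections of one degree. Sections are nevertheless
determined by their restrictions (`RhoSheaf.eq_of_locally_eq`), because restrictions respect
homogeneous components.
-/

/-! ### Commutation factors -/

namespace CommutationFactor

variable {G K : Type*} [AddCommGroup G] [Field K] (ρ : CommutationFactor G K)

theorem ne_zero (i j : G) : ρ i j ≠ 0 := left_ne_zero_of_mul_eq_one (ρ.mul_swap i j)

theorem swap (i j : G) : ρ j i = (ρ i j)⁻¹ := eq_inv_of_mul_eq_one_right (ρ.mul_swap i j)

theorem map_add_left (i j k : G) : ρ (i + j) k = ρ i k * ρ j k := ρ.add_left i j k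

theorem map_add_right (i j k : G) : ρ i (j + k) = ρ i j * ρ i k := by
  rw [ρ.swap, ρ.map_add_left, mul_inv, ← ρ.swap, ← ρ.swap]

@[simp] theorem map_zero_left (j : G) : ρ 0 j = 1 := by
  have h := ρ.map_add_left 0 0 j
  rw [add_zero] at h
  exact (mul_eq_left₀ (ρ.ne_zero 0 j)).1 h.symm

@[simp] theorem map_zero_right (j : G) : ρ j 0 = 1 := by
  rw [ρ.swap, ρ.map_zero_left, inv_one]

theorem map_neg_left (i j : G) : ρ (-i) j = (ρ i j)⁻¹ := by
  refine eq_inv_of_mul_eq_one_left ?_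
  rw [← ρ.map_add_left, neg_add_cancel, ρ.map_zero_left]

theorem map_neg_right (i j : G) : ρ i (-j) = (ρ i j)⁻¹ := by
  rw [ρ.swap, ρ.map_neg_left, ← ρ.swap]

theorem map_sub_left (i j k : G) : ρ (i - j) k = ρ i k * (ρ j k)⁻¹ := by
  rw [sub_eq_add_neg, ρ.map_add_left, ρ.map_neg_left]

theorem map_sub_right (i j k : G) : ρ i (j - k) = ρ i j * (ρ i k)⁻¹ := by
  rw [sub_eq_add_neg, ρ.map_add_right, ρ.map_neg_right]

theorem self_mul_self (i : G) : ρ i i * ρ i i = 1 := ρ.mul_swap i i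

theorem self_inv (i : G) : (ρ i i)⁻¹ = ρ i i := (ρ.swap i i).symm

theorem self_eq_one_or (i : G) : ρ i i = 1 ∨ ρ i i = -1 := mul_self_eq_one_iff.1 (ρ.self_mul_self i)

/-- The parity `i ↦ ρ(i, i) = ± 1` is a character of `G`. -/
theorem self_add (i j : G) : ρ (i + j) (i + j) = ρ i i * ρ j j := by
  rw [ρ.map_add_left, ρ.map_add_right, ρ.map_add_right]
  linear_combination ρ i i * ρ j j * ρ.mul_swap i j

theorem self_neg (i : G) : ρ (-i) (-i) = ρ i i := by
  rw [ρ.map_neg_left, ρ.map_neg_right, inv_inv]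

theorem self_sub (i j : G) : ρ (i - j) (i - j) = ρ i i * ρ j j := by
  rw [sub_eq_add_neg, ρ.self_add, ρ.self_neg]

theorem map_neg_sub_self (i j : G) : ρ (i - j) (j - i) = ρ i i * ρ j j := by
  rw [← neg_sub i j, ρ.map_neg_right, ρ.self_inv, ρ.self_sub]

end CommutationFactor

/-! ### Graded commutative algebras, their derivations and twists -/

section Graded

variable {G K : Type*} [AddCommGroup G] [Field K] (ρ : CommutationFactor G K)
  {A : Type*} [Ring A] [Algebra K A] (gr : G → Submodule K A)

/-- The graded algebra `A = ⨁ i, gr i` is `ρ`-commutative. -/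
def IsRhoComm : Prop :=
  ∀ (i j : G) (f g : A), f ∈ gr i → g ∈ gr j → f * g = ρ i j • (g * f)

/-- `X` is a `ρ`-derivation of degree `δ` of the graded algebra `A = ⨁ i, gr i`. -/
structure IsRhoDer (δ : G) (X : A →ₗ[K] A) : Prop where
  map_mem : ∀ (i : G) (f : A), f ∈ gr i → X f ∈ gr (δ + i)
  leibniz : ∀ (i : G) (f g : A), f ∈ gr i → X (f * g) = X f * g + ρ δ i • (f * X g)

variable {ρ gr}

/-- Linear maps on a graded algebra that agree on homogeneous elements are equal. -/
theorem eq_of_eq_on_homogeneous [DecidableEq G] [GradedAlgebra gr] {B : Type*} [AddCommGroup B]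
    [Module K B] (S T : A →ₗ[K] B) (h : ∀ i, ∀ f ∈ gr i, S f = T f) (f : A) : S f = T f := by
  induction f using DirectSum.Decomposition.inductionOn gr with
  | zero => simp
  | homogeneous x => exact h _ _ x.2
  | add x y hx hy => rw [map_add, map_add, hx, hy]

theorem IsRhoComm.commute_of_mem_zero [DecidableEq G] [GradedAlgebra gr] (hc : IsRhoComm ρ gr)
    {a : A} (ha : a ∈ gr 0) (b : A) : a * b = b * a :=
  eq_of_eq_on_homogeneous (gr := gr) (LinearMap.mulLeft K a) (LinearMap.mulRight K a)
    (fun j f hf => by simp [hc 0 j a f ha hf]) b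

/-- The inverse of a homogeneous unit of degree zero has degree zero. -/
theorem inv_mem_zero [DecidableEq G] [GradedAlgebra gr] {a b : A} (ha : a ∈ gr 0) (hab : a * b = 1)
    (hba : b * a = 1) : b ∈ gr 0 := by
  have h := DirectSum.coe_decompose_mul_add_of_left_mem gr (j := (0 : G)) (b := b) ha
  rw [add_zero, hab, DirectSum.decompose_of_mem_same gr (SetLike.GradedOne.one_mem)] at h
  have : b = (DirectSum.decompose gr b (0 : G) : A) := by
    have h2 := congrArg (fun z => b * z) h
    simp only [mul_one, ← mul_assoc, hba, one_mul] at h2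
    exact h2
  rw [this]
  exact SetLike.coe_mem _

/-- The inverse of a matrix whose entries have degrees `i k - j l` has entries of degrees
`j l - i k`. -/
theorem matrix_inv_mem [DecidableEq G] [GradedAlgebra gr] {ι κ : Type*} [Fintype ι] [Fintype κ]
    [DecidableEq ι] [DecidableEq κ] {i : ι → G} {j : κ → G} {F : Matrix ι κ A} {H : Matrix κ ι A}
    (hF : ∀ k l, F k l ∈ gr (i k - j l)) (hFH : F * H = 1) (hHF : H * F = 1) (l : κ) (k : ι) :
    H l k ∈ gr (j l - i k) := by
  let H' : Matrix κ ι A := Matrix.of fun l k => (DirectSum.decompose gr (H l k) (j l - i k) : A)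
  have h : F * H' = 1 := by
    ext a b
    have h1 : ∀ l, F a l * H' l b =
        (DirectSum.decompose gr (F a l * H l b) (i a - i b) : A) := fun l => by
      have := DirectSum.coe_decompose_mul_add_of_left_mem gr (j := j l - i b) (b := H l b) (hF a l)
      rw [sub_add_sub_cancel] at this
      exact this.symm
    rw [Matrix.mul_apply, Finset.sum_congr rfl fun l _ => h1 l, ← AddSubmonoidClass.coe_finsetSum,
      ← DFinsupp.finsetSum_apply, ← DirectSum.decompose_sum, ← Matrix.mul_apply, hFH,
      Matrix.one_apply]
    split_ifs with hab
    · subst hab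
      rw [sub_self, DirectSum.decompose_of_mem_same gr (SetLike.GradedOne.one_mem)]
    · simp
  have : H = H' := by
    calc H = H * (F * H') := by rw [h, Matrix.mul_one]
      _ = H' := by rw [← Matrix.mul_assoc, hHF, Matrix.one_mul]
  rw [this]
  exact SetLike.coe_mem _

namespace IsRhoDer

variable {δ ε : G} {X Y : A →ₗ[K] A}

theorem map_one [DecidableEq G] [GradedAlgebra gr] (hX : IsRhoDer ρ gr δ X) : X 1 = 0 := by
  have h := hX.leibniz 0 1 1 SetLike.GradedOne.one_mem
  simpa using h

theorem leibniz_zero (hX : IsRhoDer ρ gr δ X) {f : A} (hf : f ∈ gr 0) (g : A) :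
    X (f * g) = X f * g + f * X g := by
  rw [hX.leibniz 0 f g hf, ρ.map_zero_right, one_smul]

theorem sub (hX : IsRhoDer ρ gr δ X) (hY : IsRhoDer ρ gr δ Y) : IsRhoDer ρ gr δ (X - Y) where
  map_mem i f hf := sub_mem (hX.map_mem i f hf) (hY.map_mem i f hf)
  leibniz i f g hf := by
    simp only [LinearMap.sub_apply, hX.leibniz i f g hf, hY.leibniz i f g hf, sub_mul, mul_sub,
      smul_sub]
    abel

theorem sum {ι : Type*} (s : Finset ι) {Z : ι → A →ₗ[K] A}
    (hZ : ∀ a ∈ s, IsRhoDer ρ gr δ (Z a)) : IsRhoDer ρ gr δ (∑ a ∈ s, Z a) where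
  map_mem i f hf := by
    rw [LinearMap.sum_apply]
    exact sum_mem fun a ha => (hZ a ha).map_mem i f hf
  leibniz i f g hf := by
    simp only [LinearMap.sum_apply, Finset.sum_mul, Finset.mul_sum, Finset.smul_sum]
    rw [← Finset.sum_add_distrib]
    exact Finset.sum_congr rfl fun a ha => (hZ a ha).leibniz i f g hf

theorem smul_left [DecidableEq G] [GradedAlgebra gr] (hc : IsRhoComm ρ gr)
    (hX : IsRhoDer ρ gr δ X) {a : A} (ha : a ∈ gr ε) :
    IsRhoDer ρ gr (ε + δ) (LinearMap.mulLeft K a ∘ₗ X) where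
  map_mem i f hf := by
    rw [add_assoc]
    exact SetLike.GradedMul.mul_mem ha (hX.map_mem i f hf)
  leibniz i f g hf := by
    simp only [LinearMap.comp_apply, LinearMap.mulLeft_apply, hX.leibniz i f g hf, mul_add,
      mul_smul_comm, mul_assoc]
    rw [← mul_assoc a f, hc ε i a f ha hf, smul_mul_assoc, smul_smul, mul_assoc, mul_comm,
      ρ.map_add_left]

/-- The `ρ`-commutator of two `ρ`-derivations is a `ρ`-derivation. -/
theorem commutator (hX : IsRhoDer ρ gr δ X) (hY : IsRhoDer ρ gr ε Y) :
    IsRhoDer ρ gr (δ + ε) (X ∘ₗ Y - ρ δ ε • Y ∘ₗ X) where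
  map_mem i f hf := by
    refine sub_mem ?_ (Submodule.smul_mem _ _ ?_)
    · rw [add_assoc]
      exact hX.map_mem _ _ (hY.map_mem i f hf)
    · rw [add_comm δ, add_assoc]
      exact hY.map_mem _ _ (hX.map_mem i f hf)
  leibniz i f g hf := by
    simp only [LinearMap.sub_apply, LinearMap.smul_apply, LinearMap.comp_apply,
      hX.leibniz i f g hf, hY.leibniz i f g hf, map_add, map_smul,
      hX.leibniz _ _ g (hY.map_mem i f hf), hY.leibniz _ _ g (hX.map_mem i f hf),
      hX.leibniz i f _ hf, hY.leibniz i f _ hf, ρ.map_add_left, ρ.map_add_right, smul_add, smul_sub,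
      sub_mul, mul_sub, smul_smul, smul_mul_assoc, mul_smul_comm, mul_assoc]
    have h := ρ.mul_swap δ ε
    rw [show ρ δ ε * (ρ ε δ * ρ ε i) = ρ ε i by rw [← mul_assoc, h, one_mul]]
    module

end IsRhoDer

variable (ρ gr) [DecidableEq G] [GradedAlgebra gr]

/-- The operator `a ↦ ρ(g, |a|) a` on a graded algebra. -/
noncomputable def rhoTwist (g : G) : A →ₗ[K] A :=
  DirectSum.toModule K G A (fun i => ρ g i • (gr i).subtype) ∘ₗ
    (DirectSum.decomposeLinearEquiv gr).toLinearMap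

variable {ρ gr}

theorem rhoTwist_of_mem (g : G) {i : G} {a : A} (ha : a ∈ gr i) :
    rhoTwist ρ gr g a = ρ g i • a := by
  simp only [rhoTwist, LinearMap.comp_apply, LinearEquiv.coe_coe,
    DirectSum.decomposeLinearEquiv_apply, DirectSum.decompose_of_mem gr ha]
  rw [← DirectSum.lof_eq_of K, DirectSum.toModule_lof]
  simp

theorem rhoTwist_mul_of_mem (g : G) {i : G} {a : A} (ha : a ∈ gr i) (b : A) :
    rhoTwist ρ gr g (a * b) = ρ g i • (a * rhoTwist ρ gr g b) :=
  eq_of_eq_on_homogeneous (gr := gr) (rhoTwist ρ gr g ∘ₗ LinearMap.mulLeft K a)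
    (ρ g i • LinearMap.mulLeft K a ∘ₗ rhoTwist ρ gr g)
    (fun j f hf => by
      have h : a * f ∈ gr (i + j) := SetLike.GradedMul.mul_mem ha hf
      simp [rhoTwist_of_mem g h, rhoTwist_of_mem g hf, ρ.map_add_right, smul_smul]) b

theorem rhoTwist_comm (g h : G) (a : A) :
    rhoTwist ρ gr g (rhoTwist ρ gr h a) = rhoTwist ρ gr h (rhoTwist ρ gr g a) :=
  eq_of_eq_on_homogeneous (gr := gr) (rhoTwist ρ gr g ∘ₗ rhoTwist ρ gr h)
    (rhoTwist ρ gr h ∘ₗ rhoTwist ρ gr g)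
    (fun j f hf => by
      simp [rhoTwist_of_mem _ hf, smul_smul, mul_comm]) a

theorem IsRhoDer.map_rhoTwist {δ : G} {X : A →ₗ[K] A} (hX : IsRhoDer ρ gr δ X) (g : G) (a : A) :
    X (rhoTwist ρ gr g a) = ρ δ g • rhoTwist ρ gr g (X a) :=
  eq_of_eq_on_homogeneous (gr := gr) (X ∘ₗ rhoTwist ρ gr g) (ρ δ g • rhoTwist ρ gr g ∘ₗ X)
    (fun j f hf => by
      simp [rhoTwist_of_mem _ hf, rhoTwist_of_mem _ (hX.map_mem _ _ hf), smul_smul,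
        ρ.map_add_right, ← mul_assoc, ρ.mul_swap]) a

end Graded

/-! ### The exterior algebra behind the graded determinant -/

namespace GradedFock

variable {G K : Type*} [AddCommGroup G] [Field K] (ρ : CommutationFactor G K)
  {A : Type*} [Ring A] [Algebra K A] (gr : G → Submodule K A)
  {ι : Type*}

/-- The left multiplication by the scalar `a` on families `(f_S)`, which stand for `∑ f_S t_S`. -/
def lmul (ι : Type*) (a : A) : Module.End K (Finset ι → A) where
  toFun f S := a * f S
  map_add' f g := by ext S; simp [mul_add]
  map_smul' c f := by ext S; simp

/-- The extension of the derivation `X` of `A` that kills all `t k`. -/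
def der (ι : Type*) (X : A →ₗ[K] A) : Module.End K (Finset ι → A) where
  toFun f S := X (f S)
  map_add' f g := by ext S; simp
  map_smul' c f := by ext S; simp

theorem lmul_apply (a : A) (f : Finset ι → A) (S : Finset ι) :
    lmul (K := K) ι a f S = a * f S := rfl

theorem der_apply (X : A →ₗ[K] A) (f : Finset ι → A) (S : Finset ι) : der ι X f S = X (f S) := rfl

theorem lmul_sum {κ : Type*} (s : Finset κ) (a : κ → A) :
    lmul (K := K) ι (∑ k ∈ s, a k) = ∑ k ∈ s, lmul ι (a k) := by
  ext f S
  simp [lmul_apply, Finset.sum_mul]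

theorem lmul_mul (a b : A) : lmul (K := K) ι (a * b) = lmul ι a * lmul ι b := by
  ext f S
  simp [lmul_apply, mul_assoc]

theorem lmul_smul (c : K) (a : A) : lmul (K := K) ι (c • a) = c • lmul ι a := by
  ext f S
  simp [lmul_apply]

theorem der_mul_lmul {δ j : G} {X : A →ₗ[K] A} (hX : IsRhoDer ρ gr δ X) {a : A} (ha : a ∈ gr j) :
    der ι X * lmul ι a = lmul ι (X a) + ρ δ j • (lmul ι a * der ι X) := by
  ext f S
  simp [lmul_apply, der_apply, hX.leibniz j a _ ha]

theorem lmul_mul_lmul {j j' : G} (hc : IsRhoComm ρ gr) {a b : A} (ha : a ∈ gr j) (hb : b ∈ gr j') :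
    lmul (K := K) ι a * lmul ι b = ρ j j' • (lmul ι b * lmul ι a) := by
  rw [← lmul_mul, hc j j' a b ha hb, lmul_smul, lmul_mul]

variable [LinearOrder ι] (i : ι → G)

/-- The scalar `c` with `t k * t_S = c t_(S ∪ {k})`, where `t_S` is the ordered product of the
`t j`, `j ∈ S`, and `t k * t j = - ρ(i k, i k) ρ(i k, i j) t j * t k`. -/
def sign (k : ι) (S : Finset ι) : K :=
  ∏ j ∈ S, if j < k then -ρ (i k) (i k) * ρ (i k) (i j) else 1

theorem sign_eq_mul_erase {k l : ι} {S : Finset ι} (h : l ∈ S) :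
    sign ρ i k S =
      (if l < k then -ρ (i k) (i k) * ρ (i k) (i l) else 1) * sign ρ i k (S.erase l) :=
  (Finset.mul_prod_erase S _ h).symm

theorem sign_erase_self (k : ι) (S : Finset ι) : sign ρ i k (S.erase k) = sign ρ i k S := by
  by_cases h : k ∈ S
  · rw [sign_eq_mul_erase ρ i h, if_neg (lt_irrefl k), one_mul]
  · rw [Finset.erase_eq_of_notMem h]

variable [DecidableEq G] [GradedAlgebra gr]

/-- The left multiplication by the indeterminate `t k`. -/
noncomputable def creation (k : ι) : Module.End K (Finset ι → A) where
  toFun f S := if k ∈ S then sign ρ i k S • rhoTwist ρ gr (i k) (f (S.erase k)) else 0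
  map_add' f g := by ext S; by_cases h : k ∈ S <;> simp [h]
  map_smul' c f := by ext S; by_cases h : k ∈ S <;> simp [h, smul_comm c]

theorem creation_apply (k : ι) (f : Finset ι → A) (S : Finset ι) :
    creation ρ gr i k f S =
      if k ∈ S then sign ρ i k S • rhoTwist ρ gr (i k) (f (S.erase k)) else 0 := rfl

theorem creation_mul_lmul (k : ι) {j : G} {a : A} (ha : a ∈ gr j) :
    creation ρ gr i k * lmul ι a = ρ (i k) j • (lmul ι a * creation ρ gr i k) := by
  ext f S
  simp only [Module.End.mul_apply, LinearMap.smul_apply, Pi.smul_apply, creation_apply, lmul_apply]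
  split_ifs
  · rw [rhoTwist_mul_of_mem _ ha, mul_smul_comm, smul_smul, smul_smul, mul_comm]
  · simp

theorem der_mul_creation {δ : G} {X : A →ₗ[K] A} (hX : IsRhoDer ρ gr δ X) (k : ι) :
    der ι X * creation ρ gr i k = ρ δ (i k) • (creation ρ gr i k * der ι X) := by
  ext f S
  simp only [Module.End.mul_apply, LinearMap.smul_apply, Pi.smul_apply, creation_apply, der_apply]
  split_ifs
  · rw [map_smul, hX.map_rhoTwist, smul_smul, smul_smul, mul_comm]
  · simp

theorem creation_mul_creation (he : ∀ k l, ρ (i k) (i k) = ρ (i l) (i l)) (k l : ι) :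
    creation ρ gr i k * creation ρ gr i l =
      (-ρ (i k) (i k) * ρ (i k) (i l)) • (creation ρ gr i l * creation ρ gr i k) := by
  ext f S
  simp only [Module.End.mul_apply, LinearMap.smul_apply, Pi.smul_apply, creation_apply]
  rcases eq_or_ne k l with rfl | hkl
  · simp
  by_cases hk : k ∈ S
  swap
  · simp [hk]
  by_cases hl : l ∈ S
  swap
  · simp [hl]
  simp only [hk, hl, Finset.mem_erase, hkl, hkl.symm, ne_eq, not_false_eq_true, and_self, if_true,
    map_smul, smul_smul]
  rw [rhoTwist_comm, Finset.erase_right_comm, sign_eq_mul_erase ρ i (k := k) hl,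
    sign_eq_mul_erase ρ i (k := l) hk]
  congr 1
  have h1 := ρ.mul_swap (i k) (i l)
  have h2 := ρ.self_mul_self (i k)
  rw [he l k]
  rcases lt_or_gt_of_ne hkl with h | h
  · rw [if_neg (not_lt.2 h.le), if_pos h]
    linear_combination (-(sign ρ i k (S.erase l) * sign ρ i l (S.erase k))) * h1
      - ρ (i k) (i l) * ρ (i l) (i k) * sign ρ i k (S.erase l) * sign ρ i l (S.erase k) * h2
  · rw [if_pos h, if_neg (not_lt.2 h.le)]
    ring

/-- The family standing for `a t_S`. -/
def ket (S : Finset ι) (a : A) : Finset ι → A := fun T => if T = S then a else 0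

theorem creation_ket (k : ι) (S : Finset ι) (a : A) :
    creation ρ gr i k (ket S a) =
      if k ∈ S then 0 else ket (insert k S) (sign ρ i k S • rhoTwist ρ gr (i k) a) := by
  ext T
  rw [creation_apply]
  by_cases hk : k ∈ S
  · rw [if_pos hk]
    have : T.erase k ≠ S := by
      rintro rfl
      simp at hk
    simp [ket, this]
  · rw [if_neg hk]
    by_cases hT : T = insert k S
    · subst hT
      rw [if_pos (Finset.mem_insert_self k S), ← sign_erase_self, Finset.erase_insert hk]
      simp [ket]
    · by_cases hkT : k ∈ T
      · have : T.erase k ≠ S := by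
          rintro rfl
          exact hT (Finset.insert_erase hkT).symm
        simp [ket, this, hT]
      · simp [hkT, ket, hT]

omit [DecidableEq G] [GradedAlgebra gr] in
theorem lmul_ket (S : Finset ι) (a b : A) : lmul (K := K) ι a (ket S b) = ket S (a * b) := by
  ext T
  by_cases h : T = S <;> simp [ket, lmul_apply, h]

/-- The ordered product of the monomials `a k * t (f k)`, with the reordering scalars of
`rhoDet`. -/
theorem prod_lmul_creation {r : ℕ} (f : Fin r → ι) (a : Fin r → A) (j : Fin r → G)
    (ha : ∀ k, a k ∈ gr (j k)) :
    (List.ofFn fun k => (lmul ι (a k) * creation ρ gr i (f k) :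
      Module.End K (Finset ι → A))).prod (ket ∅ 1) =
      if Function.Injective f then ket (Finset.univ.image f)
        (((∏ k, ∏ l, if k < l then ρ (i (f k)) (j l) else 1) *
          (∏ k, ∏ l, if k < l ∧ f l < f k then
            -ρ (i (f k)) (i (f k)) * ρ (i (f k)) (i (f l)) else 1)) • (List.ofFn a).prod)
      else 0 := by
  induction r with
  | zero => simp [Function.injective_of_subsingleton f]
  | succ r ih =>
    have hmem : (List.ofFn fun k : Fin r => a k.succ).prod ∈ gr (∑ k : Fin r, j k.succ) := by
      have := SetLike.list_prod_ofFn_mem_graded (A := gr) (fun k : Fin r => j k.succ)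
        (fun k : Fin r => a k.succ) fun k => ha _
      rwa [List.sum_ofFn] at this
    rw [List.ofFn_succ, List.prod_cons, Module.End.mul_apply,
      ih (fun k => f k.succ) (fun k => a k.succ) (fun k => j k.succ) fun k => ha _]
    have hinj : Function.Injective f ↔
        f 0 ∉ Finset.univ.image (fun k : Fin r => f k.succ) ∧
          Function.Injective fun k : Fin r => f k.succ := by
      conv_lhs => rw [← Fin.cons_self_tail f, Fin.cons_injective_iff]
      simp [Fin.tail_def]
    by_cases h1 : Function.Injective fun k : Fin r => f k.succ
    swap
    · rw [if_neg h1, if_neg fun h => h1 (hinj.1 h).2, map_zero]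
    rw [if_pos h1, Module.End.mul_apply, creation_ket]
    by_cases h2 : f 0 ∈ Finset.univ.image (fun k : Fin r => f k.succ)
    · rw [if_pos h2, if_neg fun h => (hinj.1 h).1 h2, map_zero]
    rw [if_neg h2, if_pos (hinj.2 ⟨h2, h1⟩), lmul_ket]
    have himg : insert (f 0) (Finset.univ.image fun k : Fin r => f k.succ) =
        Finset.univ.image f := by
      ext x
      simp [Fin.exists_fin_succ, eq_comm]
    rw [himg, rhoTwist_of_mem _ (Submodule.smul_mem _ _ hmem), List.ofFn_succ (f := a),
      List.prod_cons]
    simp only [mul_smul_comm, smul_smul]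
    congr 2
    have hs : sign ρ i (f 0) (Finset.univ.image fun k : Fin r => f k.succ) =
        ∏ l : Fin r, if f l.succ < f 0 then
          -ρ (i (f 0)) (i (f 0)) * ρ (i (f 0)) (i (f l.succ)) else 1 := by
      rw [sign, Finset.prod_image (fun x _ y _ h => h1 h)]
    have hρ : ρ (i (f 0)) (∑ k : Fin r, j k.succ) = ∏ k : Fin r, ρ (i (f 0)) (j k.succ) := by
      induction (Finset.univ : Finset (Fin r)) using Finset.induction_on with
      | empty => simp
      | insert b s hb ihs => rw [Finset.sum_insert hb, Finset.prod_insert hb, ρ.map_add_right, ihs]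
    rw [hs, hρ]
    simp only [Fin.prod_univ_succ, if_false, Fin.succ_pos, if_true, Fin.not_lt_zero,
      Fin.succ_lt_succ_iff, true_and, false_and, one_mul]
    ring

variable [Fintype ι] (F : Matrix ι ι A)

/-- The rows `θ k = ∑ l, F k l t l` of the matrix `F`. -/
noncomputable def row (k : ι) : Module.End K (Finset ι → A) :=
  ∑ l, lmul ι (F k l) * creation ρ gr i l

variable {ρ gr i F}

theorem row_mul_lmul (hc : IsRhoComm ρ gr) (hF : ∀ k l, F k l ∈ gr (i k - i l)) (k : ι) {j : G}
    {a : A} (ha : a ∈ gr j) :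
    row ρ gr i F k * lmul ι a = ρ (i k) j • (lmul ι a * row ρ gr i F k) := by
  simp only [row, Finset.sum_mul, Finset.mul_sum, Finset.smul_sum]
  refine Finset.sum_congr rfl fun l _ => ?_
  rw [mul_assoc, creation_mul_lmul ρ gr i l ha, mul_smul_comm, ← mul_assoc,
    lmul_mul_lmul ρ gr hc (hF k l) ha, smul_mul_assoc, smul_smul, mul_assoc, ρ.map_sub_left]
  congr 1
  field_simp [ρ.ne_zero]

/-- The rows of a matrix of degree zero satisfy the same commutation relations as the `t k`. -/
theorem row_mul_row (hc : IsRhoComm ρ gr) (hF : ∀ k l, F k l ∈ gr (i k - i l))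
    (he : ∀ k l, ρ (i k) (i k) = ρ (i l) (i l)) (m k : ι) :
    row ρ gr i F m * row ρ gr i F k =
      (-ρ (i m) (i m) * ρ (i m) (i k)) • (row ρ gr i F k * row ρ gr i F m) := by
  have h1 : ∀ n, row ρ gr i F m * (lmul ι (F k n) * creation ρ gr i n) =
      (-ρ (i m) (i m) * ρ (i m) (i k)) •
        (lmul ι (F k n) * creation ρ gr i n * row ρ gr i F m) := fun n => by
    rw [← mul_assoc, row_mul_lmul hc hF m (hF k n)]
    simp only [row, Finset.sum_mul, Finset.mul_sum, Finset.smul_sum]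
    refine Finset.sum_congr rfl fun l _ => ?_
    rw [smul_mul_assoc, mul_assoc, mul_assoc, creation_mul_creation ρ gr i he l n, mul_assoc,
      ← mul_assoc (creation ρ gr i n), creation_mul_lmul ρ gr i n (hF m l)]
    simp only [mul_smul_comm, smul_mul_assoc, smul_smul, mul_assoc]
    congr 1
    rw [he l m, ρ.map_sub_right, ρ.map_sub_right, ρ.swap (i m) (i n), ρ.swap (i l) (i n)]
    field_simp [ρ.ne_zero]
  conv_lhs => rw [row.eq_def ρ gr i F k]
  conv_rhs => rw [row.eq_def ρ gr i F k]
  simp only [Finset.mul_sum, Finset.sum_mul, Finset.smul_sum, h1]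

/-- By the commutation relations a row `θ m` satisfies `θ m * θ m = -θ m * θ m`. -/
theorem row_mul_self [CharZero K] (hc : IsRhoComm ρ gr) (hF : ∀ k l, F k l ∈ gr (i k - i l))
    (he : ∀ k l, ρ (i k) (i k) = ρ (i l) (i l)) (m : ι) :
    row ρ gr i F m * row ρ gr i F m = 0 := by
  have h := row_mul_row hc hF he m m
  rw [neg_mul, ρ.self_mul_self] at h
  refine LinearMap.ext fun f => funext fun S => ?_
  have h' := congrFun (LinearMap.congr_fun h f) S
  simp only [LinearMap.smul_apply, Pi.smul_apply] at h'
  have h2 : (2 : K) • (row ρ gr i F m * row ρ gr i F m) f S = 0 := by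
    rw [show (2 : K) = 1 - -1 by norm_num, sub_smul, one_smul, ← h', sub_self]
  simpa using h2

theorem row_mul_prod_eq_zero [CharZero K] (hc : IsRhoComm ρ gr)
    (hF : ∀ k l, F k l ∈ gr (i k - i l)) (he : ∀ k l, ρ (i k) (i k) = ρ (i l) (i l)) {m : ι}
    {L : List ι} (hm : m ∈ L) : row ρ gr i F m * (L.map (row ρ gr i F)).prod = 0 := by
  induction L with
  | nil => simp at hm
  | cons k L ih =>
    rw [List.map_cons, List.prod_cons, ← mul_assoc]
    by_cases h : m = k
    · subst h
      rw [row_mul_self hc hF he, zero_mul]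
    · rw [row_mul_row hc hF he, smul_mul_assoc, mul_assoc,
        ih ((List.mem_cons.1 hm).resolve_left h), mul_zero, smul_zero]

theorem prod_mul_row_eq_zero [CharZero K] (hc : IsRhoComm ρ gr)
    (hF : ∀ k l, F k l ∈ gr (i k - i l)) (he : ∀ k l, ρ (i k) (i k) = ρ (i l) (i l)) {m : ι}
    {L : List ι} (hm : m ∈ L) : (L.map (row ρ gr i F)).prod * row ρ gr i F m = 0 := by
  induction L with
  | nil => simp at hm
  | cons k L ih =>
    rw [List.map_cons, List.prod_cons, mul_assoc]
    by_cases h : m ∈ L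
    · rw [ih h, mul_zero]
    · obtain rfl := (List.mem_cons.1 hm).resolve_right h
      clear ih h hm
      induction L with
      | nil => simp [row_mul_self hc hF he]
      | cons k L ih =>
        rw [List.map_cons, List.prod_cons, mul_assoc, ← mul_assoc, row_mul_row hc hF he,
          smul_mul_assoc, mul_assoc, ih, mul_zero, smul_zero]

theorem prod_row_mul_lmul (hc : IsRhoComm ρ gr) (hF : ∀ k l, F k l ∈ gr (i k - i l))
    (L : List ι) {j : G} {a : A} (ha : a ∈ gr j) :
    (L.map (row ρ gr i F)).prod * lmul ι a =
      ρ (L.map i).sum j • (lmul ι a * (L.map (row ρ gr i F)).prod) := by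
  induction L with
  | nil => simp
  | cons k L ih =>
    simp only [List.map_cons, List.prod_cons, List.sum_cons]
    rw [mul_assoc, ih, mul_smul_comm, ← mul_assoc, row_mul_lmul hc hF k ha, smul_mul_assoc,
      smul_smul, mul_assoc, ρ.map_add_left, mul_comm (ρ (i k) j)]

/-- The derivation `X` passes the tail `L₂` of the product `∏ k, θ k`. As `X (θ k)` is
`∑ m, (X(F) F⁻¹) k m θ m` and a product with a repeated factor `θ m` vanishes, only the diagonal
entries of `X(F) F⁻¹` contribute. -/
theorem der_mul_prod_row [CharZero K] (hc : IsRhoComm ρ gr) (hF : ∀ k l, F k l ∈ gr (i k - i l))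
    (he : ∀ k l, ρ (i k) (i k) = ρ (i l) (i l)) {δ : G} {X : A →ₗ[K] A} (hX : IsRhoDer ρ gr δ X)
    {H : Matrix ι ι A} (hHmem : ∀ k l, H k l ∈ gr (δ + (i k - i l)))
    (hH : ∀ k l, X (F k l) = ∑ m, H k m * F m l) (L₁ L₂ : List ι) (hL : ∀ k, k ∈ L₁ ++ L₂)
    (hnd : (L₁ ++ L₂).Nodup) :
    ρ δ (L₁.map i).sum • ((L₁.map (row ρ gr i F)).prod * der ι X * (L₂.map (row ρ gr i F)).prod) =
      lmul ι (L₂.map fun k => H k k).sum * ((L₁ ++ L₂).map (row ρ gr i F)).prod +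
        ρ δ ((L₁ ++ L₂).map i).sum • (((L₁ ++ L₂).map (row ρ gr i F)).prod * der ι X) := by
  induction L₂ generalizing L₁ with
  | nil =>
    have : lmul (K := K) ι (0 : A) = 0 := by ext; simp [lmul_apply]
    simp [this]
  | cons k L ih =>
    have hXrow : der ι X * row ρ gr i F k =
        ∑ m, lmul ι (H k m) * row ρ gr i F m + ρ δ (i k) • (row ρ gr i F k * der ι X) := by
      have h1 : ∑ m, lmul ι (H k m) * row ρ gr i F m =
          ∑ l, lmul ι (X (F k l)) * creation ρ gr i l := by
        simp only [row, hH, lmul_sum, Finset.mul_sum, Finset.sum_mul, lmul_mul, mul_assoc]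
        rw [Finset.sum_comm]
      rw [h1]
      simp only [row, Finset.mul_sum, Finset.sum_mul, Finset.smul_sum]
      rw [← Finset.sum_add_distrib]
      refine Finset.sum_congr rfl fun l _ => ?_
      rw [← mul_assoc, der_mul_lmul ρ gr hX (hF k l), add_mul, smul_mul_assoc, mul_assoc,
        mul_assoc, der_mul_creation ρ gr i hX, mul_smul_comm, smul_smul, ρ.map_sub_right]
      congr 2
      field_simp [ρ.ne_zero]
    have hdiag : (L₁.map (row ρ gr i F)).prod * (∑ m, lmul ι (H k m) * row ρ gr i F m) *
        (L.map (row ρ gr i F)).prod =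
        ρ (L₁.map i).sum δ • (lmul ι (H k k) * ((L₁ ++ k :: L).map (row ρ gr i F)).prod) := by
      rw [Finset.mul_sum, Finset.sum_mul, Finset.sum_eq_single k]
      · have hkk : H k k ∈ gr δ := by simpa using hHmem k k
        rw [← mul_assoc, prod_row_mul_lmul hc hF L₁ hkk]
        simp [mul_assoc]
      · intro m _ hmk
        rw [← mul_assoc, prod_row_mul_lmul hc hF L₁ (hHmem k m), smul_mul_assoc, smul_mul_assoc,
          mul_assoc, mul_assoc]
        have hm : m ∈ L₁ ∨ m ∈ L := by
          have := hL m
          simp only [List.mem_append, List.mem_cons, hmk, false_or] at this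
          exact this
        rcases hm with hm | hm
        · rw [← mul_assoc _ (row ρ gr i F m), prod_mul_row_eq_zero hc hF he hm, zero_mul, mul_zero,
            smul_zero]
        · rw [row_mul_prod_eq_zero hc hF he hm, mul_zero, mul_zero, smul_zero]
      · simp
    have hassoc : L₁ ++ k :: L = (L₁ ++ [k]) ++ L := by simp
    have ih' := ih (L₁ ++ [k]) (by rwa [← hassoc]) (by rwa [← hassoc])
    rw [← hassoc] at ih'
    rw [List.map_cons, List.prod_cons, mul_assoc, ← mul_assoc (der ι X), hXrow, add_mul, mul_add,
      ← mul_assoc, hdiag, smul_add, smul_smul, ρ.mul_swap, one_smul, List.map_cons, List.sum_cons,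
      show lmul (K := K) ι (H k k + (L.map fun k => H k k).sum) =
        lmul ι (H k k) + lmul ι (L.map fun k => H k k).sum by ext; simp [lmul_apply, add_mul],
      add_mul, add_assoc, ← ih']
    simp only [List.map_append, List.sum_append, List.prod_append, List.map_cons, List.map_nil,
      List.sum_cons, List.sum_nil, List.prod_cons, List.prod_nil, mul_one, add_zero, smul_mul_assoc,
      mul_smul_comm, smul_smul, ρ.map_add_right, mul_assoc]

/-- The defining property `∏ k, (∑ l, F k l t l) = ρdet(F) ∏ k, t k` of the graded determinant. -/
theorem prod_row_ket {r : ℕ} {i : Fin r → G} {F : Matrix (Fin r) (Fin r) A}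
    (hF : ∀ k l, F k l ∈ gr (i k - i l)) :
    ((List.finRange r).map (row ρ gr i F)).prod (ket ∅ 1) = ket Finset.univ (rhoDet ρ i F) := by
  have hexp : ((List.finRange r).map (row ρ gr i F)).prod =
      ∑ f : Fin r → Fin r, (List.ofFn fun k => (lmul (Fin r) (F k (f k)) * creation ρ gr i (f k) :
        Module.End K (Finset (Fin r) → A))).prod := by
    have := (MultilinearMap.mkPiAlgebraFin K r (Module.End K (Finset (Fin r) → A))).map_sum
      (α := fun _ : Fin r => Fin r)
      (g := fun k l => lmul (Fin r) (F k l) * creation ρ gr i l)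
    simp only [MultilinearMap.mkPiAlgebraFin_apply] at this
    rw [← this, List.ofFn_eq_map]
    rfl
  rw [hexp, LinearMap.sum_apply]
  rw [Finset.sum_congr rfl fun f _ => prod_lmul_creation ρ gr i f (fun k => F k (f k))
    (fun k => i k - i (f k)) fun k => hF k (f k), ← Finset.sum_filter]
  have hket : ket (Finset.univ : Finset (Fin r)) (rhoDet ρ i F) =
      ∑ σ : Equiv.Perm (Fin r), ket Finset.univ
      (((∏ k : Fin r, ∏ l : Fin r, if k < l then ρ (i (σ k)) (i l - i (σ l)) else 1) *
      (∏ k : Fin r, ∏ l : Fin r, if k < l ∧ σ l < σ k then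
        -ρ (i (σ k)) (i (σ k)) * ρ (i (σ k)) (i (σ l)) else 1)) •
      (List.ofFn fun k => F k (σ k)).prod) := by
    ext T
    rw [Finset.sum_apply]
    by_cases h : T = Finset.univ
    · simp only [ket, h, if_true, rhoDet]
      refine Finset.sum_congr rfl fun σ _ => ?_
      rw [Fin.sort_univ, List.ofFn_eq_map]
    · simp [ket, h]
  rw [hket]
  refine Finset.sum_bij (fun f h => Equiv.ofBijective f
    (Finite.injective_iff_bijective.1 (Finset.mem_filter.1 h).2)) (fun _ _ => Finset.mem_univ _)
    (fun _ _ _ _ h => by injection h)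
    (fun σ _ => ⟨σ, Finset.mem_filter.2 ⟨Finset.mem_univ _, σ.injective⟩, Equiv.ext fun _ => rfl⟩)
    fun f hf => ?_
  rw [Finset.image_univ_of_surjective
    (Finite.injective_iff_surjective.1 (Finset.mem_filter.1 hf).2)]
  rfl

end GradedFock

/-! ### Jacobi's formula for the graded determinant -/

section Jacobi

variable {G K : Type*} [AddCommGroup G] [Field K] {ρ : CommutationFactor G K}
  {A : Type*} [Ring A] [Algebra K A] {gr : G → Submodule K A}

theorem rhoDet_reindex {ι κ : Type*} [Fintype ι] [LinearOrder ι] [Fintype κ] [LinearOrder κ]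
    (e : κ ≃o ι) (i : ι → G) (F : Matrix ι ι A) :
    rhoDet ρ (i ∘ e) (F.submatrix e e) = rhoDet ρ i F := by
  have hsort : (Finset.univ : Finset ι).sort (· ≤ ·) =
      ((Finset.univ : Finset κ).sort (· ≤ ·)).map e := by
    refine (Finset.univ.sortedLT_sort).eq_of_mem_iff ?_ (fun a => ?_)
    · rw [List.sortedLT_iff_pairwise, List.pairwise_map]
      exact (Finset.univ.sortedLT_sort).pairwise.imp fun h => e.strictMono h
    · simp only [Finset.mem_sort, Finset.mem_univ, List.mem_map, true_and, true_iff]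
      exact ⟨e.symm a, by simp⟩
  unfold rhoDet
  refine Fintype.sum_equiv (e.toEquiv.permCongr) _ _ fun σ => ?_
  rw [hsort, List.map_map]
  have hperm : ∀ k, e.toEquiv.permCongr σ (e k) = e (σ k) := fun k => by
    simp [Equiv.permCongr_apply]
  congr 1
  · congr 1
    all_goals
      refine Fintype.prod_equiv e.toEquiv _ _ fun k => Fintype.prod_equiv e.toEquiv _ _ fun l => ?_
      simp only [OrderIso.coe_toEquiv, OrderIso.lt_iff_lt, hperm, Function.comp_apply]
  · congr 1
    refine List.map_congr_left fun k _ => ?_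
    simp only [Function.comp_apply, hperm, Matrix.submatrix_apply]

theorem rhoDet_mem [DecidableEq G] [GradedAlgebra gr] {ι : Type*} [Fintype ι] [LinearOrder ι]
    {i : ι → G} {F : Matrix ι ι A} (hF : ∀ k l, F k l ∈ gr (i k - i l)) :
    rhoDet ρ i F ∈ gr 0 := by
  refine sum_mem fun σ _ => Submodule.smul_mem _ _ ?_
  have h := SetLike.list_prod_map_mem_graded (A := gr) ((Finset.univ : Finset ι).sort (· ≤ ·))
    (fun k => i k - i (σ k)) (fun k => F k (σ k)) fun k _ => hF _ _
  have h0 : (((Finset.univ : Finset ι).sort (· ≤ ·)).map fun k => i k - i (σ k)).sum = 0 := by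
    rw [← Multiset.sum_coe, ← Multiset.map_coe, Finset.sort_eq, ← Finset.sum_eq_multiset_sum,
      Finset.sum_sub_distrib, Equiv.sum_comp σ i, sub_self]
  rwa [h0] at h

/-- Jacobi's formula `X(ρdet F) = tr(X(F) F⁻¹) ρdet F` for the graded determinant. -/
theorem IsRhoDer.map_rhoDet [CharZero K] [DecidableEq G] [GradedAlgebra gr] (hc : IsRhoComm ρ gr)
    {ι : Type*} [Fintype ι] [LinearOrder ι] {i : ι → G} {F H : Matrix ι ι A}
    (hF : ∀ k l, F k l ∈ gr (i k - i l)) (he : ∀ k l, ρ (i k) (i k) = ρ (i l) (i l))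
    (hFH : F * H = 1) (hHF : H * F = 1) {δ : G} {X : A →ₗ[K] A} (hX : IsRhoDer ρ gr δ X) :
    X (rhoDet ρ i F) = (F.map X * H).trace * rhoDet ρ i F := by
  have hHmem := matrix_inv_mem hF hFH hHF
  let e : Fin (Fintype.card ι) ≃o ι := Fintype.orderIsoFinOfCardEq ι rfl
  rw [← rhoDet_reindex e]
  let T : Matrix ι ι A := F.map X * H
  have hTmem : ∀ k l, T k l ∈ gr (δ + (i k - i l)) := fun k l => by
    simp only [T, Matrix.mul_apply, Matrix.map_apply]
    refine sum_mem fun m _ => ?_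
    have := SetLike.GradedMul.mul_mem (hX.map_mem _ _ (hF k m)) (hHmem m l)
    rwa [add_assoc, sub_add_sub_cancel] at this
  have hT : T * F = F.map X := by
    simp only [T, Matrix.mul_assoc, hHF, Matrix.mul_one]
  have h := GradedFock.der_mul_prod_row (i := i ∘ e) (F := F.submatrix e e) (H := T.submatrix e e)
    hc (fun k l => hF _ _) (fun k l => he _ _) hX (fun k l => hTmem _ _)
    (fun k l => by
      have := congrFun (congrFun hT (e k)) (e l)
      simp only [Matrix.mul_apply, Matrix.map_apply] at this
      simp only [Matrix.submatrix_apply, ← this]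
      exact (Fintype.sum_equiv e.toEquiv _ _ fun m => rfl).symm)
    [] (List.finRange _) (by simp) (by simpa using List.nodup_finRange _)
  -- Evaluate on the constant `1`, which `X` kills, and compare the coefficients of `∏ k, t k`.
  have h' := congrFun (LinearMap.congr_fun h (GradedFock.ket ∅ 1)) Finset.univ
  have hder : GradedFock.der (Fin (Fintype.card ι)) X (GradedFock.ket ∅ 1) = 0 := by
    ext S
    by_cases hS : S = ∅ <;> simp [GradedFock.der_apply, GradedFock.ket, hS, hX.map_one]
  simp only [List.map_nil, List.sum_nil, List.prod_nil, one_mul, ρ.map_zero_right, one_smul,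
    List.nil_append, LinearMap.add_apply, Module.End.mul_apply, LinearMap.smul_apply, hder,
    map_zero, smul_zero, add_zero] at h'
  rw [GradedFock.prod_row_ket (i := i ∘ e) (F := F.submatrix e e) (fun k l => hF _ _),
    GradedFock.lmul_apply, GradedFock.der_apply] at h'
  simp only [GradedFock.ket, if_true] at h'
  rw [h']
  congr 1
  rw [Matrix.trace, ← List.ofFn_eq_map, List.sum_ofFn]
  exact Fintype.sum_equiv e.toEquiv _ _ fun m => rfl

end Jacobi

/-! ### The graded Berezinian -/

section BerezinianJacobi

variable {G K : Type*} [AddCommGroup G] [Field K] {ρ : CommutationFactor G K}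
  {A : Type*} [Ring A] [Algebra K A] {gr : G → Submodule K A}
  {κ l : Type*} [Fintype κ] [Fintype l]

theorem matrix_mul_mem [DecidableEq G] [GradedAlgebra gr] {α β : Type*} {δ : G} {i : α → G}
    {j : κ → G} {h : β → G} {P : Matrix α κ A} {Q : Matrix κ β A}
    (hP : ∀ a b, P a b ∈ gr (δ + (i a - j b))) (hQ : ∀ a b, Q a b ∈ gr (j a - h b))
    (a : α) (b : β) : (P * Q) a b ∈ gr (δ + (i a - h b)) := by
  rw [Matrix.mul_apply]
  refine sum_mem fun c _ => ?_
  have := SetLike.GradedMul.mul_mem (hP a c) (hQ c b)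
  rwa [add_assoc, sub_add_sub_cancel] at this

theorem matrix_mul_mem_of_zero [DecidableEq G] [GradedAlgebra gr] {α β : Type*} {i : α → G}
    {j : κ → G} {h : β → G} {P : Matrix α κ A} {Q : Matrix κ β A}
    (hP : ∀ a b, P a b ∈ gr (i a - j b)) (hQ : ∀ a b, Q a b ∈ gr (j a - h b))
    (a : α) (b : β) : (P * Q) a b ∈ gr (i a - h b) := by
  simpa only [zero_add] using
    matrix_mul_mem (δ := 0) (by simpa only [zero_add] using hP) hQ a b

variable (ρ) in
/-- The matrix with the entries `ρ(δ, |P a b|) P a b`, for `|P a b| = i a - j b`. -/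
def twistMatrix {α β : Type*} (δ : G) (i : α → G) (j : β → G) (P : Matrix α β A) : Matrix α β A :=
  Matrix.of fun a b => ρ δ (i a - j b) • P a b

theorem IsRhoDer.map_matrix_mul {α β : Type*} {δ : G} {X : A →ₗ[K] A} (hX : IsRhoDer ρ gr δ X)
    {i : α → G} {j : κ → G} {P : Matrix α κ A} (hP : ∀ a b, P a b ∈ gr (i a - j b))
    (Q : Matrix κ β A) :
    (P * Q).map X = P.map X * Q + twistMatrix ρ δ i j P * Q.map X := by
  ext a b
  simp only [Matrix.map_apply, Matrix.mul_apply, Matrix.add_apply, map_sum, twistMatrix,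
    Matrix.of_apply, ← Finset.sum_add_distrib, smul_mul_assoc]
  exact Finset.sum_congr rfl fun c _ => hX.leibniz _ _ _ (hP a c)

/-- Graded cyclicity of the trace of a product of an even-odd and an odd-even block. -/
theorem trace_twistMatrix_mul (hc : IsRhoComm ρ gr) {δ : G} {i : κ → G} {j : l → G}
    (hij : ∀ a b, ρ (i a) (i a) * ρ (j b) (j b) = -1) {P : Matrix κ l A} {Y : Matrix l κ A}
    (hP : ∀ a b, P a b ∈ gr (i a - j b)) (hY : ∀ b a, Y b a ∈ gr (δ + (j b - i a))) :
    (twistMatrix ρ δ i j P * Y).trace = -(Y * P).trace := by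
  simp only [Matrix.trace, Matrix.diag_apply, Matrix.mul_apply, twistMatrix, Matrix.of_apply]
  rw [Finset.sum_comm, ← Finset.sum_neg_distrib]
  refine Finset.sum_congr rfl fun b _ => ?_
  rw [← Finset.sum_neg_distrib]
  refine Finset.sum_congr rfl fun a _ => ?_
  rw [smul_mul_assoc, hc _ _ _ _ (hP a b) (hY b a), smul_smul, ρ.map_add_right, ← mul_assoc,
    ρ.mul_swap, one_mul, ρ.map_neg_sub_self, hij, neg_one_smul]

variable [DecidableEq κ] [DecidableEq l]

/-- The block computation for Jacobi's formula of the Berezinian: for the Schur complement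
`S = F₀₀ - F₀₁ F₁₁⁻¹ F₁₀` and the blocks of the inverse matrix `H`, the supertrace of `X(F) H` is
`tr(X(S) S⁻¹) - tr(X(F₁₁) F₁₁⁻¹)`. -/
theorem IsRhoDer.trace_schur [DecidableEq G] [GradedAlgebra gr] (hc : IsRhoComm ρ gr) {δ : G}
    {X : A →ₗ[K] A} (hX : IsRhoDer ρ gr δ X) {i : κ → G} {j : l → G}
    (hij : ∀ a b, ρ (i a) (i a) * ρ (j b) (j b) = -1)
    {F₀₀ H₀₀ : Matrix κ κ A} {F₀₁ H₀₁ : Matrix κ l A} {F₁₀ H₁₀ : Matrix l κ A}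
    {F₁₁ H₁₁ u : Matrix l l A}
    (hF₀₀ : ∀ a b, F₀₀ a b ∈ gr (i a - i b)) (hF₀₁ : ∀ a b, F₀₁ a b ∈ gr (i a - j b))
    (hF₁₀ : ∀ a b, F₁₀ a b ∈ gr (j a - i b)) (hF₁₁ : ∀ a b, F₁₁ a b ∈ gr (j a - j b))
    (hH₀₀ : ∀ a b, H₀₀ a b ∈ gr (i a - i b)) (hH₁₀ : ∀ a b, H₁₀ a b ∈ gr (j a - i b))
    (hFu : F₁₁ * u = 1) (huF : u * F₁₁ = 1)
    (r00 : F₀₀ * H₀₀ + F₀₁ * H₁₀ = 1) (r10 : F₁₀ * H₀₀ + F₁₁ * H₁₀ = 0)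
    (r11 : F₁₀ * H₀₁ + F₁₁ * H₁₁ = 1)
    (s00 : H₀₀ * F₀₀ + H₀₁ * F₁₀ = 1) (s01 : H₀₀ * F₀₁ + H₀₁ * F₁₁ = 0) :
    (∀ a b, (F₀₀ - F₀₁ * u * F₁₀) a b ∈ gr (i a - i b)) ∧
    (F₀₀ - F₀₁ * u * F₁₀) * H₀₀ = 1 ∧ H₀₀ * (F₀₀ - F₀₁ * u * F₁₀) = 1 ∧
    ((F₀₀ - F₀₁ * u * F₁₀).map X * H₀₀).trace - (F₁₁.map X * u).trace =
      (F₀₀.map X * H₀₀ + F₀₁.map X * H₁₀).trace -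
        (F₁₀.map X * H₀₁ + F₁₁.map X * H₁₁).trace := by
  have hu := matrix_inv_mem hF₁₁ hFu huF
  have hb : ∀ a b, (F₀₁ * u) a b ∈ gr (i a - j b) := fun a b => by
    exact matrix_mul_mem_of_zero hF₀₁ hu a b
  have h10 : u * F₁₀ * H₀₀ = -H₁₀ := by
    rw [Matrix.mul_assoc, eq_neg_of_add_eq_zero_left r10, Matrix.mul_neg, ← Matrix.mul_assoc, huF,
      Matrix.one_mul]
  have h01 : H₀₀ * (F₀₁ * u) = -H₀₁ := by
    rw [← Matrix.mul_assoc, eq_neg_of_add_eq_zero_left s01, Matrix.neg_mul, Matrix.mul_assoc, hFu,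
      Matrix.mul_one]
  have h11 : H₁₀ * (F₀₁ * u) = u - H₁₁ := by
    rw [← neg_eq_iff_eq_neg.2 h10, Matrix.neg_mul, Matrix.mul_assoc, h01, Matrix.mul_neg, neg_neg,
      Matrix.mul_assoc, eq_sub_of_add_eq r11, Matrix.mul_sub, Matrix.mul_one, ← Matrix.mul_assoc,
      huF, Matrix.one_mul]
  refine ⟨fun a b => sub_mem (hF₀₀ a b) ?_, ?_, ?_, ?_⟩
  · exact matrix_mul_mem_of_zero hb hF₁₀ a b
  · rw [Matrix.sub_mul, Matrix.mul_assoc F₀₁, Matrix.mul_assoc F₀₁, h10, Matrix.mul_neg,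
      sub_neg_eq_add, r00]
  · rw [Matrix.mul_sub, ← Matrix.mul_assoc H₀₀, h01, Matrix.neg_mul, sub_neg_eq_add, s00]
  · -- Eliminate `X(u)` by differentiating `F₀₁ = (F₀₁ u) F₁₁` instead of the inverse matrix.
    have hXb : (F₀₁ * u).map X =
        (F₀₁.map X - twistMatrix ρ δ i j (F₀₁ * u) * F₁₁.map X) * u := by
      have h : F₀₁ = F₀₁ * u * F₁₁ := by rw [Matrix.mul_assoc, huF, Matrix.mul_one]
      have h' := congrArg (fun P => P.map X) h
      simp only [hX.map_matrix_mul hb] at h'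
      rw [h', add_sub_cancel_right, Matrix.mul_assoc, hFu, Matrix.mul_one]
    have hmapsub : (F₀₀ - F₀₁ * u * F₁₀).map X = F₀₀.map X - (F₀₁ * u * F₁₀).map X := by
      ext; simp
    have hY : ∀ a b, (F₁₁.map X * H₁₀ + F₁₀.map X * H₀₀) a b ∈ gr (δ + (j a - i b)) := fun a b => by
      refine add_mem ?_ ?_
      · exact matrix_mul_mem (P := F₁₁.map X) (fun a b => hX.map_mem _ _ (hF₁₁ a b)) hH₁₀ a b
      · exact matrix_mul_mem (P := F₁₀.map X) (fun a b => hX.map_mem _ _ (hF₁₀ a b)) hH₀₀ a b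
    have htr := trace_twistMatrix_mul hc hij hb hY
    rw [Matrix.add_mul, Matrix.mul_assoc, Matrix.mul_assoc, h11, h01] at htr
    rw [hmapsub, hX.map_matrix_mul hb, hXb,
      show (F₀₀.map X - ((F₀₁.map X - twistMatrix ρ δ i j (F₀₁ * u) * F₁₁.map X) * u * F₁₀ +
          twistMatrix ρ δ i j (F₀₁ * u) * F₁₀.map X)) * H₀₀ =
        F₀₀.map X * H₀₀ - F₀₁.map X * (u * F₁₀ * H₀₀) +
          twistMatrix ρ δ i j (F₀₁ * u) * (F₁₁.map X * (u * F₁₀ * H₀₀)) -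
          twistMatrix ρ δ i j (F₀₁ * u) * (F₁₀.map X * H₀₀) by
        simp only [Matrix.sub_mul, Matrix.add_mul, Matrix.mul_assoc]; abel, h10]
    simp only [Matrix.mul_neg, Matrix.mul_add, Matrix.mul_sub, Matrix.trace_add, Matrix.trace_sub,
      Matrix.trace_neg] at htr ⊢
    rw [← sub_eq_zero] at htr ⊢
    rw [← neg_eq_zero, ← htr]
    abel

end BerezinianJacobi

section Berezinian

variable {G K : Type*} [AddCommGroup G] [Field K] {ρ : CommutationFactor G K}
  {A : Type*} [Ring A] [Algebra K A] {gr : G → Submodule K A}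
  [DecidableEq G] [GradedAlgebra gr]
  {ι : Type*} [Fintype ι] [LinearOrder ι] {i : ι → G} {F H : Matrix ι ι A}

/-- The logarithmic derivative of a quotient of two elements of degree zero. -/
theorem map_mul_ringInverse [Nontrivial A] (hc : IsRhoComm ρ gr) {a b : A} (ha : a ∈ gr 0)
    (hb : b ∈ gr 0) (hab : IsUnit (a * Ring.inverse b)) :
    a * Ring.inverse b ∈ gr 0 ∧ ∀ {δ : G} {X : A →ₗ[K] A}, IsRhoDer ρ gr δ X → ∀ {s t : A},
      X a = s * a → X b = t * b → X (a * Ring.inverse b) = (s - t) * (a * Ring.inverse b) := by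
  have hu : IsUnit b := by
    by_contra h
    rw [Ring.inverse_non_unit _ h, mul_zero] at hab
    exact not_isUnit_zero hab
  have h1 := Ring.mul_inverse_cancel b hu
  have h2 := Ring.inverse_mul_cancel b hu
  have hv := inv_mem_zero hb h1 h2
  have hav : a * Ring.inverse b ∈ gr 0 := by
    simpa using SetLike.GradedMul.mul_mem ha hv
  refine ⟨hav, fun {δ X} hX {s t} hs ht => ?_⟩
  have hXv : X (Ring.inverse b) = -(Ring.inverse b * t) := by
    have h := hX.leibniz_zero hb (Ring.inverse b)
    rw [h1, hX.map_one, ht, mul_assoc, h1, mul_one] at h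
    calc X (Ring.inverse b) = Ring.inverse b * (b * X (Ring.inverse b)) := by
          rw [← mul_assoc, h2, one_mul]
      _ = -(Ring.inverse b * t) := by
          rw [← neg_eq_of_add_eq_zero_right h.symm, mul_neg]
  rw [hX.leibniz_zero ha, hs, hXv, mul_neg, ← mul_assoc a, hc.commute_of_mem_zero hav t, sub_mul,
    mul_assoc, sub_eq_add_neg]

/-- Jacobi's formula `X(ρBer F) = str(X(F) F⁻¹) ρBer F` for the graded Berezinian. -/
theorem IsRhoDer.map_rhoBer [CharZero K] (hc : IsRhoComm ρ gr)
    (hF : ∀ k l, F k l ∈ gr (i k - i l)) (hFH : F * H = 1) (hHF : H * F = 1)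
    (hB : IsUnit (rhoBer ρ i F)) :
    rhoBer ρ i F ∈ gr 0 ∧ ∀ {δ : G} {X : A →ₗ[K] A}, IsRhoDer ρ gr δ X →
      X (rhoBer ρ i F) = (∑ k, ρ (i k) (i k) • (F.map X * H) k k) * rhoBer ρ i F := by
  classical
  rcases subsingleton_or_nontrivial A with hA | hA
  · exact ⟨by rw [Subsingleton.elim (rhoBer ρ i F) 0]; exact zero_mem _,
      fun _ => Subsingleton.elim _ _⟩
  have hHmem := matrix_inv_mem hF hFH hHF
  let p : ι → Prop := fun k => ρ (i k) (i k) = 1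
  have hodd : ∀ k : {k // ¬ p k}, ρ (i k) (i k) = -1 := fun k =>
    (ρ.self_eq_one_or (i k)).resolve_left k.2
  unfold rhoBer at hB ⊢
  simp only at hB ⊢
  split_ifs at hB ⊢ with hcond
  swap
  · exact absurd hB not_isUnit_zero
  obtain ⟨-, h11⟩ := hcond
  have hij : ∀ (a : {k // p k}) (b : {k // ¬ p k}), ρ (i a) (i a) * ρ (i b) (i b) = -1 :=
    fun a b => by rw [show ρ (i a) (i a) = 1 from a.2, hodd, one_mul]
  have hpq : Disjoint (fun k => ¬ p k) p := Pi.disjoint_iff.2 fun k => by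
    by_cases h : p k <;> simp [h]
  have hblock : ∀ (P Q : Matrix ι ι A) (q r : ι → Prop), (P * Q).toBlock q r =
      P.toBlock q p * Q.toBlock p r +
        P.toBlock q (fun k => ¬ p k) * Q.toBlock (fun k => ¬ p k) r := fun P Q q r => by
    ext a b
    simp only [Matrix.toBlock_apply, Matrix.mul_apply, Matrix.add_apply]
    exact (Fintype.sum_subtype_add_sum_subtype p fun x => P a.1 x * Q x b.1).symm
  have r00 := hblock F H p p
  have r10 := hblock F H (fun k => ¬ p k) p
  have r11 := hblock F H (fun k => ¬ p k) (fun k => ¬ p k)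
  have s00 := hblock H F p p
  have s01 := hblock H F p (fun k => ¬ p k)
  rw [hFH, Matrix.toBlock_one_self] at r00 r11
  rw [hHF, Matrix.toBlock_one_self] at s00
  rw [hFH, Matrix.toBlock_one_disjoint hpq] at r10
  rw [hHF, Matrix.toBlock_one_disjoint hpq.symm] at s01
  have hFu := Ring.mul_inverse_cancel _ h11
  have huF := Ring.inverse_mul_cancel _ h11
  have key := fun {δ : G} {X : A →ₗ[K] A} (hX : IsRhoDer ρ gr δ X) =>
    hX.trace_schur hc hij (fun a b => hF a.1 b.1) (fun a b => hF a.1 b.1) (fun a b => hF a.1 b.1)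
      (fun a b => hF a.1 b.1) (fun a b => hHmem a.1 b.1) (fun a b => hHmem a.1 b.1) hFu huF
      r00.symm r10.symm r11.symm s00.symm s01.symm
  -- The first three assertions of `key` do not involve `X`; the zero derivation yields them.
  have hzero : IsRhoDer ρ gr 0 (0 : A →ₗ[K] A) := ⟨fun _ _ _ => zero_mem _, by simp⟩
  obtain ⟨hS, hSH, hHS, -⟩ := key hzero
  have hD₀ := rhoDet_mem (ρ := ρ) hS
  have hD₁ := rhoDet_mem (ρ := ρ) (gr := gr) (i := fun k : {k // ¬ p k} => i k.1)
    (F := F.toBlock (fun k => ¬ p k) (fun k => ¬ p k)) fun a b => hF a.1 b.1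
  have hX₀ := fun {δ : G} {X : A →ₗ[K] A} (hX : IsRhoDer ρ gr δ X) =>
    hX.map_rhoDet hc hS (fun k l => k.2.trans l.2.symm) hSH hHS
  have hX₁ := fun {δ : G} {X : A →ₗ[K] A} (hX : IsRhoDer ρ gr δ X) =>
    hX.map_rhoDet hc (i := fun k : {k // ¬ p k} => i k.1)
      (F := F.toBlock (fun k => ¬ p k) (fun k => ¬ p k)) (fun a b => hF a.1 b.1)
      (fun k l => (hodd k).trans (hodd l).symm) hFu huF
  have hstr : ∀ {δ : G} {X : A →ₗ[K] A}, IsRhoDer ρ gr δ X →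
      ∑ k, ρ (i k) (i k) • (F.map X * H) k k = _ - _ := fun {δ X} hX => by
    refine Eq.trans ?_ (key hX).2.2.2.symm
    rw [← Fintype.sum_subtype_add_sum_subtype p, sub_eq_add_neg, Matrix.trace, Matrix.trace,
      ← Finset.sum_neg_distrib]
    congr 1
    · refine Finset.sum_congr rfl fun k _ => ?_
      rw [show ρ (i k) (i k) = 1 from k.2, one_smul]
      exact congrFun (congrFun (hblock (F.map X) H p p) k) k
    · refine Finset.sum_congr rfl fun k _ => ?_
      rw [hodd, neg_one_smul]
      exact congrArg Neg.neg
        (congrFun (congrFun (hblock (F.map X) H (fun k => ¬ p k) (fun k => ¬ p k)) k) k)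
  obtain ⟨hmem, hlog⟩ := map_mul_ringInverse hc hD₀ hD₁ hB
  exact ⟨hmem, fun hX => (hlog hX (hX₀ hX) (hX₁ hX)).trans (congrArg (· * _) (hstr hX).symm)⟩

end Berezinian

/-! ### Coordinate frames and the divergence of a derivation -/

section Frames

variable {G K : Type*} [AddCommGroup G] [Field K]
  {A : Type*} [Ring A] [Algebra K A] {ι : Type*} [Fintype ι] [DecidableEq ι]

/-- Elements `x a` of degrees `d a` of a graded algebra and `ρ`-commuting `ρ`-derivations
`D a = ∂/∂x^a` of degrees `-d a` with `D a (x b) = δ_ab`. -/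
structure IsCoordFrame (ρ : CommutationFactor G K) (gr : G → Submodule K A) (d : ι → G)
    (x : ι → A) (D : ι → A →ₗ[K] A) : Prop where
  mem : ∀ a, x a ∈ gr (d a)
  der : ∀ a, IsRhoDer ρ gr (-d a) (D a)
  apply_coord : ∀ a b, D a (x b) = if a = b then 1 else 0
  comm : ∀ a b f, D a (D b f) = ρ (d a) (d b) • D b (D a f)

/-- The derivation `X` has the expression `X = ∑ a, X(x a) D a` in the frame `x`, `D`. -/
def ExpandsIn (x : ι → A) (D : ι → A →ₗ[K] A) (X : A →ₗ[K] A) : Prop :=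
  ∀ f, X f = ∑ a, X (x a) * D a f

/-- The operator `s ↦ ∑ a, ρ(|x^a|, |x^a| + |X|) ∂(X^a s)/∂x^a`. -/
def frameLie (ρ : CommutationFactor G K) (d : ι → G) (x : ι → A) (D : ι → A →ₗ[K] A) (δ : G)
    (X : A →ₗ[K] A) (s : A) : A :=
  ∑ a, ρ (d a) (d a + δ) • D a (X (x a) * s)

variable {ρ : CommutationFactor G K} {gr : G → Submodule K A}
  {d : ι → G} {x y : ι → A} {D E : ι → A →ₗ[K] A} {δ : G} {X : A →ₗ[K] A}

namespace IsCoordFrame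

/-- The Lie derivative of `D(x) s` is `D(x) (div X · s + X s)`, where `div X = frameLie … 1` is the
divergence with respect to the coordinate volume form `D(x)`. -/
theorem frameLie_eq (hx : IsCoordFrame ρ gr d x D) (hX : IsRhoDer ρ gr δ X)
    (hXe : ExpandsIn x D X) (s : A) :
    frameLie ρ d x D δ X s = frameLie ρ d x D δ X 1 * s + X s := by
  rw [hXe s]
  simp only [frameLie, mul_one, Finset.sum_mul, ← Finset.sum_add_distrib]
  refine Finset.sum_congr rfl fun a _ => ?_
  rw [(hx.der a).leibniz _ _ s (hX.map_mem _ _ (hx.mem a)), smul_add, smul_mul_assoc, smul_smul,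
    ρ.map_neg_left, add_comm δ, mul_inv_cancel₀ (ρ.ne_zero _ _), one_smul]

theorem frameLie_mem [DecidableEq G] [GradedAlgebra gr] (hx : IsCoordFrame ρ gr d x D)
    (hX : IsRhoDer ρ gr δ X) {s : A} (hs : s ∈ gr 0) : frameLie ρ d x D δ X s ∈ gr δ := by
  refine sum_mem fun a _ => Submodule.smul_mem _ _ ?_
  have := (hx.der a).map_mem _ _ (SetLike.GradedMul.mul_mem (hX.map_mem _ _ (hx.mem a)) hs)
  rwa [add_zero, add_comm δ, neg_add_cancel_left] at this

/-- The `ρ`-commutator of `∂/∂x^b` and `X`, evaluated on `f`. -/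
theorem apply_der (hx : IsCoordFrame ρ gr d x D) (hX : IsRhoDer ρ gr δ X)
    (hXe : ExpandsIn x D X) (b : ι) (f : A) :
    D b (X f) = (ρ (d b) δ)⁻¹ • X (D b f) + ∑ c, D b (X (x c)) * D c f := by
  rw [hXe f, hXe (D b f), map_sum, Finset.smul_sum, ← Finset.sum_add_distrib]
  refine Finset.sum_congr rfl fun c _ => ?_
  rw [(hx.der b).leibniz _ _ _ (hX.map_mem _ _ (hx.mem c)), hx.comm b c, mul_smul_comm, smul_smul,
    ρ.map_neg_left, ρ.map_add_right, add_comm]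
  congr 2
  field_simp [ρ.ne_zero]

/-- The Jacobian matrices of a change of coordinates and of the inverse change are inverse to each
other. -/
theorem jacobian_mul (hx : IsCoordFrame ρ gr d x D) (hD : ∀ a, ExpandsIn y E (D a)) :
    (Matrix.of fun b a => D b (y a)) * (Matrix.of fun a b => E a (x b)) = 1 := by
  ext b c
  rw [Matrix.mul_apply, Matrix.one_apply, ← hx.apply_coord, hD b (x c)]
  rfl

variable [DecidableEq G] [GradedAlgebra gr]

/-- Under a change of coordinates the divergence with respect to the coordinate volume forms
changes by the supertrace of `X(J) J⁻¹`, where `J` is the Jacobian matrix. -/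
theorem frameLie_one_change (hc : IsRhoComm ρ gr) (hx : IsCoordFrame ρ gr d x D)
    (hy : IsCoordFrame ρ gr d y E) (hD : ∀ a, ExpandsIn y E (D a))
    (hE : ∀ a, ExpandsIn x D (E a)) (hX : IsRhoDer ρ gr δ X) (hXx : ExpandsIn x D X) :
    frameLie ρ d y E δ X 1 = frameLie ρ d x D δ X 1 +
      ∑ b, ρ (d b) (d b) • ∑ a, X (D b (y a)) * E a (x b) := by
  have hJ : ∀ a b, D b (y a) ∈ gr (-d b + d a) := fun a b => (hx.der b).map_mem _ _ (hy.mem a)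
  have hH : ∀ a b, E a (x b) ∈ gr (-d a + d b) := fun a b => (hy.der a).map_mem _ _ (hx.mem b)
  have hDX : ∀ b c, D b (X (x c)) ∈ gr (-d b + (δ + d c)) := fun b c =>
    (hx.der b).map_mem _ _ (hX.map_mem _ _ (hx.mem c))
  have t1 : ∀ a b, (ρ (d a) (d a + δ) * (ρ (d b) δ)⁻¹) • (E a (x b) * X (D b (y a))) =
      ρ (d b) (d b) • (X (D b (y a)) * E a (x b)) := fun a b => by
    rw [hc _ _ _ _ (hH a b) (hX.map_mem _ _ (hJ a b)), smul_smul]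
    congr 1
    have h1 := ρ.self_mul_self (d a)
    simp only [ρ.map_add_left, ρ.map_add_right, ρ.map_neg_left, ρ.map_neg_right, ρ.swap (d a) (d b),
      ρ.self_inv, inv_inv]
    field_simp [ρ.ne_zero]
    linear_combination h1
  have t2 : ∀ a b c, ρ (d a) (d a + δ) • (E a (x b) * (D b (X (x c)) * D c (y a))) =
      ρ (d c) (d c + δ) • (D c (y a) * E a (x b) * D b (X (x c))) := fun a b c => by
    rw [← mul_assoc, hc _ _ _ _ (SetLike.GradedMul.mul_mem (hH a b) (hDX b c)) (hJ a c), smul_smul,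
      mul_assoc]
    congr 1
    have h1 := ρ.self_mul_self (d a)
    simp only [ρ.map_add_left, ρ.map_add_right, ρ.map_neg_left, ρ.map_neg_right, ρ.swap (d a) (d b),
      ρ.swap (d a) (d c), ρ.swap δ, ρ.self_inv, inv_inv]
    field_simp [ρ.ne_zero]
    linear_combination h1
  have hJH := hx.jacobian_mul hD
  simp only [frameLie, mul_one]
  have e1 : ∀ a, ρ (d a) (d a + δ) • E a (X (y a)) =
      ∑ b, ρ (d b) (d b) • (X (D b (y a)) * E a (x b)) +
        ∑ b, ∑ c, ρ (d c) (d c + δ) • (D c (y a) * E a (x b) * D b (X (x c))) := fun a => by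
    rw [hE a, Finset.smul_sum, ← Finset.sum_add_distrib]
    refine Finset.sum_congr rfl fun b _ => ?_
    rw [hx.apply_der hX hXx b (y a), mul_add, mul_smul_comm, smul_add, smul_smul, t1,
      Finset.mul_sum, Finset.smul_sum]
    simp only [t2]
  rw [Finset.sum_congr rfl fun a _ => e1 a, Finset.sum_add_distrib, add_comm]
  congr 1
  · rw [Finset.sum_comm]
    rw [Finset.sum_congr rfl fun b _ => Finset.sum_comm]
    rw [Finset.sum_comm]
    refine Finset.sum_congr rfl fun c _ => ?_
    rw [Finset.sum_eq_single c]
    · rw [← Finset.smul_sum, ← Finset.sum_mul]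
      have := congrFun (congrFun hJH c) c
      simp only [Matrix.mul_apply, Matrix.of_apply, Matrix.one_apply_eq] at this
      rw [this, one_mul]
    · intro b _ hb
      rw [← Finset.smul_sum, ← Finset.sum_mul]
      have := congrFun (congrFun hJH c) b
      simp only [Matrix.mul_apply, Matrix.of_apply, Matrix.one_apply_ne hb.symm] at this
      rw [this, zero_mul, smul_zero]
    · simp
  · rw [Finset.sum_comm]
    simp only [Finset.smul_sum]

end IsCoordFrame

/-- The Lie derivative of Berezinian sections does not depend on the coordinates: if
`s = ρBer(∂y/∂x) t`, then the Lie derivatives of `D(x) s` and `D(y) t` agree. -/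
theorem IsCoordFrame.frameLie_rhoBer [CharZero K] [DecidableEq G] [GradedAlgebra gr] {n : ℕ}
    {d : Fin n → G} {x y : Fin n → A} {D E : Fin n → A →ₗ[K] A} (hc : IsRhoComm ρ gr)
    (hx : IsCoordFrame ρ gr d x D) (hy : IsCoordFrame ρ gr d y E) (hD : ∀ a, ExpandsIn y E (D a))
    (hE : ∀ a, ExpandsIn x D (E a)) (hX : IsRhoDer ρ gr δ X) (hXx : ExpandsIn x D X)
    (hXy : ExpandsIn y E X) {J : Matrix (Fin n) (Fin n) A} (hJ : ∀ b a, J b a = D b (y a))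
    (hB : IsUnit (rhoBer ρ (fun a => -d a) J)) (t : A) :
    frameLie ρ d x D δ X (rhoBer ρ (fun a => -d a) J * t) =
      rhoBer ρ (fun a => -d a) J * frameLie ρ d y E δ X t := by
  have hJ' : J = Matrix.of fun b a => D b (y a) := by
    ext b a
    exact hJ b a
  have hdeg : ∀ b a, J b a ∈ gr (-d b - -d a) := fun b a => by
    rw [sub_neg_eq_add, hJ]
    exact (hx.der b).map_mem _ _ (hy.mem a)
  obtain ⟨hBmem, hBX⟩ := IsRhoDer.map_rhoBer (i := fun a => -d a) hc hdeg
    (H := Matrix.of fun a b => E a (x b)) (by rw [hJ', hx.jacobian_mul hD])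
    (by rw [hJ', hy.jacobian_mul hE]) hB
  rw [hx.frameLie_eq hX hXx, hX.leibniz_zero hBmem, hBX hX, hy.frameLie_eq hX hXy t, mul_add,
    ← add_assoc, ← mul_assoc, ← add_mul, ← add_mul, ← mul_assoc,
    hc.commute_of_mem_zero hBmem (frameLie ρ d y E δ X 1),
    hx.frameLie_one_change hc hy hD hE hX hXx]
  congr 4
  refine Finset.sum_congr rfl fun b _ => ?_
  rw [ρ.self_neg, Matrix.mul_apply]
  simp only [Matrix.map_apply, hJ, Matrix.of_apply]

namespace IsCoordFrame

variable [CharZero K]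

/-- A homological vector field kills its divergence with respect to a coordinate volume form. By
`Q(Q^a) = 0`, applying `Q` yields a double sum over `(∂Q^c/∂x^a) (∂Q^a/∂x^c)`, whose terms change
sign when `a` and `c` are exchanged. -/
theorem map_frameLie_one (hc : IsRhoComm ρ gr) (hx : IsCoordFrame ρ gr d x D)
    (hX : IsRhoDer ρ gr δ X) (hXe : ExpandsIn x D X) (hodd : ρ δ δ = -1)
    (hXX : ∀ f, X (X f) = 0) : X (frameLie ρ d x D δ X 1) = 0 := by
  let T : ι → ι → A := fun a c =>
    (ρ (d a) (d a + δ) * ρ (d a) δ) • (D a (X (x c)) * D c (X (x a)))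
  have hDX : ∀ b c, D b (X (x c)) ∈ gr (-d b + (δ + d c)) := fun b c =>
    (hx.der b).map_mem _ _ (hX.map_mem _ _ (hx.mem c))
  have hT : ∀ a c, T a c = -T c a := fun a c => by
    simp only [T]
    rw [hc _ _ _ _ (hDX a c) (hDX c a), smul_smul, ← neg_smul]
    congr 1
    have h1 := ρ.self_mul_self (d a)
    simp only [ρ.map_add_left, ρ.map_add_right, ρ.map_neg_left, ρ.map_neg_right, ρ.swap (d a) (d c),
      ρ.swap (d a) δ, ρ.swap (d c) δ, ρ.self_inv, inv_inv, hodd]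
    field_simp [ρ.ne_zero]
    linear_combination -h1
  have hsum : X (frameLie ρ d x D δ X 1) = -∑ a, ∑ c, T a c := by
    simp only [frameLie, mul_one, map_sum, ← Finset.sum_neg_distrib]
    refine Finset.sum_congr rfl fun a _ => ?_
    have h := hx.apply_der hX hXe a (X (x a))
    rw [hXX, map_zero] at h
    have h' := eq_neg_of_add_eq_zero_left h.symm
    rw [map_smul, ← smul_inv_smul₀ (ρ.ne_zero (d a) δ) (X (D a (X (x a)))), h', smul_neg, smul_neg,
      smul_smul, Finset.smul_sum, Finset.sum_neg_distrib]
  have hanti : ∑ a, ∑ c, T a c = -∑ a, ∑ c, T a c := by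
    conv_lhs => rw [Finset.sum_comm]
    rw [← Finset.sum_neg_distrib]
    refine Finset.sum_congr rfl fun a _ => ?_
    rw [← Finset.sum_neg_distrib]
    exact Finset.sum_congr rfl fun c _ => hT c a
  have h2 : (2 : K) • ∑ a, ∑ c, T a c = 0 := by
    rw [two_smul]
    nth_rewrite 1 [hanti]
    exact neg_add_cancel _
  rw [hsum, (smul_eq_zero.1 h2).resolve_left two_ne_zero, neg_zero]

/-- A homological vector field kills its divergence `s⁻¹ L_Q(s)` with respect to the volume form
`D(x) s`, which is `div Q + s⁻¹ Q(s)`. -/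
theorem map_divergence [DecidableEq G] [GradedAlgebra gr] (hc : IsRhoComm ρ gr)
    (hx : IsCoordFrame ρ gr d x D) (hX : IsRhoDer ρ gr δ X) (hXe : ExpandsIn x D X)
    (hodd : ρ δ δ = -1) (hXX : ∀ f, X (X f) = 0) {s f : A} (hs : s ∈ gr 0) (hsu : IsUnit s)
    (hf : s * f = frameLie ρ d x D δ X s) : X f = 0 := by
  obtain ⟨u, rfl⟩ := hsu
  have hv : (↑u⁻¹ : A) ∈ gr 0 := inv_mem_zero hs u.mul_inv u.inv_mul
  have hf' : f = frameLie ρ d x D δ X 1 + ↑u⁻¹ * X u := by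
    calc f = ↑u⁻¹ * (↑u * f) := by rw [← mul_assoc, u.inv_mul, one_mul]
      _ = _ := by
        rw [hf, hx.frameLie_eq hX hXe, mul_add, ← mul_assoc, hc.commute_of_mem_zero hv, mul_assoc,
          u.inv_mul, mul_one]
  have hXv : X (↑u⁻¹ : A) = -(↑u⁻¹ * ↑u⁻¹ * X u) := by
    have h := hX.leibniz_zero hv (u : A)
    rw [u.inv_mul, hX.map_one] at h
    have h' := eq_neg_of_add_eq_zero_left h.symm
    calc X (↑u⁻¹ : A) = X (↑u⁻¹ : A) * u * ↑u⁻¹ := by rw [mul_assoc, u.mul_inv, mul_one]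
      _ = _ := by
        rw [h', neg_mul, mul_assoc, ← hc.commute_of_mem_zero hv (X u), mul_assoc]
  have hsq : X u * X u = 0 := by
    have hmem := hX.map_mem _ _ hs
    rw [add_zero] at hmem
    have h := hc _ _ _ _ hmem hmem
    rw [hodd, neg_one_smul] at h
    have h2 : (2 : K) • (X u * X u) = 0 := by
      rw [two_smul]
      nth_rewrite 1 [h]
      exact neg_add_cancel _
    exact (smul_eq_zero.1 h2).resolve_left two_ne_zero
  rw [hf', map_add, hx.map_frameLie_one hc hX hXe hodd hXX, hX.leibniz_zero hv, hXX, hXv, mul_zero,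
    neg_mul, mul_assoc, hsq, mul_zero, neg_zero, add_zero, add_zero]

end IsCoordFrame

end Frames

/-! ### Derivations of formal power series -/

namespace RhoSeries

open CommutationFactor Finset.HasAntidiagonal

variable {G K : Type*} [AddCommGroup G] [Field K] {ρ : CommutationFactor G K} {m : ℕ}
  {d : Fin m → G} {R : Type*} [CommRing R] [Algebra K R]

theorem admissible_single (b : Fin m) : ρ.Admissible d (Finsupp.single b 1) := fun c _ => by
  classical
  rw [Finsupp.single_apply]
  split_ifs <;> simp

theorem isHomogeneous_monomial (w : Fin m →₀ ℕ) (r : R) :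
    (monomial w r : RhoSeries ρ d R).IsHomogeneous (expDegree d w) := fun v hv => by
  classical
  rw [coeff_monomial] at hv
  split_ifs at hv with h
  · rw [h.1]
  · exact absurd rfl hv

theorem monomial_zero_one : (monomial 0 1 : RhoSeries ρ d R) = 1 := rfl

theorem coeff_monomial_zero_mul (r : R) (f : RhoSeries ρ d R) (w : Fin m →₀ ℕ) :
    (monomial 0 r * f).coeff w = r * f.coeff w := by
  classical
  rw [coeff_mul]
  split_ifs with h
  · rw [Finset.sum_eq_single (0, w)]
    · simp [coeff_monomial, reorder_zero_left, ρ.admissible_zero d]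
    · rintro ⟨a, b⟩ hp hne
      rw [mem_antidiagonal] at hp
      have : a ≠ 0 := by
        rintro rfl
        exact hne (by simpa using hp)
      simp [coeff_monomial, this]
    · simp
  · rw [f.coeff_eq_zero h, mul_zero]

theorem coeff_mul_monomial_zero (r : R) (f : RhoSeries ρ d R) (w : Fin m →₀ ℕ) :
    (f * monomial 0 r).coeff w = f.coeff w * r := by
  classical
  rw [coeff_mul]
  split_ifs with h
  · rw [Finset.sum_eq_single (w, 0)]
    · simp [coeff_monomial, reorder_zero_right, ρ.admissible_zero d]
    · rintro ⟨a, b⟩ hp hne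
      rw [mem_antidiagonal] at hp
      have : b ≠ 0 := by
        rintro rfl
        exact hne (by simpa using hp)
      simp [coeff_monomial, this]
    · simp
  · rw [f.coeff_eq_zero h, zero_mul]

theorem monomial_zero_mul (r s : R) :
    (monomial 0 (r * s) : RhoSeries ρ d R) = monomial 0 r * monomial 0 s := by
  classical
  ext w
  rw [coeff_monomial_zero_mul, coeff_monomial, coeff_monomial]
  split_ifs <;> simp

theorem monomial_add (w : Fin m →₀ ℕ) (r s : R) :
    (monomial w (r + s) : RhoSeries ρ d R) = monomial w r + monomial w s := by
  classical
  ext v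
  rw [coeff_add, coeff_monomial, coeff_monomial, coeff_monomial]
  split_ifs <;> simp

theorem monomial_zero (w : Fin m →₀ ℕ) : (monomial w 0 : RhoSeries ρ d R) = 0 := by
  classical
  ext v
  rw [coeff_monomial, ite_self, coeff_zero]

theorem monomial_smul (w : Fin m →₀ ℕ) (c : K) (r : R) :
    (monomial w (c • r) : RhoSeries ρ d R) = c • monomial w r := by
  classical
  ext v
  rw [coeff_smul, coeff_monomial, coeff_monomial]
  split_ifs <;> simp

theorem coeff_single_mul (b : Fin m) (t : RhoSeries ρ d R) (w : Fin m →₀ ℕ)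
    (hw : ρ.Admissible d w) (hb : w b ≠ 0) :
    (monomial (Finsupp.single b 1) 1 * t).coeff w =
      ρ.reorder d (Finsupp.single b 1) (w - Finsupp.single b 1) •
        t.coeff (w - Finsupp.single b 1) := by
  classical
  have hle : Finsupp.single b 1 ≤ w := Finsupp.single_le_iff.2 (Nat.one_le_iff_ne_zero.2 hb)
  rw [coeff_mul, if_pos hw, Finset.sum_eq_single (Finsupp.single b 1, w - Finsupp.single b 1)]
  · simp [coeff_monomial, admissible_single]
  · rintro ⟨p, q⟩ hp hne
    rw [mem_antidiagonal] at hp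
    have : p ≠ Finsupp.single b 1 := by
      rintro rfl
      refine hne (Prod.ext rfl ?_)
      simp only at hp ⊢
      rw [← hp, add_tsub_cancel_left]
    simp [coeff_monomial, this]
  · intro h
    exact absurd (mem_antidiagonal.2 (add_tsub_cancel_of_le hle)) h

theorem coeff_single_mul_of_eq_zero (b : Fin m) (t : RhoSeries ρ d R) (w : Fin m →₀ ℕ)
    (hb : w b = 0) : (monomial (Finsupp.single b 1) 1 * t).coeff w = 0 := by
  classical
  rw [coeff_mul]
  split_ifs
  · refine Finset.sum_eq_zero ?_
    rintro ⟨p, q⟩ hp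
    rw [mem_antidiagonal] at hp
    have : p ≠ Finsupp.single b 1 := by
      rintro rfl
      have := DFunLike.congr_fun hp b
      simp [hb] at this
    simp [coeff_monomial, this]
  · rfl

open Classical in
/-- The part of `f` that consists of the monomials with smallest indeterminate `ξ b`, divided by
`ξ b`. -/
noncomputable def tail (b : Fin m) (f : RhoSeries ρ d R) : RhoSeries ρ d R :=
  ⟨fun w => if ∀ c < b, w c = 0 then f.coeff (w + Finsupp.single b 1) else 0,
    fun w hw => by
      have : f.coeff (w + Finsupp.single b 1) = 0 :=
        f.coeff_eq_zero (fun h => hw (Admissible.of_add_left ρ h))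
      simp [this],
    (f.2.2.image (fun i => i - d b)).subset (by
      rintro i ⟨w, hw, rfl⟩
      refine ⟨expDegree d (w + Finsupp.single b 1), ⟨_, fun h => hw ?_, rfl⟩, ?_⟩
      · have : f.coeff (w + Finsupp.single b 1) = 0 := h
        simp [this]
      · simp [expDegree_add, expDegree_single])⟩

open Classical in
theorem coeff_tail (b : Fin m) (f : RhoSeries ρ d R) (w : Fin m →₀ ℕ) :
    (tail b f).coeff w = if ∀ c < b, w c = 0 then f.coeff (w + Finsupp.single b 1) else 0 := rfl

/-- Each non-constant monomial of `f` is divided by its smallest indeterminate. -/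
theorem eq_monomial_add_sum_tail (f : RhoSeries ρ d R) :
    f = monomial 0 (f.coeff 0) + ∑ b, monomial (Finsupp.single b 1) 1 * tail b f := by
  classical
  have hsum : ∀ (s : Finset (Fin m)) (g : Fin m → RhoSeries ρ d R) (w : Fin m →₀ ℕ),
      (∑ b ∈ s, g b).coeff w = ∑ b ∈ s, (g b).coeff w := fun s g w => by
    induction s using Finset.induction_on with
    | empty => simp
    | insert b s hb ih => rw [Finset.sum_insert hb, Finset.sum_insert hb, coeff_add, ih]
  ext w
  rw [coeff_add, hsum]
  by_cases hw : ρ.Admissible d w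
  swap
  · simp only [coeff_eq_zero _ hw, Finset.sum_const_zero, add_zero]
  by_cases h0 : w = 0
  · subst h0
    rw [Finset.sum_eq_zero fun b _ => coeff_single_mul_of_eq_zero b _ _ rfl]
    simp [coeff_monomial, ρ.admissible_zero d]
  · have hne : (Finset.univ.filter fun b => w b ≠ 0).Nonempty := by
      obtain ⟨b, hb⟩ := Finsupp.ne_iff.1 h0
      exact ⟨b, by simpa using hb⟩
    set b := Finset.min' _ hne with hbdef
    have hb : w b ≠ 0 := (Finset.mem_filter.1 (Finset.min'_mem _ hne)).2
    have hmin : ∀ c, w c ≠ 0 → b ≤ c := fun c hc => Finset.min'_le _ _ (by simpa using hc)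
    rw [Finset.sum_eq_single b]
    · have hlow : ∀ c < b, (w - Finsupp.single b 1 : Fin m →₀ ℕ) c = 0 := fun c hc => by
        have : w c = 0 := by
          by_contra h
          exact absurd (hmin c h) (not_le.2 hc)
        simp [this]
      have hre : ρ.reorder d (Finsupp.single b 1) (w - Finsupp.single b 1) = 1 := by
        refine Finset.prod_eq_one fun b' _ => Finset.prod_eq_one fun c _ => ?_
        split_ifs with h
        · by_cases hbb : b' = b
          · subst hbb
            rw [hlow c h, mul_zero, pow_zero]
          · rw [Finsupp.single_apply, if_neg (Ne.symm hbb), zero_mul, pow_zero]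
        · rfl
      rw [coeff_single_mul b _ w hw hb, hre, one_smul, coeff_tail, if_pos hlow,
        tsub_add_cancel_of_le (Finsupp.single_le_iff.2 (Nat.one_le_iff_ne_zero.2 hb)),
        coeff_monomial, if_neg (fun h => h0 h.1), zero_add]
    · intro c _ hcb
      by_cases hc : w c = 0
      · exact coeff_single_mul_of_eq_zero c _ _ hc
      · have hlt : b < c := lt_of_le_of_ne (hmin c hc) (Ne.symm hcb)
        rw [coeff_single_mul c _ w hw hc, coeff_tail, if_neg, smul_zero]
        intro h
        have := h b hlt
        rw [Finsupp.tsub_apply, Finsupp.single_apply, if_neg hcb] at this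
        exact hb (by simpa using this)
    · simp

/-- A linear operator `D` that commutes up to scalars with the multiplications by the indeterminates
vanishes as soon as it kills the coefficient ring: `D f` has order at least `N`, for every `N`. -/
theorem eq_zero_of_single_mul (D : RhoSeries ρ d R →+ RhoSeries ρ d R) (c : Fin m → K)
    (hD : ∀ b f, D (monomial (Finsupp.single b 1) 1 * f) =
      c b • (monomial (Finsupp.single b 1) 1 * D f))
    (h0 : ∀ r, D (monomial 0 r) = 0) (f : RhoSeries ρ d R) : D f = 0 := by
  have key : ∀ N : ℕ, ∀ f : RhoSeries ρ d R, ∀ w : Fin m →₀ ℕ, w.degree < N →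
      (D f).coeff w = 0 := by
    intro N
    induction N with
    | zero => intro f w hw; simp at hw
    | succ N ih =>
      intro f w hw
      by_cases hadm : ρ.Admissible d w
      swap
      · exact coeff_eq_zero _ hadm
      have hterm : ∀ b, (D (monomial (Finsupp.single b 1) 1 * tail b f)).coeff w = 0 := fun b => by
        rw [hD, coeff_smul]
        by_cases hb : w b = 0
        · rw [coeff_single_mul_of_eq_zero b _ _ hb, smul_zero]
        · have hle : Finsupp.single b 1 ≤ w :=
            Finsupp.single_le_iff.2 (Nat.one_le_iff_ne_zero.2 hb)
          have hdeg : (w - Finsupp.single b 1).degree < N := by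
            have := congrArg Finsupp.degree (tsub_add_cancel_of_le hle)
            rw [map_add, Finsupp.degree_single] at this
            omega
          rw [coeff_single_mul b _ w hadm hb, ih _ _ hdeg, smul_zero, smul_zero]
      rw [eq_monomial_add_sum_tail f, map_add, h0, zero_add, map_sum]
      have hsum : ∀ s : Finset (Fin m),
          (∑ b ∈ s, D (monomial (Finsupp.single b 1) 1 * tail b f)).coeff w = 0 := fun s => by
        classical
        induction s using Finset.induction_on with
        | empty => simp
        | insert b s hb ihs => rw [Finset.sum_insert hb, coeff_add, ihs, hterm, add_zero]
      exact hsum _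
  ext w
  exact key (w.degree + 1) f w (Nat.lt_succ_self _)

theorem coeff_mapCoeff (D : R → R) (hD : D 0 = 0) (f : RhoSeries ρ d R) (w : Fin m →₀ ℕ) :
    (mapCoeff D hD f).coeff w = D (f.coeff w) := rfl

theorem mapCoeff_mul (D : R →ₗ[K] R) (hD : ∀ r s, D (r * s) = D r * s + r * D s)
    (f g : RhoSeries ρ d R) :
    mapCoeff D D.map_zero (f * g) = mapCoeff D D.map_zero f * g + f * mapCoeff D D.map_zero g := by
  classical
  ext w
  simp only [coeff_mapCoeff, coeff_add, coeff_mul]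
  split_ifs
  · simp only [map_sum, map_smul, hD, smul_add, Finset.sum_add_distrib]
  · simp

theorem mapCoeff_monomial (D : R → R) (hD : D 0 = 0) (w : Fin m →₀ ℕ) (r : R) :
    mapCoeff D hD (monomial w r : RhoSeries ρ d R) = monomial w (D r) := by
  classical
  ext v
  rw [coeff_mapCoeff, coeff_monomial, coeff_monomial]
  split_ifs
  · rfl
  · exact hD

variable (ρ d) in
/-- The scalar that arises when `∂/∂(ξ b)` passes the factors `ξ c`, `c < b`, of `ξ ^ w`. -/
def passing (b : Fin m) (w : Fin m →₀ ℕ) : K :=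
  ∏ c, if c < b then ρ (-d b) (d c) ^ (w c) else 1

theorem coeff_formalPartial (b : Fin m) (f : RhoSeries ρ d R) (w : Fin m →₀ ℕ) :
    (formalPartial b f).coeff w =
      (((w b : K) + 1) * passing ρ d b w) • f.coeff (w + Finsupp.single b 1) := rfl

theorem passing_add (b : Fin m) (w v : Fin m →₀ ℕ) :
    passing ρ d b (w + v) = passing ρ d b w * passing ρ d b v := by
  simp only [passing, ← Finset.prod_mul_distrib]
  refine Finset.prod_congr rfl fun c _ => ?_
  split_ifs
  · rw [Finsupp.add_apply, pow_add]
  · rw [mul_one]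

/-- Both factors count how `ξ b`, respectively `∂/∂(ξ b)`, passes the `ξ c`, `c < b`, of `ξ ^ w`;
their degrees are opposite. -/
theorem reorder_single_mul_passing (b : Fin m) (w : Fin m →₀ ℕ) :
    ρ.reorder d (Finsupp.single b 1) w * passing ρ d b w = 1 := by
  classical
  rw [reorder, Finset.prod_eq_single b, passing, ← Finset.prod_mul_distrib]
  · refine Finset.prod_eq_one fun c _ => ?_
    split_ifs
    · rw [Finsupp.single_eq_same, one_mul, ← mul_pow, ρ.map_neg_left,
        mul_inv_cancel₀ (ρ.ne_zero _ _), one_pow]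
    · rw [mul_one]
  · intro b' _ hb'
    refine Finset.prod_eq_one fun c _ => ?_
    rw [Finsupp.single_apply, if_neg (Ne.symm hb'), zero_mul, pow_zero, ite_self]
  · simp

/-- The scalar for passing all of `ξ ^ w`, split according to the factors `ξ b`, `ξ c` with `c < b`
and `ξ c` with `b < c`. -/
theorem map_neg_expDegree (b : Fin m) (w : Fin m →₀ ℕ) :
    ρ (-d b) (expDegree d w) =
      ρ (-d b) (d b) ^ w b * passing ρ d b w * ρ.reorder d w (Finsupp.single b 1) := by
  classical
  have h1 : ρ (-d b) (expDegree d w) = ∏ c, ρ (-d b) (d c) ^ w c := by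
    rw [expDegree]
    have hpow : ∀ (k : ℕ) (i j : G), ρ i (k • j) = ρ i j ^ k := fun k i j => by
      induction k with
      | zero => simp
      | succ k ih => rw [succ_nsmul, ρ.map_add_right, ih, pow_succ]
    induction (Finset.univ : Finset (Fin m)) using Finset.induction_on with
    | empty => simp
    | insert c s hc ih =>
      rw [Finset.sum_insert hc, Finset.prod_insert hc, ρ.map_add_right, ih, hpow]
  have h2 : ρ.reorder d w (Finsupp.single b 1) =
      ∏ c, if b < c then ρ (-d b) (d c) ^ w c else 1 := by
    refine Finset.prod_congr rfl fun c _ => ?_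
    rw [Finset.prod_eq_single b]
    · rw [Finsupp.single_eq_same, mul_one, ρ.map_neg_left, ← ρ.swap]
    · intro c' _ hc'
      rw [Finsupp.single_apply, if_neg (Ne.symm hc'), mul_zero, pow_zero, ite_self]
    · simp
  have h3 : ρ (-d b) (d b) ^ w b = ∏ c, if c = b then ρ (-d b) (d c) ^ w c else 1 := by
    rw [Finset.prod_ite_eq' Finset.univ b, if_pos (Finset.mem_univ b)]
  rw [h1, h2, h3, passing, ← Finset.prod_mul_distrib, ← Finset.prod_mul_distrib]
  refine Finset.prod_congr rfl fun c _ => ?_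
  rcases lt_trichotomy c b with h | h | h
  · simp [h, h.ne, h.not_gt]
  · simp [h]
  · simp [h, h.ne', h.not_gt]

theorem sum_antidiagonal_add_single_left {V : Type*} [AddCommGroup V] [Module K V] (b : Fin m)
    (w : Fin m →₀ ℕ) (Ψ : (Fin m →₀ ℕ) × (Fin m →₀ ℕ) → V) :
    ∑ p ∈ antidiagonal (w + Finsupp.single b 1 : Fin m →₀ ℕ), (p.1 b : K) • Ψ p =
      ∑ q ∈ antidiagonal w, ((q.1 b : K) + 1) • Ψ (q.1 + Finsupp.single b 1, q.2) := by
  classical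
  symm
  refine Finset.sum_of_injOn (fun q => (q.1 + Finsupp.single b 1, q.2)) ?_ ?_ ?_ ?_
  · rintro ⟨q, q'⟩ - ⟨r, r'⟩ - h
    simpa using h
  · rintro ⟨q, q'⟩ hq
    simp only [Finset.mem_coe, mem_antidiagonal] at hq ⊢
    rw [← hq, add_right_comm]
  · rintro ⟨q, q'⟩ hq hnot
    simp only [mem_antidiagonal] at hq
    have : q b = 0 := by
      by_contra h
      have hle : Finsupp.single b 1 ≤ q := Finsupp.single_le_iff.2 (Nat.one_le_iff_ne_zero.2 h)
      refine hnot ⟨(q - Finsupp.single b 1, q'), ?_, ?_⟩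
      · simp only [Finset.mem_coe, mem_antidiagonal]
        refine add_right_cancel (b := Finsupp.single b 1) ?_
        rw [add_right_comm, tsub_add_cancel_of_le hle, hq]
      · simp only [tsub_add_cancel_of_le hle]
    simp [this]
  · rintro ⟨q, q'⟩ -
    simp

theorem sum_antidiagonal_add_single_right {V : Type*} [AddCommGroup V] [Module K V] (b : Fin m)
    (w : Fin m →₀ ℕ) (Ψ : (Fin m →₀ ℕ) × (Fin m →₀ ℕ) → V) :
    ∑ p ∈ antidiagonal (w + Finsupp.single b 1 : Fin m →₀ ℕ), (p.2 b : K) • Ψ p =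
      ∑ q ∈ antidiagonal w, ((q.2 b : K) + 1) • Ψ (q.1, q.2 + Finsupp.single b 1) := by
  have h := sum_antidiagonal_add_single_left (K := K) b w (fun p => Ψ p.swap)
  rw [← Finset.sum_equiv (Equiv.prodComm _ _)
    (s := antidiagonal (w + Finsupp.single b 1 : Fin m →₀ ℕ)) (f := fun p => (p.2 b : K) • Ψ p)
    (by simp [mem_antidiagonal, add_comm]) (by simp)] at h
  rw [h]
  exact Finset.sum_equiv (Equiv.prodComm _ _) (by simp [mem_antidiagonal, add_comm]) (by simp)

/-- The partial derivative `∂/∂(ξ b)` is a `ρ`-derivation of degree `-|ξ b|`. -/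
theorem formalPartial_mul (b : Fin m) {i : G} {f : RhoSeries ρ d R} (hf : f.IsHomogeneous i)
    (g : RhoSeries ρ d R) :
    formalPartial b (f * g) = formalPartial b f * g + ρ (-d b) i • (f * formalPartial b g) := by
  classical
  ext w
  by_cases hw : ρ.Admissible d w
  swap
  · rw [coeff_eq_zero _ hw, coeff_eq_zero _ hw]
  let Ψ : (Fin m →₀ ℕ) × (Fin m →₀ ℕ) → R := fun p =>
    (passing ρ d b w * ρ.reorder d p.1 p.2) • (f.coeff p.1 * g.coeff p.2)
  have hleft : (formalPartial b f * g).coeff w =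
      ∑ p ∈ antidiagonal (w + Finsupp.single b 1 : Fin m →₀ ℕ), (p.1 b : K) • Ψ p := by
    rw [sum_antidiagonal_add_single_left, coeff_mul, if_pos hw]
    refine Finset.sum_congr rfl fun q hq => ?_
    rw [mem_antidiagonal] at hq
    simp only [Ψ, coeff_formalPartial, smul_mul_assoc, smul_smul]
    congr 1
    rw [← hq, passing_add, reorder_add_left]
    linear_combination (-(((q.1 b : K) + 1) * passing ρ d b q.1 * ρ.reorder d q.1 q.2)) *
      reorder_single_mul_passing (ρ := ρ) (d := d) b q.2
  have hright : (ρ (-d b) i • (f * formalPartial b g)).coeff w =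
      ∑ p ∈ antidiagonal (w + Finsupp.single b 1 : Fin m →₀ ℕ),
        (p.2 b : K) • (ρ (-d b) (d b) ^ p.1 b • Ψ p) := by
    rw [sum_antidiagonal_add_single_right b w fun p => ρ (-d b) (d b) ^ p.1 b • Ψ p, coeff_smul,
      coeff_mul, if_pos hw, Finset.smul_sum]
    refine Finset.sum_congr rfl fun q hq => ?_
    rw [mem_antidiagonal] at hq
    by_cases hq0 : f.coeff q.1 = 0
    · simp [Ψ, hq0]
    simp only [Ψ, coeff_formalPartial, mul_smul_comm, smul_smul]
    congr 1
    rw [← hf _ hq0, map_neg_expDegree, ← hq, passing_add, reorder_add_right]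
    ring
  rw [coeff_add, hleft, hright, ← Finset.sum_add_distrib, coeff_formalPartial, coeff_mul]
  have hpb : ∀ p ∈ antidiagonal (w + Finsupp.single b 1 : Fin m →₀ ℕ),
      p.1 b + p.2 b = w b + 1 := fun p hp => by
    rw [mem_antidiagonal] at hp
    simpa using DFunLike.congr_fun hp b
  have hneg : ρ (d b) (d b) ≠ 1 → ρ (-d b) (d b) = -1 := fun h => by
    rw [ρ.map_neg_left, (ρ.self_eq_one_or (d b)).resolve_left h, inv_neg, inv_one]
  split_ifs with hw'
  · rw [Finset.smul_sum]
    refine Finset.sum_congr rfl fun p hp => ?_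
    have hp' := hpb p hp
    have hpK : (p.1 b : K) + p.2 b = w b + 1 := by exact_mod_cast congrArg (Nat.cast (R := K)) hp'
    have hsc : (p.2 b : K) * ρ (-d b) (d b) ^ p.1 b = p.2 b := by
      by_cases hb : ρ (d b) (d b) = 1
      · rw [ρ.map_neg_left, hb, inv_one, one_pow, mul_one]
      · have := hw' b hb
        simp only [Finsupp.add_apply, Finsupp.single_eq_same] at this
        rcases Nat.eq_zero_or_pos (p.2 b) with h | h
        · simp [h]
        · have : p.1 b = 0 := by omega
          rw [this, pow_zero, mul_one]
    rw [smul_smul (p.2 b : K), hsc, ← add_smul, hpK]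
    simp only [Ψ, smul_smul, mul_assoc]
  · rw [smul_zero]
    symm
    refine Finset.sum_eq_zero fun p hp => ?_
    have hp' := hpb p hp
    obtain ⟨hb, hwb⟩ : ρ (d b) (d b) ≠ 1 ∧ w b = 1 := by
      simp only [Admissible, not_forall, not_le] at hw'
      obtain ⟨c, hc, hlt⟩ := hw'
      have hwc := hw c hc
      rw [Finsupp.add_apply, Finsupp.single_apply] at hlt
      split_ifs at hlt with hbc
      · subst hbc
        exact ⟨hc, by omega⟩
      · omega
    by_cases h1 : p.1 b ≤ 1
    · by_cases h2 : p.2 b ≤ 1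
      · have e1 : p.1 b = 1 := by omega
        have e2 : p.2 b = 1 := by omega
        rw [e1, e2, hneg hb]
        simp
      · have : g.coeff p.2 = 0 := g.coeff_eq_zero fun h => h2 (h b hb)
        simp [Ψ, this]
    · have : f.coeff p.1 = 0 := f.coeff_eq_zero fun h => h1 (h b hb)
      simp [Ψ, this]

theorem formalPartial_isHomogeneous (b : Fin m) {i : G} {f : RhoSeries ρ d R}
    (hf : f.IsHomogeneous i) : (formalPartial b f).IsHomogeneous (-d b + i) := fun w hw => by
  rw [coeff_formalPartial] at hw
  have := hf (w + Finsupp.single b 1) fun h => hw (by rw [h, smul_zero])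
  rw [expDegree_add, expDegree_single] at this
  rw [← this]
  abel

theorem formalPartial_monomial_zero (b : Fin m) (r : R) :
    formalPartial b (monomial 0 r : RhoSeries ρ d R) = 0 := by
  classical
  ext w
  have : w + Finsupp.single b 1 ≠ 0 := fun h => by
    have := DFunLike.congr_fun h b
    simp at this
  simp [coeff_formalPartial, coeff_monomial, this]

theorem formalPartial_single (b c : Fin m) :
    formalPartial b (monomial (Finsupp.single c 1) 1 : RhoSeries ρ d R) =
      if b = c then 1 else 0 := by
  classical
  ext w
  rw [coeff_formalPartial, coeff_monomial]
  by_cases hbc : b = c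
  · subst hbc
    rw [if_pos rfl, coeff_one]
    by_cases hw : w = 0
    · subst hw
      simp [admissible_single, passing]
    · rw [if_neg hw, if_neg, smul_zero]
      rintro ⟨h, -⟩
      exact hw (by simpa using h)
  · rw [if_neg hbc, if_neg, smul_zero, coeff_zero]
    rintro ⟨h, -⟩
    have := DFunLike.congr_fun h b
    simp [Ne.symm hbc] at this

end RhoSeries

/-! ### Hadamard's lemma -/

section Hadamard

open MeasureTheory Metric

variable {𝕜 : Type*} [RCLike 𝕜] {E : Type*} [NormedAddCommGroup E] [NormedSpace 𝕜 E]

theorem add_smul_sub_mem_ball {z₀ z : E} {r : ℝ} (hz : z ∈ ball z₀ r) {t : ℝ}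
    (ht : t ∈ Set.Icc (0 : ℝ) 1) : z₀ + (t : 𝕜) • (z - z₀) ∈ ball z₀ r := by
  rw [mem_ball, dist_eq_norm] at hz ⊢
  rw [add_sub_cancel_left, norm_smul, RCLike.norm_ofReal, abs_of_nonneg ht.1]
  exact (mul_le_of_le_one_left (norm_nonneg _) ht.2).trans_lt hz

theorem add_smul_sub_mem_closedBall {z₀ z : E} {r : ℝ} (hz : z ∈ closedBall z₀ r) {t : ℝ}
    (ht : t ∈ Set.Icc (0 : ℝ) 1) : z₀ + (t : 𝕜) • (z - z₀) ∈ closedBall z₀ r := by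
  rw [mem_closedBall, dist_eq_norm] at hz ⊢
  rw [add_sub_cancel_left, norm_smul, RCLike.norm_ofReal, abs_of_nonneg ht.1]
  exact (mul_le_of_le_one_left (norm_nonneg _) ht.2).trans hz

theorem continuousOn_pow_smul_comp_segment {V : Type*} [NormedAddCommGroup V] [NormedSpace 𝕜 V]
    {z₀ z : E} {r : ℝ} {q : E → V} (hq : ContinuousOn q (ball z₀ r)) (hz : z ∈ ball z₀ r) (i : ℕ) :
    ContinuousOn (fun t : ℝ => (t : 𝕜) ^ i • q (z₀ + (t : 𝕜) • (z - z₀))) (Set.Icc 0 1) := by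
  have hline : Continuous fun t : ℝ => z₀ + (t : 𝕜) • (z - z₀) :=
    continuous_const.add (RCLike.continuous_ofReal.smul continuous_const)
  exact (RCLike.continuous_ofReal.pow i).continuousOn.smul
    (hq.comp hline.continuousOn fun t ht => add_smul_sub_mem_ball hz ht)

variable [FiniteDimensional 𝕜 E]

/-- Differentiation under the integral sign for the moments `∫ t ^ j h(z₀ + t (z - z₀)) dt`. -/
theorem hasFDerivAt_moment {F : Type*} [NormedAddCommGroup F] [NormedSpace 𝕜 F] [NormedSpace ℝ F]
    {z₀ : E} {r : ℝ} {h : E → F} (hh : ContDiffOn 𝕜 ∞ h (ball z₀ r)) (j : ℕ) {z₁ : E}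
    (hz₁ : z₁ ∈ ball z₀ r) :
    HasFDerivAt (fun z => ∫ t in (0 : ℝ)..1, (t : 𝕜) ^ j • h (z₀ + (t : 𝕜) • (z - z₀)))
      (∫ t in (0 : ℝ)..1, (t : 𝕜) ^ (j + 1) • fderiv 𝕜 h (z₀ + (t : 𝕜) • (z₁ - z₀))) z₁ := by
  have : ProperSpace E := FiniteDimensional.proper 𝕜 E
  have hd := (contDiffOn_infty_iff_fderiv_of_isOpen isOpen_ball).1 hh
  have hIoc : Set.uIoc (0 : ℝ) 1 ⊆ Set.Icc 0 1 := by
    rw [Set.uIoc_of_le zero_le_one]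
    exact Set.Ioc_subset_Icc_self
  obtain ⟨r', h1, h2⟩ := exists_between (mem_ball.1 hz₁)
  have hsub : closedBall z₀ r' ⊆ ball z₀ r := closedBall_subset_ball h2
  obtain ⟨C, hC⟩ := (isCompact_closedBall z₀ r').exists_bound_of_continuousOn
    (hd.2.continuousOn.mono hsub)
  refine intervalIntegral.hasFDerivAt_integral_of_dominated_of_fderiv_le
    (F := fun z (t : ℝ) => (t : 𝕜) ^ j • h (z₀ + (t : 𝕜) • (z - z₀)))
    (F' := fun z (t : ℝ) => (t : 𝕜) ^ (j + 1) • fderiv 𝕜 h (z₀ + (t : 𝕜) • (z - z₀)))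
    (s := ball z₀ r') (bound := fun _ => C) (isOpen_ball.mem_nhds (mem_ball.2 h1)) ?_ ?_ ?_ ?_ ?_ ?_
  · filter_upwards [isOpen_ball.mem_nhds hz₁] with z hz
    exact ((continuousOn_pow_smul_comp_segment hh.continuousOn hz j).mono
      hIoc).aestronglyMeasurable measurableSet_uIoc
  · refine ContinuousOn.intervalIntegrable ?_
    rw [Set.uIcc_of_le zero_le_one]
    exact continuousOn_pow_smul_comp_segment hh.continuousOn hz₁ j
  · exact ((continuousOn_pow_smul_comp_segment hd.2.continuousOn hz₁ _).mono
      hIoc).aestronglyMeasurable measurableSet_uIoc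
  · refine Filter.Eventually.of_forall fun t ht z hz => ?_
    have ht' := hIoc ht
    rw [norm_smul, norm_pow, RCLike.norm_ofReal, abs_of_nonneg ht'.1]
    refine (mul_le_of_le_one_left (norm_nonneg _) (pow_le_one₀ ht'.1 ht'.2)).trans ?_
    exact hC _ (add_smul_sub_mem_closedBall (ball_subset_closedBall hz) ht')
  · exact intervalIntegrable_const
  · refine Filter.Eventually.of_forall fun t ht z hz => ?_
    have hzr := add_smul_sub_mem_ball (𝕜 := 𝕜) (hsub (ball_subset_closedBall hz)) (hIoc ht)
    have e1 : HasFDerivAt (fun z : E => z₀ + (t : 𝕜) • (z - z₀))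
        ((t : 𝕜) • ContinuousLinearMap.id 𝕜 E) z :=
      (((hasFDerivAt_id z).sub_const z₀).const_smul (t : 𝕜)).const_add z₀
    have e2 := ((hd.1 _ hzr).differentiableAt (isOpen_ball.mem_nhds hzr)).hasFDerivAt
    have e3 := (e2.comp z e1).const_smul ((t : 𝕜) ^ j)
    rw [ContinuousLinearMap.comp_smul, ContinuousLinearMap.comp_id, smul_smul, ← pow_succ] at e3
    exact e3

end Hadamard

section HadamardSmooth

open MeasureTheory Metric

universe w w'

variable {𝕜 : Type*} [RCLike 𝕜] {E : Type w} [NormedAddCommGroup E] [NormedSpace 𝕜 E]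
  [FiniteDimensional 𝕜 E]

/-- The derivative of a moment of `h` is a moment of the derivative of `h`, so all moments are
smooth. The target lives in the universe `max w w'` because the induction replaces `F` by
`E →L[𝕜] F`. -/
theorem contDiffOn_moment (N : ℕ) {F : Type (max w w')} [NormedAddCommGroup F] [NormedSpace 𝕜 F]
    [NormedSpace ℝ F] {z₀ : E} {r : ℝ} {h : E → F} (hh : ContDiffOn 𝕜 ∞ h (ball z₀ r)) (j : ℕ) :
    ContDiffOn 𝕜 N (fun z => ∫ t in (0 : ℝ)..1, (t : 𝕜) ^ j • h (z₀ + (t : 𝕜) • (z - z₀)))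
      (ball z₀ r) := by
  induction N generalizing F j with
  | zero =>
    exact contDiffOn_zero.2 fun z hz =>
      (hasFDerivAt_moment hh j hz).continuousAt.continuousWithinAt
  | succ N ih =>
    have hd := (contDiffOn_infty_iff_fderiv_of_isOpen isOpen_ball).1 hh
    rw [Nat.cast_succ, contDiffOn_succ_iff_fderiv_of_isOpen isOpen_ball]
    refine ⟨fun z hz => (hasFDerivAt_moment hh j hz).differentiableAt.differentiableWithinAt,
      fun h => absurd h (by simp), ?_⟩
    exact (ih hd.2 (j + 1)).congr fun z hz => (hasFDerivAt_moment hh j hz).fderiv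

theorem hadamard_smooth {F : Type w'} [NormedAddCommGroup F] [NormedSpace 𝕜 F] [CompleteSpace F]
    {z₀ : E} {r : ℝ} {f : E → F} (hf : ContDiffOn 𝕜 ∞ f (ball z₀ r)) :
    ∃ g : E → E →L[𝕜] F, ContDiffOn 𝕜 ∞ g (ball z₀ r) ∧
      ∀ z ∈ ball z₀ r, f z = f z₀ + g z (z - z₀) := by
  let _ : NormedSpace ℝ F := NormedSpace.restrictScalars ℝ 𝕜 F
  let _ : NormedSpace ℝ E := NormedSpace.restrictScalars ℝ 𝕜 E
  have : IsScalarTower ℝ 𝕜 F := RestrictScalars.isScalarTower ℝ 𝕜 F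
  have : IsScalarTower ℝ 𝕜 E := RestrictScalars.isScalarTower ℝ 𝕜 E
  have hd := (contDiffOn_infty_iff_fderiv_of_isOpen isOpen_ball).1 hf
  refine ⟨fun z => ∫ t in (0 : ℝ)..1, (t : 𝕜) ^ 0 • fderiv 𝕜 f (z₀ + (t : 𝕜) • (z - z₀)),
    contDiffOn_infty.2 fun N => contDiffOn_moment.{w, max w w'} N hd.2 0, fun z hz => ?_⟩
  have hline : Continuous fun t : ℝ => z₀ + (t : 𝕜) • (z - z₀) :=
    continuous_const.add (RCLike.continuous_ofReal.smul continuous_const)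
  have hcont : ContinuousOn (fun t : ℝ => fderiv 𝕜 f (z₀ + (t : 𝕜) • (z - z₀)))
      (Set.uIcc 0 1) := by
    rw [Set.uIcc_of_le zero_le_one]
    exact hd.2.continuousOn.comp hline.continuousOn fun t ht => add_smul_sub_mem_ball hz ht
  simp only [pow_zero, one_smul]
  rw [ContinuousLinearMap.intervalIntegral_apply hcont.intervalIntegrable]
  have hderiv : ∀ t ∈ Set.uIcc (0 : ℝ) 1, HasDerivAt
      (fun t : ℝ => f (z₀ + (t : 𝕜) • (z - z₀)))
      (fderiv 𝕜 f (z₀ + (t : 𝕜) • (z - z₀)) (z - z₀)) t := by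
    intro t ht
    rw [Set.uIcc_of_le zero_le_one] at ht
    have hzr := add_smul_sub_mem_ball (𝕜 := 𝕜) hz ht
    have e2 := ((hd.1 _ hzr).differentiableAt (isOpen_ball.mem_nhds hzr)).hasFDerivAt
    have e1 : HasDerivAt (fun t : ℝ => z₀ + (t : 𝕜) • (z - z₀)) (z - z₀) t := by
      have : HasDerivAt (fun t : ℝ => z₀ + t • (z - z₀)) ((1 : ℝ) • (z - z₀)) t :=
        ((hasDerivAt_id t).smul_const (z - z₀)).const_add z₀
      rw [one_smul] at this
      refine this.congr_of_eventuallyEq (Filter.Eventually.of_forall fun s => ?_)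
      simp only [RCLike.real_smul_eq_coe_smul (K := 𝕜)]
    exact (e2.restrictScalars ℝ).comp_hasDerivAt t e1
  rw [intervalIntegral.integral_eq_sub_of_hasDerivAt hderiv
    (ContinuousOn.intervalIntegrable (hcont.clm_apply continuousOn_const))]
  simp

/-- **Hadamard's lemma**, for smooth and for analytic functions: near `z₀`, a function `f` of class
`C^k` is `f z₀ + g(z) (z - z₀)` with `g` of class `C^k`. In the smooth case `g` is the average of
the derivative over the segment from `z₀` to `z`, in the analytic case it is obtained by shifting
the power series. -/
theorem hadamard {F : Type w'} [NormedAddCommGroup F] [NormedSpace 𝕜 F] [CompleteSpace F]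
    {k : ℕ∞ω} (hk : ∞ ≤ k) {U : Set E} (hU : IsOpen U) {z₀ : E} (hz₀ : z₀ ∈ U) {f : E → F}
    (hf : ContDiffOn 𝕜 k f U) :
    ∃ r > 0, ball z₀ r ⊆ U ∧ ∃ g : E → E →L[𝕜] F, ContDiffOn 𝕜 k g (ball z₀ r) ∧
      ∀ z ∈ ball z₀ r, f z = f z₀ + g z (z - z₀) := by
  obtain ⟨r, hr, hrU⟩ := Metric.isOpen_iff.1 hU z₀ hz₀
  rcases eq_or_ne k ω with rfl | hkω
  · obtain ⟨p, R, hp⟩ := ((hf.contDiffAt (hU.mem_nhds hz₀)).analyticAt)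
    have hshift : HasFPowerSeriesOnBall (fun z => p.shift.sum (z - z₀)) p.shift z₀ R := by
      have h1 : HasFPowerSeriesOnBall p.shift.sum p.shift 0 p.shift.radius :=
        p.shift.hasFPowerSeriesOnBall (by
          rw [FormalMultilinearSeries.radius_shift]
          exact hp.r_pos.trans_le hp.r_le)
      have h2 := h1.comp_sub z₀
      rw [zero_add] at h2
      refine h2.mono hp.r_pos ?_
      rw [FormalMultilinearSeries.radius_shift]
      exact hp.r_le
    have hunshift := hshift.unshift (z := f z₀)
    -- Prepending the value `f z₀` to the shifted power series gives back the series of `f`.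
    have hpp : p.shift.unshift (f z₀) = p := by
      funext n
      cases n with
      | zero =>
        ext v
        simp [FormalMultilinearSeries.unshift, hp.coeff_zero v]
      | succ n =>
        exact LinearIsometryEquiv.symm_apply_apply (continuousMultilinearCurryRightEquiv' 𝕜 n E F) _
    rw [hpp] at hunshift
    obtain ⟨r', hr', hr'R⟩ : ∃ r' > 0, ball z₀ r' ⊆ Metric.eball z₀ R :=
      Metric.isOpen_iff.1 Metric.isOpen_eball z₀ (Metric.mem_eball_self hp.r_pos)
    refine ⟨min r r', lt_min hr hr', (ball_subset_ball (min_le_left _ _)).trans hrU,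
      fun z => p.shift.sum (z - z₀), ?_, fun z hz => ?_⟩
    · exact (hshift.analyticOnNhd.mono
        ((ball_subset_ball (min_le_right _ _)).trans hr'R)).contDiffOn_of_completeSpace
    · exact hp.unique hunshift (hr'R (ball_subset_ball (min_le_right _ _) hz))
  · have hk' : k = ∞ := by
      rcases k with _ | k
      · exact absurd rfl hkω
      · have h : (⊤ : ℕ∞) ≤ k := WithTop.coe_le_coe.1 hk
        rw [top_le_iff.1 h]
        rfl
    subst hk'
    exact ⟨r, hr, hrU, hadamard_smooth (hf.mono hrU)⟩

end HadamardSmooth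

/-! ### Derivations of the functions on the underlying manifold -/

section BaseDerivations

theorem localExpr_apply {M E K : Type*} [TopologicalSpace M] [TopologicalSpace E] [RCLike K]
    {φ : OpenPartialHomeomorph M E} {V : Opens M} (hV : (V : Set M) ⊆ φ.source) (f : V → K)
    (p : V) : (extendByZero f ∘ φ.symm) (φ p.1) = f p := by
  simp [extendByZero, φ.left_inv (hV p.2)]

theorem apply_mem_localDomain {M E : Type*} [TopologicalSpace M] [TopologicalSpace E]
    {φ : OpenPartialHomeomorph M E} {V : Opens M} (hV : (V : Set M) ⊆ φ.source) (p : V) :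
    φ p.1 ∈ φ.target ∩ φ.symm ⁻¹' (V : Set M) :=
  ⟨φ.map_source (hV p.2), by
    rw [Set.mem_preimage, φ.left_inv (hV p.2)]
    exact p.2⟩

variable {𝕜 K : Type*} [RCLike 𝕜] [RCLike K] [NormedAlgebra 𝕜 K] {k : ℕ∞ω} {n : ℕ}
  {M : Type u} [TopologicalSpace M] [ChartedSpace (EuclideanSpace 𝕜 (Fin n)) M]
  {φ : OpenPartialHomeomorph M (EuclideanSpace 𝕜 (Fin n))} {V : Opens M}

/-- The local expression of a function in a chart is of class `C^k`. -/
theorem contDiffOn_localExpr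
    (hφ : φ ∈ IsManifold.maximalAtlas 𝓘(𝕜, EuclideanSpace 𝕜 (Fin n)) k M)
    (f : baseFunctions 𝕜 K k (n := n) V) :
    ContDiffOn 𝕜 k (extendByZero f.1 ∘ φ.symm) (φ.target ∩ φ.symm ⁻¹' (V : Set M)) := by
  rw [← contMDiffOn_iff_contDiffOn]
  intro z hz
  exact (contMDiffAt_extendByZero f ⟨φ.symm z, hz.2⟩).comp_contMDiffWithinAt z
    ((contMDiffOn_symm_of_mem_maximalAtlas hφ).mono Set.inter_subset_left z hz)

theorem baseFunctions.sum_apply {ι : Type*} (s : Finset ι)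
    (f : ι → baseFunctions 𝕜 K k (n := n) V) (p : V) :
    (∑ i ∈ s, f i).1 p = ∑ i ∈ s, (f i).1 p := by
  have h : (∑ i ∈ s, f i).1 = ∑ i ∈ s, (f i).1 :=
    map_sum (baseFunctions 𝕜 K k (n := n) V).val f s
  rw [h, Finset.sum_apply]

/-- Near each point `p`, a function is `f(p) + ∑ i, (x^i - x^i(p)) g_i`. -/
theorem exists_hadamard_expansion (hk : ∞ ≤ k)
    (hφ : φ ∈ IsManifold.maximalAtlas 𝓘(𝕜, EuclideanSpace 𝕜 (Fin n)) k M)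
    (hV : (V : Set M) ⊆ φ.source) (f : baseFunctions 𝕜 K k (n := n) V) (p : V) :
    ∃ (W : Opens M) (hW : W ≤ V), p.1 ∈ W ∧ ∃ g : Fin n → baseFunctions 𝕜 K k (n := n) W,
      baseFunctions.restrict hW f = algebraMap K _ (f.1 p) +
        ∑ i, (baseCoord hφ (subset_trans hW hV) i -
          algebraMap K _ (algebraMap 𝕜 K (φ p.1 i))) * g i := by
  obtain ⟨r, hr, hrS, g, hg, hfg⟩ := hadamard hk (φ.isOpen_inter_preimage_symm V.isOpen)
    (apply_mem_localDomain hV p) (contDiffOn_localExpr hφ f)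
  let W : Opens M := ⟨φ.source ∩ φ ⁻¹' Metric.ball (φ p.1) r,
    φ.isOpen_inter_preimage Metric.isOpen_ball⟩
  have hW : W ≤ V := fun q hq => by
    have := (hrS hq.2).2
    rwa [Set.mem_preimage, φ.left_inv hq.1] at this
  have hgs : ∀ i, ContMDiff 𝓘(𝕜, EuclideanSpace 𝕜 (Fin n)) 𝓘(𝕜, K) k
      (fun q : W => g (φ q.1) (EuclideanSpace.single i 1)) := fun i q => by
    have h1 : ContDiffOn 𝕜 k (fun z => g z (EuclideanSpace.single i 1))
      (Metric.ball (φ p.1) r) := hg.clm_apply contDiffOn_const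
    exact ((h1.contDiffAt (Metric.isOpen_ball.mem_nhds q.2.2)).contMDiffAt).comp q
      (contMDiffAt_subtype_iff.2 (contMDiffAt_of_mem_maximalAtlas hφ q.2.1))
  refine ⟨W, hW, ⟨hV p.2, Metric.mem_ball_self hr⟩, fun i => ⟨_, hgs i⟩, ?_⟩
  apply Subtype.ext
  funext q
  have h1 := hfg (φ q.1) q.2.2
  rw [localExpr_apply hV, localExpr_apply hV f.1 ⟨q.1, hW q.2⟩] at h1
  change f.1 ⟨q.1, hW q.2⟩ = f.1 p + (∑ i, _ : baseFunctions 𝕜 K k (n := n) W).1 q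
  rw [h1, baseFunctions.sum_apply]
  congr 1
  have h2 : φ q.1 - φ p.1 = ∑ i, (φ q.1 i - φ p.1 i) • EuclideanSpace.single i (1 : 𝕜) := by
    ext j
    simp [Finset.sum_apply, Pi.single_apply]
  conv_lhs => rw [h2, map_sum]
  refine Finset.sum_congr rfl fun i _ => ?_
  change _ = (algebraMap 𝕜 K (φ q.1 i) - algebraMap 𝕜 K (φ p.1 i)) * _
  rw [map_smul, Algebra.smul_def, map_sub]

/-- A family of derivations, compatible with restrictions, that kills the coordinate functions is
zero: apply it to the Hadamard expansion at `p` and evaluate at `p`. -/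
theorem derivation_eq_zero_of_baseCoord (hk : ∞ ≤ k)
    (hφ : φ ∈ IsManifold.maximalAtlas 𝓘(𝕜, EuclideanSpace 𝕜 (Fin n)) k M)
    (hV : (V : Set M) ⊆ φ.source)
    (D : ∀ W : Opens M, W ≤ V →
      (baseFunctions 𝕜 K k (n := n) W →ₗ[K] baseFunctions 𝕜 K k (n := n) W))
    (hmul : ∀ W hW f g, D W hW (f * g) = D W hW f * g + f * D W hW g)
    (hres : ∀ W (hW : W ≤ V) f,
      D W hW (baseFunctions.restrict hW f) = baseFunctions.restrict hW (D V le_rfl f))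
    (hcoord : ∀ W hW i, D W hW (baseCoord hφ (subset_trans hW hV) i) = 0)
    (f : baseFunctions 𝕜 K k (n := n) V) : D V le_rfl f = 0 := by
  apply Subtype.ext
  funext p
  obtain ⟨W, hW, hpW, g, hg⟩ := exists_hadamard_expansion hk hφ hV f p
  have h1 : ∀ c : K, D W hW (algebraMap K _ c) = 0 := fun c => by
    have h := hmul W hW 1 1
    rw [mul_one, mul_one, one_mul] at h
    rw [Algebra.algebraMap_eq_smul_one, map_smul, left_eq_add.1 h, smul_zero]
  have h2 := congrArg (fun h => h.1 ⟨p.1, hpW⟩) (hres W hW f)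
  change _ = (D V le_rfl f).1 p at h2
  rw [← h2, hg, map_add, h1, zero_add, map_sum]
  change (∑ i, _ : baseFunctions 𝕜 K k (n := n) W).1 ⟨p.1, hpW⟩ = 0
  rw [baseFunctions.sum_apply]
  refine Finset.sum_eq_zero fun i _ => ?_
  rw [hmul, map_sub, hcoord, h1, sub_zero, zero_mul, zero_add]
  change (algebraMap 𝕜 K (φ p.1 i) - algebraMap 𝕜 K (φ p.1 i)) * _ = 0
  rw [sub_self, zero_mul]

variable [IsManifold 𝓘(𝕜, EuclideanSpace 𝕜 (Fin n)) k M]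

theorem differentiableAt_localExpr [hk : Fact (∞ ≤ k)]
    (hφ : φ ∈ IsManifold.maximalAtlas 𝓘(𝕜, EuclideanSpace 𝕜 (Fin n)) k M)
    (hV : (V : Set M) ⊆ φ.source) (f : baseFunctions 𝕜 K k (n := n) V) (p : V) :
    DifferentiableAt 𝕜 (extendByZero f.1 ∘ φ.symm) (φ p.1) :=
  ((contDiffOn_localExpr hφ f).contDiffAt ((φ.isOpen_inter_preimage_symm V.isOpen).mem_nhds
    (apply_mem_localDomain hV p))).differentiableAt (by
      rintro rfl
      simpa using hk.out)

/-- The partial derivative as a linear map. -/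
noncomputable def basePartialₗ [Fact (∞ ≤ k)]
    (hφ : φ ∈ IsManifold.maximalAtlas 𝓘(𝕜, EuclideanSpace 𝕜 (Fin n)) k M)
    (hV : (V : Set M) ⊆ φ.source) (a : Fin n) :
    baseFunctions 𝕜 K k (n := n) V →ₗ[K] baseFunctions 𝕜 K k (n := n) V where
  toFun := basePartial hφ hV a
  map_add' f g := by
    apply Subtype.ext
    funext p
    change fderiv 𝕜 (extendByZero (f + g).1 ∘ φ.symm) (φ p.1) (EuclideanSpace.single a 1) =
      fderiv 𝕜 (extendByZero f.1 ∘ φ.symm) (φ p.1) (EuclideanSpace.single a 1) +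
      fderiv 𝕜 (extendByZero g.1 ∘ φ.symm) (φ p.1) (EuclideanSpace.single a 1)
    have : (extendByZero (f + g).1 ∘ φ.symm) =
        extendByZero f.1 ∘ φ.symm + extendByZero g.1 ∘ φ.symm := by
      funext z
      by_cases hz : φ.symm z ∈ V <;> simp [extendByZero, hz]
    rw [this, fderiv_add (differentiableAt_localExpr hφ hV f p)
      (differentiableAt_localExpr hφ hV g p)]
    rfl
  map_smul' c f := by
    apply Subtype.ext
    funext p
    change fderiv 𝕜 (extendByZero (c • f).1 ∘ φ.symm) (φ p.1) (EuclideanSpace.single a 1) =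
      c • fderiv 𝕜 (extendByZero f.1 ∘ φ.symm) (φ p.1) (EuclideanSpace.single a 1)
    have : (extendByZero (c • f).1 ∘ φ.symm) = c • (extendByZero f.1 ∘ φ.symm) := by
      funext z
      by_cases hz : φ.symm z ∈ V <;> simp [extendByZero, hz]
    rw [this, fderiv_const_smul (differentiableAt_localExpr hφ hV f p)]
    rfl

theorem basePartial_mul [Fact (∞ ≤ k)]
    (hφ : φ ∈ IsManifold.maximalAtlas 𝓘(𝕜, EuclideanSpace 𝕜 (Fin n)) k M)
    (hV : (V : Set M) ⊆ φ.source) (a : Fin n) (f g : baseFunctions 𝕜 K k (n := n) V) :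
    basePartial hφ hV a (f * g) = basePartial hφ hV a f * g + f * basePartial hφ hV a g := by
  apply Subtype.ext
  funext p
  change fderiv 𝕜 (extendByZero (f * g).1 ∘ φ.symm) (φ p.1) (EuclideanSpace.single a 1) =
    fderiv 𝕜 (extendByZero f.1 ∘ φ.symm) (φ p.1) (EuclideanSpace.single a 1) * g.1 p +
    f.1 p * fderiv 𝕜 (extendByZero g.1 ∘ φ.symm) (φ p.1) (EuclideanSpace.single a 1)
  have : (extendByZero (f * g).1 ∘ φ.symm) =
      (extendByZero f.1 ∘ φ.symm) * (extendByZero g.1 ∘ φ.symm) := by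
    funext z
    by_cases hz : φ.symm z ∈ V <;> simp [extendByZero, hz]
  rw [this, fderiv_mul (differentiableAt_localExpr hφ hV f p)
    (differentiableAt_localExpr hφ hV g p), localExpr_apply hV, localExpr_apply hV]
  simp only [add_apply, smul_apply, smul_eq_mul]
  ring

theorem basePartial_restrict [Fact (∞ ≤ k)]
    (hφ : φ ∈ IsManifold.maximalAtlas 𝓘(𝕜, EuclideanSpace 𝕜 (Fin n)) k M)
    (hV : (V : Set M) ⊆ φ.source) {W : Opens M} (hW : W ≤ V) (a : Fin n)
    (f : baseFunctions 𝕜 K k (n := n) V) :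
    basePartial hφ (subset_trans hW hV) a (baseFunctions.restrict hW f) =
      baseFunctions.restrict hW (basePartial hφ hV a f) := by
  apply Subtype.ext
  funext p
  change fderiv 𝕜 (extendByZero (baseFunctions.restrict hW f).1 ∘ φ.symm) (φ p.1)
      (EuclideanSpace.single a 1) =
    fderiv 𝕜 (extendByZero f.1 ∘ φ.symm) (φ p.1) (EuclideanSpace.single a 1)
  rw [Filter.EventuallyEq.fderiv_eq]
  filter_upwards [(φ.isOpen_inter_preimage_symm W.isOpen).mem_nhds
    (apply_mem_localDomain (subset_trans hW hV) p)] with z hz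
  have h1 : φ.symm z ∈ W := hz.2
  simp [extendByZero, h1, hW h1, baseFunctions.restrict]

theorem basePartial_baseCoord [Fact (∞ ≤ k)]
    (hφ : φ ∈ IsManifold.maximalAtlas 𝓘(𝕜, EuclideanSpace 𝕜 (Fin n)) k M)
    (hV : (V : Set M) ⊆ φ.source) (a b : Fin n) :
    basePartial hφ hV a (baseCoord (K := K) hφ hV b) = if a = b then 1 else 0 := by
  apply Subtype.ext
  funext p
  change fderiv 𝕜 (extendByZero (baseCoord (K := K) hφ hV b).1 ∘ φ.symm) (φ p.1)
      (EuclideanSpace.single a 1) = _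
  have : (extendByZero (baseCoord (K := K) hφ hV b).1 ∘ φ.symm) =ᶠ[nhds (φ p.1)]
      (Algebra.linearMap 𝕜 K).toContinuousLinearMap.comp (EuclideanSpace.proj (𝕜 := 𝕜) b) := by
    filter_upwards [(φ.isOpen_inter_preimage_symm V.isOpen).mem_nhds
      (apply_mem_localDomain hV p)] with z hz
    have h1 : φ.symm z ∈ V := hz.2
    simp [extendByZero, h1, baseCoord, φ.right_inv hz.1]
  rw [this.fderiv_eq, ContinuousLinearMap.fderiv]
  by_cases h : a = b
  · subst h
    simp
  · simp [h, Ne.symm h]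

end BaseDerivations

/-! ### Derivations of the structure sheaf -/

section SheafDerivations

variable {G K : Type*} [AddCommGroup G] [DecidableEq G] [Field K] {ρ : CommutationFactor G K}
  {M : Type u} [TopologicalSpace M]

/-- A family `X V`, `V ≤ U`, of `ρ`-derivations of degree `δ` compatible with restrictions: a vector
field of degree `δ` on the open set `U`. -/
structure IsSheafDer (𝒪 : RhoSheaf.{u, v} ρ M) (U : Opens M) (δ : G)
    (X : ∀ V : Opens M, V ≤ U → (𝒪.obj V →ₗ[K] 𝒪.obj V)) : Prop where
  der : ∀ V hV, IsRhoDer ρ (𝒪.gr V) δ (X V hV)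
  app_res : ∀ {V W : Opens M} (hV : V ≤ U) (hW : W ≤ V) (f : 𝒪.obj V),
    X W (hW.trans hV) (𝒪.res hW f) = 𝒪.res hW (X V hV f)

variable {𝒪 : RhoSheaf.{u, v} ρ M} {U : Opens M} {δ ε : G}
  {X Y : ∀ V : Opens M, V ≤ U → (𝒪.obj V →ₗ[K] 𝒪.obj V)}

theorem RhoSheaf.isRhoComm (𝒪 : RhoSheaf.{u, v} ρ M) (U : Opens M) : IsRhoComm ρ (𝒪.gr U) :=
  𝒪.rho_comm U

namespace IsSheafDer

theorem sub (hX : IsSheafDer 𝒪 U δ X) (hY : IsSheafDer 𝒪 U δ Y) :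
    IsSheafDer 𝒪 U δ (fun V hV => X V hV - Y V hV) :=
  ⟨fun V hV => (hX.der V hV).sub (hY.der V hV), fun hV hW f => by
    simp only [LinearMap.sub_apply, hX.app_res hV hW, hY.app_res hV hW, map_sub]⟩

theorem sum {ι : Type*} (s : Finset ι)
    {Z : ι → ∀ V : Opens M, V ≤ U → (𝒪.obj V →ₗ[K] 𝒪.obj V)}
    (hZ : ∀ a ∈ s, IsSheafDer 𝒪 U δ (Z a)) : IsSheafDer 𝒪 U δ (fun V hV => ∑ a ∈ s, Z a V hV) :=
  ⟨fun V hV => IsRhoDer.sum s fun a ha => (hZ a ha).der V hV, fun hV hW f => by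
    simp only [LinearMap.sum_apply, map_sum]
    exact Finset.sum_congr rfl fun a ha => (hZ a ha).app_res hV hW f⟩

theorem smul_left (hX : IsSheafDer 𝒪 U δ X) {c : 𝒪.obj U} (hc : c ∈ 𝒪.gr U ε) :
    IsSheafDer 𝒪 U (ε + δ) (fun V hV => LinearMap.mulLeft K (𝒪.res hV c) ∘ₗ X V hV) :=
  ⟨fun V hV => (hX.der V hV).smul_left (𝒪.isRhoComm V) (𝒪.res_mem hV ε c hc), fun hV hW f => by
    simp only [LinearMap.comp_apply, LinearMap.mulLeft_apply, map_mul, hX.app_res hV hW,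
      𝒪.res_res]⟩

theorem commutator (hX : IsSheafDer 𝒪 U δ X) (hY : IsSheafDer 𝒪 U ε Y) :
    IsSheafDer 𝒪 U (δ + ε) (fun V hV => X V hV ∘ₗ Y V hV - ρ δ ε • Y V hV ∘ₗ X V hV) :=
  ⟨fun V hV => (hX.der V hV).commutator (hY.der V hV), fun hV hW f => by
    simp only [LinearMap.sub_apply, LinearMap.smul_apply, LinearMap.comp_apply, map_sub, map_smul,
      hX.app_res hV hW, hY.app_res hV hW]⟩

end IsSheafDer

end SheafDerivations

/-! ### Vector fields in coordinates -/

section Coordinates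

variable {𝕜 K : Type*} [RCLike 𝕜] [RCLike K] [NormedAlgebra 𝕜 K] {k : ℕ∞ω}
  {G : Type*} [AddCommGroup G] [DecidableEq G] {ρ : CommutationFactor G K}
  {n m : ℕ} {d : Fin m → G}
  {M : Type u} [TopologicalSpace M] [ChartedSpace (EuclideanSpace 𝕜 (Fin n)) M]
 {𝒪 : RhoSheaf.{u, v} ρ M}

namespace RhoChart

variable (x : RhoChart (𝕜 := 𝕜) (n := n) k d 𝒪) {V W : Opens M}

theorem iso_coord_base (hV : V ≤ x.dom) (a : Fin n) :
    x.iso V hV (x.coord hV (Fin.castAdd m a)) =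
      RhoSeries.monomial 0 (baseCoord x.φ_mem hV a) := by
  simp [coord]

theorem iso_coord_formal (hV : V ≤ x.dom) (b : Fin m) :
    x.iso V hV (x.coord hV (Fin.natAdd n b)) = RhoSeries.monomial (Finsupp.single b 1) 1 := by
  simp [coord]

theorem coord_mem (hV : V ≤ x.dom) (a : Fin (n + m)) :
    x.coord hV a ∈ 𝒪.gr V (coordDegree n d a) := by
  rw [x.iso_gr V hV]
  induction a using Fin.addCases with
  | left a =>
    rw [iso_coord_base, coordDegree, Fin.append_left]
    simpa [CommutationFactor.expDegree] using
      RhoSeries.isHomogeneous_monomial (ρ := ρ) (d := d) 0 (baseCoord (K := K) x.φ_mem hV a)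
  | right b =>
    rw [iso_coord_formal, coordDegree, Fin.append_right]
    simpa [CommutationFactor.expDegree_single] using
      RhoSeries.isHomogeneous_monomial (ρ := ρ) (d := d) (Finsupp.single b 1)
        (1 : baseFunctions 𝕜 K k (n := n) V)

theorem res_coord (hV : V ≤ x.dom) (hW : W ≤ V) (a : Fin (n + m)) :
    𝒪.res hW (x.coord hV a) = x.coord (hW.trans hV) a := by
  classical
  apply (x.iso W (hW.trans hV)).injective
  ext1 w
  rw [x.iso_res V W hV hW]
  induction a using Fin.addCases with
  | left a =>
    rw [iso_coord_base, iso_coord_base, RhoSeries.coeff_monomial, RhoSeries.coeff_monomial]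
    split_ifs <;> rfl
  | right b =>
    rw [iso_coord_formal, iso_coord_formal, RhoSeries.coeff_monomial, RhoSeries.coeff_monomial]
    split_ifs <;> rfl

variable [IsManifold 𝓘(𝕜, EuclideanSpace 𝕜 (Fin n)) k M] [Fact (∞ ≤ k)]

theorem iso_partialDeriv_base (hV : V ≤ x.dom) (a : Fin n) (f : 𝒪.obj V) :
    x.iso V hV (x.partialDeriv hV (Fin.castAdd m a) f) =
      RhoSeries.mapCoeff (basePartialₗ x.φ_mem hV a) (map_zero _) (x.iso V hV f) := by
  simp [partialDeriv]
  rfl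

theorem iso_partialDeriv_formal (hV : V ≤ x.dom) (b : Fin m) (f : 𝒪.obj V) :
    x.iso V hV (x.partialDeriv hV (Fin.natAdd n b) f) =
      RhoSeries.formalPartial b (x.iso V hV f) := by
  simp [partialDeriv]

/-- The partial derivative as a linear map. -/
noncomputable def partialDerivₗ (hV : V ≤ x.dom) (a : Fin (n + m)) : 𝒪.obj V →ₗ[K] 𝒪.obj V where
  toFun := x.partialDeriv hV a
  map_add' f g := by
    apply (x.iso V hV).injective
    ext1 w
    induction a using Fin.addCases with
    | left a => simp [iso_partialDeriv_base, RhoSeries.coeff_mapCoeff]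
    | right b => simp [iso_partialDeriv_formal, RhoSeries.coeff_formalPartial]
  map_smul' c f := by
    apply (x.iso V hV).injective
    ext1 w
    induction a using Fin.addCases with
    | left a => simp [iso_partialDeriv_base, RhoSeries.coeff_mapCoeff]
    | right b => simp [iso_partialDeriv_formal, RhoSeries.coeff_formalPartial, smul_comm c]

theorem partialDerivₗ_apply (hV : V ≤ x.dom) (a : Fin (n + m)) (f : 𝒪.obj V) :
    x.partialDerivₗ hV a f = x.partialDeriv hV a f := rfl

theorem isRhoDer_partialDeriv (hV : V ≤ x.dom) (a : Fin (n + m)) :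
    IsRhoDer ρ (𝒪.gr V) (-coordDegree n d a) (x.partialDerivₗ hV a) := by
  induction a using Fin.addCases with
  | left a =>
    rw [coordDegree, Fin.append_left, neg_zero]
    refine ⟨fun i f hf => ?_, fun i f g hf => ?_⟩
    · rw [zero_add, x.iso_gr V hV, partialDerivₗ_apply, iso_partialDeriv_base]
      intro w hw
      refine (x.iso_gr V hV i f).1 hf w fun h => hw ?_
      rw [RhoSeries.coeff_mapCoeff, h, map_zero]
    · apply (x.iso V hV).injective
      simp only [partialDerivₗ_apply, iso_partialDeriv_base, map_mul, map_add,
        ρ.map_zero_left, one_smul]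
      exact RhoSeries.mapCoeff_mul _ (basePartial_mul x.φ_mem hV a) _ _
  | right b =>
    rw [coordDegree, Fin.append_right]
    refine ⟨fun i f hf => ?_, fun i f g hf => ?_⟩
    · rw [x.iso_gr V hV, partialDerivₗ_apply, iso_partialDeriv_formal]
      exact RhoSeries.formalPartial_isHomogeneous b ((x.iso_gr V hV i f).1 hf)
    · apply (x.iso V hV).injective
      simp only [partialDerivₗ_apply, iso_partialDeriv_formal, map_mul, map_add, map_smul]
      exact RhoSeries.formalPartial_mul b ((x.iso_gr V hV i f).1 hf) _

theorem partialDeriv_coord (hV : V ≤ x.dom) (a b : Fin (n + m)) :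
    x.partialDeriv hV a (x.coord hV b) = if a = b then 1 else 0 := by
  apply (x.iso V hV).injective
  rw [apply_ite (x.iso V hV), map_one, map_zero]
  induction a using Fin.addCases with
  | left a =>
    induction b using Fin.addCases with
    | left b =>
      rw [iso_partialDeriv_base, iso_coord_base, RhoSeries.mapCoeff_monomial]
      refine (congrArg (RhoSeries.monomial 0) (basePartial_baseCoord x.φ_mem hV a b)).trans ?_
      by_cases h : a = b
      · subst h
        simp [RhoSeries.monomial_zero_one]
      · simp [h, RhoSeries.monomial_zero]
    | right b =>
      rw [iso_partialDeriv_base, iso_coord_formal, RhoSeries.mapCoeff_monomial]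
      change RhoSeries.monomial _ (basePartial x.φ_mem hV a 1) = _
      have h1 := basePartial_mul x.φ_mem (K := K) hV a 1 1
      rw [mul_one, mul_one, one_mul, left_eq_add] at h1
      have h2 : Fin.castAdd m a ≠ Fin.natAdd n b := fun h => by
        have := congrArg Fin.val h
        simp at this
        omega
      rw [h1, if_neg h2]
      simp [RhoSeries.monomial_zero]
  | right a =>
    induction b using Fin.addCases with
    | left b =>
      have h2 : Fin.natAdd n a ≠ Fin.castAdd m b := fun h => by
        have := congrArg Fin.val h
        simp at this
        omega
      rw [iso_partialDeriv_formal, iso_coord_base, RhoSeries.formalPartial_monomial_zero, if_neg h2]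
    | right b =>
      rw [iso_partialDeriv_formal, iso_coord_formal, RhoSeries.formalPartial_single]
      simp

theorem isSheafDer_partialDeriv (hU : V ≤ x.dom) (a : Fin (n + m)) :
    IsSheafDer 𝒪 V (-coordDegree n d a) (fun _ hW => x.partialDerivₗ (hW.trans hU) a) := by
  refine ⟨fun W hW => x.isRhoDer_partialDeriv _ a, fun {V' _} hV hW f => ?_⟩
  have hV' := hV.trans hU
  apply (x.iso _ (hW.trans hV')).injective
  ext1 w
  rw [x.iso_res V' _ hV' hW]
  simp only [partialDerivₗ_apply]
  induction a using Fin.addCases with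
  | left a =>
    rw [iso_partialDeriv_base, iso_partialDeriv_base, RhoSeries.coeff_mapCoeff,
      RhoSeries.coeff_mapCoeff, x.iso_res V' _ hV' hW]
    exact basePartial_restrict x.φ_mem hV' hW a _
  | right b =>
    rw [iso_partialDeriv_formal, iso_partialDeriv_formal, RhoSeries.coeff_formalPartial,
      RhoSeries.coeff_formalPartial, x.iso_res V' _ hV' hW]
    rfl

end RhoChart

end Coordinates

section CoordinateFrames

variable {𝕜 K : Type*} [RCLike 𝕜] [RCLike K] [NormedAlgebra 𝕜 K] {k : ℕ∞ω}
  {G : Type*} [AddCommGroup G] [DecidableEq G] {ρ : CommutationFactor G K}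
  {n m : ℕ} {d : Fin m → G}
  {M : Type u} [TopologicalSpace M] [ChartedSpace (EuclideanSpace 𝕜 (Fin n)) M]
  [Fact (∞ ≤ k)]
  {𝒪 : RhoSheaf.{u, v} ρ M} {U : Opens M} {δ : G}
  {X : ∀ V : Opens M, V ≤ U → (𝒪.obj V →ₗ[K] 𝒪.obj V)}

/-- A vector field on a coordinate neighbourhood that kills the coordinates is zero. On functions of
the even coordinates `x^1, …, x^n` each of its coefficients is a derivation of functions on the
underlying manifold. -/
theorem IsSheafDer.eq_zero_of_coord (hX : IsSheafDer 𝒪 U δ X)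
    (x : RhoChart (𝕜 := 𝕜) (n := n) k d 𝒪) (hU : U ≤ x.dom)
    (h : ∀ V hV a, X V hV (x.coord (hV.trans hU) a) = 0) (f : 𝒪.obj U) : X U le_rfl f = 0 := by
  classical
  have hsymm : ∀ (V : Opens M) (hV : V ≤ U) r, (x.iso V (hV.trans hU)).symm
      (RhoSeries.monomial 0 r) ∈ 𝒪.gr V 0 := fun V hV r => by
    rw [x.iso_gr V (hV.trans hU), AlgEquiv.apply_symm_apply]
    simpa [CommutationFactor.expDegree] using
      RhoSeries.isHomogeneous_monomial (ρ := ρ) (d := d) 0 r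
  -- `X` kills the functions on the underlying manifold, coefficient by coefficient.
  have hbase : ∀ r, X U le_rfl ((x.iso U hU).symm (RhoSeries.monomial 0 r)) = 0 := by
    intro r
    apply (x.iso U hU).injective
    ext1 w
    rw [map_zero, RhoSeries.coeff_zero]
    refine derivation_eq_zero_of_baseCoord Fact.out x.φ_mem hU (fun V hV =>
      { toFun := fun r => (x.iso V (hV.trans hU)
          (X V hV ((x.iso V (hV.trans hU)).symm (RhoSeries.monomial 0 r)))).coeff w
        map_add' := fun r s => by
          rw [RhoSeries.monomial_add, map_add, map_add, map_add, RhoSeries.coeff_add]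
        map_smul' := fun c r => by
          rw [RhoSeries.monomial_smul, map_smul, map_smul, map_smul, RhoSeries.coeff_smul]
          rfl }) ?_ ?_ ?_ r
    · intro V hV r s
      simp only [LinearMap.coe_mk, AddHom.coe_mk]
      rw [RhoSeries.monomial_zero_mul, map_mul, (hX.der V hV).leibniz_zero (hsymm V hV r),
        map_add, map_mul, map_mul, AlgEquiv.apply_symm_apply, AlgEquiv.apply_symm_apply,
        RhoSeries.coeff_add, RhoSeries.coeff_mul_monomial_zero, RhoSeries.coeff_monomial_zero_mul]
    · intro V hV r
      simp only [LinearMap.coe_mk, AddHom.coe_mk]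
      rw [← x.iso_res U V hU hV, ← hX.app_res le_rfl hV]
      congr 4
      apply (x.iso V (hV.trans hU)).injective
      ext1 w'
      rw [AlgEquiv.apply_symm_apply, x.iso_res U V hU hV, AlgEquiv.apply_symm_apply,
        RhoSeries.coeff_monomial, RhoSeries.coeff_monomial]
      split_ifs <;> rfl
    · intro V hV i
      simp only [LinearMap.coe_mk, AddHom.coe_mk]
      have := h V hV (Fin.castAdd m i)
      rw [← (x.iso V (hV.trans hU)).symm_apply_apply (x.coord _ _), x.iso_coord_base] at this
      refine (congrArg (fun t => (x.iso V (hV.trans hU) t).coeff w) this).trans ?_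
      rw [map_zero, RhoSeries.coeff_zero]
  -- Multiplication by `x^(n+b)`, which `X` kills, commutes with `X` up to the
  -- scalar `ρ(δ, |x^(n+b)|)`.
  have hser := RhoSeries.eq_zero_of_single_mul
    (((x.iso U hU).toLinearMap ∘ₗ X U le_rfl ∘ₗ (x.iso U hU).symm.toLinearMap).toAddMonoidHom)
    (fun b => ρ δ (d b)) (fun b f => by
      simp only [LinearMap.toAddMonoidHom_coe, LinearMap.comp_apply, AlgEquiv.toLinearMap_apply]
      rw [map_mul, ← x.iso_coord_formal hU b, AlgEquiv.symm_apply_apply,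
        (hX.der U le_rfl).leibniz _ _ _ (x.coord_mem hU _), h U le_rfl, zero_mul, zero_add,
        map_smul, map_mul, coordDegree, Fin.append_right])
    (fun r => by
      simp only [LinearMap.toAddMonoidHom_coe, LinearMap.comp_apply, AlgEquiv.toLinearMap_apply]
      rw [hbase, map_zero]) (x.iso U hU f)
  simp only [LinearMap.toAddMonoidHom_coe, LinearMap.comp_apply, AlgEquiv.toLinearMap_apply,
    AlgEquiv.symm_apply_apply] at hser
  exact (x.iso U hU).injective (hser.trans (map_zero _).symm)

variable [IsManifold 𝓘(𝕜, EuclideanSpace 𝕜 (Fin n)) k M]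

/-- A vector field on a coordinate neighbourhood is `∑ a, X(x^a) ∂/∂x^a`. -/
theorem IsSheafDer.expandsIn (hX : IsSheafDer 𝒪 U δ X)
    (x : RhoChart (𝕜 := 𝕜) (n := n) k d 𝒪) (hU : U ≤ x.dom) :
    ExpandsIn (x.coord hU) (x.partialDerivₗ hU) (X U le_rfl) := by
  intro f
  -- The difference of `X` and its expansion kills the coordinates.
  have hsum : IsSheafDer 𝒪 U δ (fun V hV => ∑ a, LinearMap.mulLeft K
      (𝒪.res hV (X U le_rfl (x.coord hU a))) ∘ₗ x.partialDerivₗ (hV.trans hU) a) := by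
    refine IsSheafDer.sum _ fun a _ => ?_
    have h1 := (x.isSheafDer_partialDeriv hU a).smul_left
      ((hX.der U le_rfl).map_mem _ _ (x.coord_mem hU a))
    rwa [add_neg_cancel_right] at h1
  have h0 := (hX.sub hsum).eq_zero_of_coord x hU (fun V hV b => by
    simp only [LinearMap.sub_apply, LinearMap.sum_apply, LinearMap.comp_apply,
      LinearMap.mulLeft_apply, RhoChart.partialDerivₗ_apply, x.partialDeriv_coord]
    rw [← x.res_coord hU hV b, hX.app_res le_rfl hV]
    simp) f
  simp only [LinearMap.sub_apply, LinearMap.sum_apply, LinearMap.comp_apply,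
    LinearMap.mulLeft_apply, 𝒪.res_self] at h0
  exact sub_eq_zero.1 h0

/-- The partial derivatives `ρ`-commute, because their `ρ`-commutators kill the coordinates. -/
theorem RhoChart.isCoordFrame (x : RhoChart (𝕜 := 𝕜) (n := n) k d 𝒪) (hU : U ≤ x.dom) :
    IsCoordFrame ρ (𝒪.gr U) (coordDegree n d) (x.coord hU) (x.partialDerivₗ hU) where
  mem := x.coord_mem hU
  der := x.isRhoDer_partialDeriv hU
  apply_coord := x.partialDeriv_coord hU
  comm a b f := by
    have h0 := ((x.isSheafDer_partialDeriv hU a).commutator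
      (x.isSheafDer_partialDeriv hU b)).eq_zero_of_coord x hU (fun V hV c => by
        have hone : ∀ a b c, x.partialDerivₗ (hV.trans hU) a
            (x.partialDerivₗ (hV.trans hU) b (x.coord (hV.trans hU) c)) = 0 := fun a b c => by
          rw [x.partialDerivₗ_apply _ b, x.partialDeriv_coord]
          split_ifs
          · exact (x.isRhoDer_partialDeriv _ a).map_one
          · exact map_zero _
        simp only [LinearMap.sub_apply, LinearMap.smul_apply, LinearMap.comp_apply]
        rw [hone, hone, smul_zero, sub_zero]) f
    simp only [LinearMap.sub_apply, LinearMap.smul_apply, LinearMap.comp_apply,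
      ρ.map_neg_left, ρ.map_neg_right, inv_inv] at h0
    exact sub_eq_zero.1 h0

end CoordinateFrames

/-! ### Sheaves of graded algebras: separation and gluing -/

namespace RhoSheaf

variable {G K : Type*} [AddCommGroup G] [DecidableEq G] [Field K] {ρ : CommutationFactor G K}
  {M : Type u} [TopologicalSpace M] (𝒪 : RhoSheaf.{u, v} ρ M) {U V : Opens M}

theorem res_decompose (h : V ≤ U) (f : 𝒪.obj U) (i : G) :
    𝒪.res h (DirectSum.decompose (𝒪.gr U) f i) =
      DirectSum.decompose (𝒪.gr V) (𝒪.res h f) i := by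
  induction f using DirectSum.Decomposition.inductionOn (𝒪.gr U) with
  | zero => simp
  | @homogeneous j f =>
    have hf := 𝒪.res_mem h j _ f.2
    by_cases hij : j = i
    · subst hij
      rw [DirectSum.decompose_of_mem_same _ f.2, DirectSum.decompose_of_mem_same _ hf]
    · rw [DirectSum.decompose_of_mem_ne _ f.2 hij, DirectSum.decompose_of_mem_ne _ hf hij, map_zero]
  | add f g hf hg =>
    simp only [DirectSum.decompose_add, DirectSum.add_apply, Submodule.coe_add, map_add, hf, hg]

/-- Sections that agree on a covering are equal. Gluing concerns sections of one degree, but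
restrictions commute with the projections to the homogeneous components. -/
theorem eq_of_res_eq {ι : Type u} {W : ι → Opens M} (hW : ∀ a, W a ≤ U)
    (hU : ∀ p ∈ U, ∃ a, p ∈ W a) {f g : 𝒪.obj U} (h : ∀ a, 𝒪.res (hW a) f = 𝒪.res (hW a) g) :
    f = g := by
  have hsup : iSup W = U := le_antisymm (iSup_le hW) fun p hp => Opens.mem_iSup.2 (hU p hp)
  subst hsup
  have key : ∀ i, (DirectSum.decompose (𝒪.gr (iSup W)) f i : 𝒪.obj (iSup W)) =
      DirectSum.decompose (𝒪.gr (iSup W)) g i := fun i =>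
    (𝒪.glue i W (fun a => 𝒪.res (le_iSup W a) (DirectSum.decompose (𝒪.gr (iSup W)) f i))
      (fun a => 𝒪.res_mem _ _ _ (SetLike.coe_mem _))
      (fun a b => by rw [𝒪.res_res, 𝒪.res_res])).unique
      ⟨SetLike.coe_mem _, fun a => rfl⟩
      ⟨SetLike.coe_mem _, fun a => by rw [res_decompose, res_decompose, h a]⟩
  apply (DirectSum.decompose (𝒪.gr (iSup W))).injective
  ext i
  exact key i

theorem eq_of_locally_eq {f g : 𝒪.obj U}
    (h : ∀ p ∈ U, ∃ (V : Opens M) (hV : V ≤ U), p ∈ V ∧ 𝒪.res hV f = 𝒪.res hV g) : f = g := by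
  choose W hW hp hfg using fun p : U => h p.1 p.2
  exact 𝒪.eq_of_res_eq hW (fun p hpU => ⟨⟨p, hpU⟩, hp ⟨p, hpU⟩⟩) hfg

theorem exists_glue {ι : Type u} {W : ι → Opens M} (hW : ∀ a, W a ≤ U)
    (hU : ∀ p ∈ U, ∃ a, p ∈ W a) {i : G} {s : ∀ a, 𝒪.obj (W a)} (hs : ∀ a, s a ∈ 𝒪.gr (W a) i)
    (h : ∀ a b, 𝒪.res (inf_le_left : W a ⊓ W b ≤ W a) (s a) = 𝒪.res inf_le_right (s b)) :
    ∃ t ∈ 𝒪.gr U i, ∀ a, 𝒪.res (hW a) t = s a := by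
  have hsup : iSup W = U := le_antisymm (iSup_le hW) fun p hp => Opens.mem_iSup.2 (hU p hp)
  subst hsup
  obtain ⟨t, ht, -⟩ := 𝒪.glue i W s hs h
  exact ⟨t, ht⟩

end RhoSheaf

/-! ### The divergence of a vector field -/

namespace RhoVectorField

variable {𝕜 K : Type*} [RCLike 𝕜] [RCLike K] [NormedAlgebra 𝕜 K] {k : ℕ∞ω} [Fact (∞ ≤ k)]
  {G : Type*} [AddCommGroup G] [DecidableEq G] {ρ : CommutationFactor G K}
  {n m : ℕ} {d : Fin m → G}
  {M : Type u} [TopologicalSpace M] [ChartedSpace (EuclideanSpace 𝕜 (Fin n)) M]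
  [IsManifold 𝓘(𝕜, EuclideanSpace 𝕜 (Fin n)) k M]
  {𝒪 : RhoSheaf.{u, v} ρ M} {δ : G} (X : RhoVectorField 𝒪 δ)
  (vol : RhoVolumeForm (𝕜 := 𝕜) (n := n) k d 𝒪) (x y : RhoChart (𝕜 := 𝕜) (n := n) k d 𝒪)

theorem isSheafDer (U : Opens M) : IsSheafDer 𝒪 U δ (fun V _ => X.app V) :=
  ⟨fun V _ => ⟨X.app_mem V, X.leibniz V⟩, fun _ hW f => X.app_res hW f⟩

theorem res_lieDerivCoord {V : Opens M} (hV : V ≤ x.dom) (s : 𝒪.obj x.dom) :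
    𝒪.res hV (X.lieDerivCoord x s) = frameLie ρ (coordDegree n d) (x.coord hV)
      (x.partialDerivₗ hV) δ (X.app V) (𝒪.res hV s) := by
  simp only [lieDerivCoord, frameLie, map_sum, map_smul]
  refine Finset.sum_congr rfl fun a _ => ?_
  rw [← x.res_coord le_rfl hV, X.app_res, ← map_mul]
  exact congrArg _ ((x.isSheafDer_partialDeriv le_rfl a).app_res le_rfl hV _).symm

/-- The Berezinian of a change of coordinates is the quotient of two local expressions of the volume
form. In particular the junk value `0` of `rhoBer` does not occur. -/
theorem isUnit_rhoBer_jacobian (vol : RhoVolumeForm (𝕜 := 𝕜) (n := n) k d 𝒪)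
    (x y : RhoChart (𝕜 := 𝕜) (n := n) k d 𝒪) :
    IsUnit (rhoBer ρ (fun a => -coordDegree n d a) (x.jacobian y)) := by
  obtain ⟨u, hu⟩ := (vol.s_isUnit x).map (𝒪.res (inf_le_left : x.dom ⊓ y.dom ≤ x.dom))
  obtain ⟨w, hw⟩ := (vol.s_isUnit y).map (𝒪.res (inf_le_right : x.dom ⊓ y.dom ≤ y.dom))
  have h := vol.compat x y
  rw [← hu, ← hw] at h
  exact ⟨u * w⁻¹, by rw [Units.val_mul, h, mul_assoc, w.mul_inv, mul_one]⟩

/-- The equation `vol · f = L_X vol` does not depend on the coordinates: if it holds for `y` on the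
intersection of two coordinate neighbourhoods, then also for `x`. -/
theorem divergence_eq_of_overlap {f : 𝒪.obj (x.dom ⊓ y.dom)}
    (h : 𝒪.res inf_le_right (vol.s y) * f = 𝒪.res inf_le_right (X.lieDerivCoord y (vol.s y))) :
    𝒪.res inf_le_left (vol.s x) * f = 𝒪.res inf_le_left (X.lieDerivCoord x (vol.s x)) := by
  have hx := x.isCoordFrame (U := x.dom ⊓ y.dom) inf_le_left
  have hy := y.isCoordFrame (U := x.dom ⊓ y.dom) inf_le_right
  have hX := X.isSheafDer (x.dom ⊓ y.dom)
  rw [res_lieDerivCoord] at h ⊢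
  rw [vol.compat x y, IsCoordFrame.frameLie_rhoBer (J := x.jacobian y) (𝒪.isRhoComm _) hx hy
    (fun a => (x.isSheafDer_partialDeriv inf_le_left a).expandsIn y inf_le_right)
    (fun a => (y.isSheafDer_partialDeriv inf_le_right a).expandsIn x inf_le_left)
    (hX.der _ le_rfl) (hX.expandsIn x inf_le_left) (hX.expandsIn y inf_le_right) (fun _ _ => rfl)
    (isUnit_rhoBer_jacobian vol x y), mul_assoc, h]

/-- In each coordinate system there is a local divergence, and it has the degree of `X`. -/
theorem exists_local_divergence :
    ∃ f ∈ 𝒪.gr x.dom δ, vol.s x * f = X.lieDerivCoord x (vol.s x) := by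
  obtain ⟨u, hu⟩ := vol.s_isUnit x
  have hs := vol.s_mem x
  rw [← hu] at hs ⊢
  have h1 := (x.isCoordFrame le_rfl).frameLie_mem ((X.isSheafDer x.dom).der _ le_rfl) hs
  have h2 := SetLike.GradedMul.mul_mem (inv_mem_zero hs u.mul_inv u.inv_mul) h1
  rw [zero_add] at h2
  refine ⟨_, h2, ?_⟩
  rw [← mul_assoc, u.mul_inv, one_mul]
  rfl

variable {X vol} in
theorem IsDivergence.unique (h𝒪 : IsRhoManifold (𝕜 := 𝕜) (n := n) k d 𝒪) {f g : 𝒪.obj ⊤}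
    (hf : IsDivergence vol X f) (hg : IsDivergence vol X g) : f = g :=
  𝒪.eq_of_locally_eq fun p _ => by
    obtain ⟨x, hx⟩ := h𝒪.exists_chart p
    exact ⟨x.dom, le_top, hx, (vol.s_isUnit x).mul_left_cancel ((hf x).trans (hg x).symm)⟩

/-- The local divergences agree on overlaps, so they define a global one. -/
theorem exists_isDivergence (h𝒪 : IsRhoManifold (𝕜 := 𝕜) (n := n) k d 𝒪) :
    ∃ f ∈ 𝒪.gr ⊤ δ, IsDivergence vol X f := by
  choose x hx using h𝒪.exists_chart
  choose g hg hgx using X.exists_local_divergence vol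
  have hres : ∀ (y : RhoChart (𝕜 := 𝕜) (n := n) k d 𝒪) {V : Opens M} (hV : V ≤ y.dom),
      𝒪.res hV (vol.s y) * 𝒪.res hV (g y) = 𝒪.res hV (X.lieDerivCoord y (vol.s y)) :=
    fun y V hV => by rw [← map_mul, hgx]
  obtain ⟨f, hf, hfx⟩ := 𝒪.exists_glue (U := ⊤) (W := fun p => (x p).dom) (fun _ => le_top)
    (fun p _ => ⟨p, hx p⟩) (fun p => hg (x p)) (fun p q =>
      ((vol.s_isUnit (x p)).map (𝒪.res inf_le_left)).mul_left_cancel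
        ((hres (x p) inf_le_left).trans
          (X.divergence_eq_of_overlap vol (x p) (x q) (hres (x q) inf_le_right)).symm))
  refine ⟨f, hf, fun y => 𝒪.eq_of_locally_eq fun p hp => ⟨y.dom ⊓ (x p).dom, inf_le_left,
    ⟨hp, hx p⟩, ?_⟩⟩
  rw [map_mul, 𝒪.res_res]
  refine X.divergence_eq_of_overlap vol y (x p) ?_
  rw [← hres (x p) inf_le_right, ← hfx p, 𝒪.res_res]

variable {X vol} in
theorem IsHomological.app_app (hX : X.IsHomological) (U : Opens M) (f : 𝒪.obj U) :
    X.app U (X.app U f) = 0 := by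
  have h := hX.bracket_self U f
  rw [hX.odd, neg_one_smul, sub_neg_eq_add, ← two_smul K] at h
  exact (smul_eq_zero.1 h).resolve_left two_ne_zero

variable {X vol} in
/-- A homological vector field kills its divergence; this is local. -/
theorem IsDivergence.app_eq_zero (h𝒪 : IsRhoManifold (𝕜 := 𝕜) (n := n) k d 𝒪)
    (hX : X.IsHomological) {f : 𝒪.obj ⊤} (hf : IsDivergence vol X f) : X.app ⊤ f = 0 :=
  𝒪.eq_of_locally_eq fun p _ => by
    obtain ⟨x, hx⟩ := h𝒪.exists_chart p
    refine ⟨x.dom, le_top, hx, ?_⟩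
    have hd := X.isSheafDer x.dom
    rw [← X.app_res, map_zero]
    exact (x.isCoordFrame le_rfl).map_divergence (𝒪.isRhoComm _) (hd.der _ le_rfl)
      (hd.expandsIn x le_rfl) hX.odd (hX.app_app x.dom) (vol.s_mem x) (vol.s_isUnit x) (hf x)

end RhoVectorField

theorem mainTheorem2 {𝕜 K : Type*} [RCLike 𝕜] [RCLike K] [NormedAlgebra 𝕜 K]
    (k : ℕ∞ω) [Fact (∞ ≤ k)]
    {G : Type*} [AddCommGroup G] [DecidableEq G] (ρ : CommutationFactor G K)
    {n m : ℕ} (d : Fin m → G)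
    {M : Type u} [TopologicalSpace M] [ChartedSpace (EuclideanSpace 𝕜 (Fin n)) M]
    [IsManifold 𝓘(𝕜, EuclideanSpace 𝕜 (Fin n)) k M]
    (𝒪 : RhoSheaf.{u, v} ρ M) (h𝒪 : IsRhoManifold (𝕜 := 𝕜) (n := n) k d 𝒪)
    {δ : G} (Q : RhoVectorField 𝒪 δ) (hQ : Q.IsHomological)
    (vol : RhoVolumeForm (𝕜 := 𝕜) (n := n) k d 𝒪) :
    (∃! f : 𝒪.obj ⊤, RhoVectorField.IsDivergence vol Q f) ∧
    (∀ f : 𝒪.obj ⊤, RhoVectorField.IsDivergence vol Q f →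
      f ∈ 𝒪.gr ⊤ δ ∧ Q.app ⊤ f = 0) ∧
    (∃! c : Q.Cohomology 1, ∀ f : 𝒪.obj ⊤, RhoVectorField.IsDivergence vol Q f →
      ∃ hf : f ∈ Q.cocycles 1, Submodule.Quotient.mk ⟨f, hf⟩ = c) := by
  obtain ⟨f, hfδ, hf⟩ := Q.exists_isDivergence vol h𝒪
  have hQf : Q.app ⊤ f = 0 := hf.app_eq_zero h𝒪 hQ
  have huniq : ∀ g, RhoVectorField.IsDivergence vol Q g → g = f := fun g hg => hg.unique h𝒪 hf
  have hfc : f ∈ Q.cocycles 1 :=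
    ⟨by rw [one_zsmul]; exact hfδ, LinearMap.mem_ker.2 hQf⟩
  refine ⟨⟨f, hf, huniq⟩, fun g hg => ?_, ⟨Submodule.Quotient.mk ⟨f, hfc⟩, fun g hg => ?_,
    fun c hc => ?_⟩⟩
  · rw [huniq g hg]
    exact ⟨hfδ, hQf⟩
  · obtain rfl := huniq g hg
    exact ⟨hfc, rfl⟩
  · obtain ⟨_, h⟩ := hc f hf
    exact h.symm
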